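/- Setting. Let $\mathbb N=\{1,2,\dots\}$, let $\ell^2$ be the real Hilbert space of square-summable sequences $\mathbf x=(x_i)_{i\in\mathbb N}$ with standard unit vectors $\mathbf e_i$, and let $B_r(\mathbf x)$ denote its open balls. Fix positive numbers $a_i$ $(i\in\mathbb N)$ with $\sum_i a_i<1$, and let $P$ be the probability measure on $\ell^2$ obtained by restricting to $\ell^2$ the infinite product of the centred Gaussian measures on $\mathbb R$ with variances $a_i^2$. Let $m\in\mathbb N$ and $1\le p<\infty$. For a nonempty open set $U\subset\ell^2$, a function $\varphi:U\to\mathbb R$ is F-continuous if for all $\mathbf x\in U$ and $l\in\mathbb N$ the map $(s_1,\dots,s_l)\mapsto\varphi(\mathbf x+s_1\mathbf e_1+\cdots+s_l\mathbf e_l)$ is continuous where it is defined. Write $D_{x_i}\varphi(\mathbf x)=\lim_{t\to0}(\varphi(\mathbf x+t\mathbf e_i)-\varphi(\mathbf x))/t$ and $D^k_{x_{i_1}\cdots x_{i_k}}=D_{x_{i_1}}\circ\cdots\circ D_{x_{i_k}}$. The space $C^\infty_{\mathcal F}(U)$ of test functions consists of all F-continuous Borel functions $\varphi:U\to\mathbb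 R$ such that all partial derivatives of all orders exist and are bounded, F-continuous and Borel measurable on $U$; $\sup_U\sum_{i_1,\dots,i_k}a_{i_1}^2\cdots a_{i_k}^2|D^k_{x_{i_1}\cdots x_{i_k}}\varphi|^2<\infty$ for all $k\in\mathbb N$; and for some $r,R\in(0,\infty)$ the set $\{\varphi\ne0\}$ is contained in $B_R(\mathbf 0)$ and $B_r(\mathbf x)\subset U$ for every $\mathbf x$ in it. Put $D_{x_i}^*\varphi=-D_{x_i}\varphi+\frac{x_i}{a_i^2}\varphi$. For $f\in L^p(U,P)$, a function $g\in L^p(U,P)$ is the weak derivative $D^k_{x_{i_1}\cdots x_{i_k}}f$ on $U$ if $$\int_U g\,\varphi\,dP=\int_U f\cdot(D^*_{x_{i_k}}\circ\cdots\circ D^*_{x_{i_1}})\varphi\,dP\qquad\text{for all }\varphi\in C^\infty_{\mathcal F}(U).$$ The space $W^{m,p}(U)$ consists of the $f\in L^p(U,P)$ that have weak derivatives $D^k_{x_{i_1}\cdots x_{i_k}}f\in L^p(U,P)$ for all $1\le k\le m$ and all $i_1,\dots,i_k\in\mathbb N$, and for which $$\|f\|_{W^{m,p}(U)}=\Big(\int_U|f|^p\,dP+\sum_{k=1}^m\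 \sum_{i_1,\dots,i_k=1}^\infty a_{i_1}^p\cdots a_{i_k}^p\int_U|D^k_{x_{i_1}\cdots x_{i_k}}f|^p\,dP\Big)^{1/p}<\infty .$$ For $f\in L^p(U,P)$, $\operatorname{supp}f$ is $U$ minus the union of all open balls $B\subset U$ with $\int_B|f|^p\,dP=0$. Let $\mathscr C_c^\infty$ be the set of functions $\mathbf x\mapsto u(x_1,\dots,x_n)$ on $\ell^2$ with $n\in\mathbb N$ and $u\in C_c^\infty(\mathbb R^n)$. Proposition. Let $O\subset\ell^2$ be open, let $\mathbb H=\{\mathbf x\in\ell^2:x_1>0\}$, and let $\mathbf x_0\in(\partial\mathbb H)\cap O$. Let $f\in W^{m,p}(\mathbb H\cap O)$, and suppose that there are $0<r_1<r_2<\infty$ with $$\operatorname{supp}f\subset B_{r_1}(\mathbf x_0),\qquad B_{r_2}(\mathbf x_0)\cap\mathbb H\subset O.$$ Let $\tilde f$ be the extension of $f$ by zero from $\mathbb H\cap O$ to $\mathbb H$. Then: (1) $\tilde f\in W^{m,p}(\mathbb H)$. (2) For every $k=1,\dots,m$ and all $i_1,\dots,i_k\in\mathbb N$, the weak derivative $D^k_{x_{i_1}\cdots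 x_{i_k}}\tilde f$ on $\mathbb H$ equals, $P$-almost everywhere on $\mathbb H$, the extension by zero from $\mathbb H\cap O$ to $\mathbb H$ of the weak derivative $D^k_{x_{i_1}\cdots x_{i_k}}f$ on $\mathbb H\cap O$. (3) There is a sequence $(\varphi_j)_{j\ge1}$ in $\mathscr C_c^\infty$ with $\varphi_j-f\in W^{m,p}(\mathbb H\cap O)$ for all $j$ and $\lim_{j\to\infty}\|\varphi_j-f\|_{W^{m,p}(\mathbb H\cap O)}=0$. -/

import Mathlib

open Set Filter Topology MeasureTheory
open scoped ENNReal ContDiff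

noncomputable section

/-- The real Hilbert space `ℓ²` of square-summable sequences. Coordinates are numbered from `0`, so
that `x 0` is the first coordinate. -/
abbrev Ell2 : Type := lp (fun _ : ℕ => ℝ) 2

namespace Ell2

instance instMeasurableSpace : MeasurableSpace Ell2 := borel Ell2

instance instBorelSpace : BorelSpace Ell2 := ⟨rfl⟩

/-- The standard unit vectors. -/
def e (i : ℕ) : Ell2 := lp.single 2 i (1 : ℝ)

/-- The half-space of points whose first coordinate is positive. -/
def halfSpace : Set Ell2 := {x | 0 < x 0}

/-- The Gaussian measure `P`: the restriction to `ℓ²` of the infinite product over `i` of the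
centred normal laws with variance `(a i)²`. -/
def gaussian (a : ℕ → ℝ) : Measure Ell2 :=
  Measure.comap (fun (x : Ell2) (i : ℕ) => x i)
    (Measure.infinitePi fun i => ProbabilityTheory.gaussianReal 0 (Real.toNNReal (a i ^ 2)))

/-- `E` is uniformly included in `V`. -/
def UniformlyIncluded (E V : Set Ell2) : Prop :=
  ∃ r > 0, ∃ R > 0, (⋃ x ∈ E, Metric.ball x r) ⊆ V ∧ E ⊆ Metric.ball 0 R

/-- Continuity of `f` on the finite-dimensional slices of `U`
(only the values of `f` on `U` matter). -/
def FContinuous (U : Set Ell2) (f : Ell2 → ℝ) : Prop :=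
  ∀ x ∈ U, ∀ l : ℕ,
    ContinuousOn (fun s : Fin l → ℝ => f (x + ∑ j, s j • e j))
      {s | x + ∑ j, s j • e j ∈ U}

/-- The partial derivative in the `i`-th coordinate. -/
def partialD (i : ℕ) (f : Ell2 → ℝ) : Ell2 → ℝ :=
  fun x => deriv (fun t : ℝ => f (x + t • e i)) 0

/-- The iterated partial derivative `D_{i₁} (D_{i₂} (⋯ (D_{iₖ} f)))` for the list `[i₁, …, iₖ]`. -/
def iterD (I : List ℕ) (f : Ell2 → ℝ) : Ell2 → ℝ :=
  I.foldr partialD f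

/-- Real functions on the open set `U` that are F-continuous and Borel measurable, and all of whose
partial derivatives of all orders exist, are bounded, F-continuous and Borel measurable on `U`. -/
def IsCFInfty (U : Set Ell2) (f : Ell2 → ℝ) : Prop :=
  FContinuous U f ∧ Measurable (fun x : U => f x) ∧
    ∀ (I : List ℕ) (i : ℕ),
      (∀ x ∈ U, DifferentiableAt ℝ (fun t : ℝ => iterD I f (x + t • e i)) 0) ∧
      (∃ C : ℝ, ∀ x ∈ U, |iterD (i :: I) f x| ≤ C) ∧
      FContinuous U (iterD (i :: I) f) ∧
      Measurable (fun x : U => iterD (i :: I) f x)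

/-- The test functions on the open set `U`. -/
def IsTest (a : ℕ → ℝ) (U : Set Ell2) (φ : Ell2 → ℝ) : Prop :=
  IsCFInfty U φ ∧
    (∀ k : ℕ, 1 ≤ k →
      ⨆ x ∈ U, ∑' i : Fin k → ℕ,
        ENNReal.ofReal ((∏ j, a (i j) ^ 2) * |iterD (List.ofFn i) φ x| ^ 2) < ⊤) ∧
    UniformlyIncluded {x ∈ U | φ x ≠ 0} U

/-- The formal adjoint `D_i^* φ = - D_i φ + (x_i / a_i²) φ`. -/
def adjD (a : ℕ → ℝ) (i : ℕ) (φ : Ell2 → ℝ) : Ell2 → ℝ :=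
  fun x => -partialD i φ x + x i / a i ^ 2 * φ x

/-- `D_{iₖ}^* (⋯ (D_{i₁}^* φ))` for the list `[i₁, …, iₖ]`. -/
def iterAdjD (a : ℕ → ℝ) (I : List ℕ) (φ : Ell2 → ℝ) : Ell2 → ℝ :=
  I.foldl (fun ψ i => adjD a i ψ) φ

/-- `g ∈ L^p(U, P)` is a weak derivative `D_{i₁ ⋯ iₖ}^k f` on `U`. -/
def HasWeakDeriv (a : ℕ → ℝ) (p : ℝ) (U : Set Ell2) {k : ℕ} (i : Fin k → ℕ)
    (f g : Ell2 → ℝ) : Prop :=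
  MemLp g (ENNReal.ofReal p) ((gaussian a).restrict U) ∧
    ∀ φ : Ell2 → ℝ, IsTest a U φ →
      ∫ x in U, g x * φ x ∂(gaussian a) =
        ∫ x in U, f x * iterAdjD a (List.ofFn i) φ x ∂(gaussian a)

open Classical in
/-- The weak derivative `D_{i₁ ⋯ iₖ}^k f` in `L^p(U, P)` (a representative; zero if there is
none). -/
def weakDeriv (a : ℕ → ℝ) (p : ℝ) (U : Set Ell2) {k : ℕ} (i : Fin k → ℕ)
    (f : Ell2 → ℝ) : Ell2 → ℝ :=
  if h : ∃ g, HasWeakDeriv a p U i f g then h.choose else 0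

/-- `∑_{k=1}^m ∑_{i₁,…,iₖ} a_{i₁}^p ⋯ a_{iₖ}^p ∫_U |D_{i₁ ⋯ iₖ}^k f|^p dP`. -/
def derivEnergy (a : ℕ → ℝ) (m : ℕ) (p : ℝ) (U : Set Ell2) (f : Ell2 → ℝ) : ℝ≥0∞ :=
  ∑ k ∈ Finset.Icc 1 m, ∑' i : Fin k → ℕ,
    ENNReal.ofReal (∏ j, a (i j) ^ p) *
      ∫⁻ x in U, ENNReal.ofReal (|weakDeriv a p U i f x| ^ p) ∂(gaussian a)

/-- Membership of (the class of) `f` in the Sobolev space `W^{m,p}(U)`. -/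
def MemSobolev (a : ℕ → ℝ) (m : ℕ) (p : ℝ) (U : Set Ell2) (f : Ell2 → ℝ) : Prop :=
  MemLp f (ENNReal.ofReal p) ((gaussian a).restrict U) ∧
    (∀ k : ℕ, 1 ≤ k → k ≤ m → ∀ i : Fin k → ℕ, ∃ g, HasWeakDeriv a p U i f g) ∧
    derivEnergy a m p U f < ⊤

/-- The Sobolev norm (meaningful for members of `W^{m,p}(U)`). -/
def sobolevNorm (a : ℕ → ℝ) (m : ℕ) (p : ℝ) (U : Set Ell2) (f : Ell2 → ℝ) : ℝ≥0∞ :=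
  (∫⁻ x in U, ENNReal.ofReal (|f x| ^ p) ∂(gaussian a) + derivEnergy a m p U f) ^ (1 / p)

/-- The support of `f ∈ L^p(U, P)`: what remains of `U` after removing all open balls inside `U`
over which the integral of `|f|^p` vanishes. -/
def lpSupport (a : ℕ → ℝ) (p : ℝ) (U : Set Ell2) (f : Ell2 → ℝ) : Set Ell2 :=
  U \ ⋃₀ {B | ∃ (x : Ell2) (r : ℝ), 0 < r ∧ B = Metric.ball x r ∧ B ⊆ U ∧
    ∫⁻ y in B, ENNReal.ofReal (|f y| ^ p) ∂(gaussian a) = 0}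

/-- Smooth cylinder functions: `x ↦ u (x_1, …, x_n)` with `n ≥ 1` and `u ∈ C_c^∞(ℝⁿ)`. -/
def IsSmoothCylinder (φ : Ell2 → ℝ) : Prop :=
  ∃ (n : ℕ) (u : (Fin n → ℝ) → ℝ), 1 ≤ n ∧ ContDiff ℝ ∞ u ∧ HasCompactSupport u ∧
    ∀ x : Ell2, φ x = u (fun j => x j)

end Ell2

end

/-!
The statement rests on two facts: a cutoff argument near the centre `x₀`, and the density of smooth
cylinder functions.

*Extension by zero.* Let `U = ℍ ∩ O`. Off the ball `B_{r₁}(x₀)` the function `f` vanishes almost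
everywhere, and so do its weak derivatives, by the fundamental lemma of the calculus of variations on
the open set where `f` vanishes (`HasWeakDeriv.ae_eq_zero`). Take a radial cutoff function `η` that is
one on `B_{r₁}(x₀)` and has its support inside `B_{r₂}(x₀)`. It has bounded Fréchet derivatives of all
orders (`exists_cutoff`), so `η φ` is a test function on `U` for every test function `φ` on `ℍ`
(`isTest_mul`), and replacing `φ` by `η φ` changes none of the integrals that define weak derivatives
(`HasWeakDeriv.integral_cutoff`). This gives the weak derivatives of the extension
(`hasWeakDeriv_indicator`). The fundamental lemma (`ae_eq_zero_of_integral_mul_eq_zero`) is proved with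
the test functions `η cos ⟨t, ·⟩` and `η sin ⟨t, ·⟩` and the injectivity of the characteristic function.

*Approximation.* Average the extension of `f` over all coordinates but the first `n`, and mollify in
the first `n` coordinates with a mollifier `ρ` supported in `{z | z 0 ≤ -δ}` near the origin. The
result is `u (x₁, …, xₙ)` with `u y = ∫ ρ (y - π w) / γ (π w) f w dP w`, where `π` is the projection to
the first `n` coordinates and `γ` the Gaussian density on `ℝⁿ`. Because of the factor `1 / γ`, the
adjoint `D_i^*` acts on the kernel as `D_i` acts on `ρ` (`iterAdjD_kernel`), and because `ρ` lives where
the first coordinate is negative, the kernel is, up to a cutoff, a test function on `U` when `y` lies in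
the half-space. Hence the derivatives of `u` in the first `n` coordinates are the mollifications of the
weak derivatives of `f`, and the others vanish (`iterD_mollify`).

The `L^p` error of this smoothing of a function `g` is at most a constant times the sum of two errors
(`lintegral_mollify_sub_le`): that of resampling the coordinates beyond the first `n` in `g`, which
tends to zero as `n → ∞` (`tendsto_resampleError`), and that of small shifts of `g` in the first `n`
coordinates, which for fixed `n` tends to zero with the shift (`tendsto_shiftError`). Since the
derivatives of `f` have summable weighted norms, `n` can be chosen by dominated convergence; then only
finitely many derivatives are affected by the choice of `ρ` (`exists_cylinder_approx`). Integration by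
parts (`integral_iterD_mul`) shows that the classical derivatives of `u` are its weak derivatives.
-/

namespace Ell2

noncomputable section

/-! ### The space `ℓ²` and the Gaussian measure -/

theorem e_apply (i j : ℕ) : e i j = if j = i then (1 : ℝ) else 0 := by
  rw [e, lp.single_apply, Pi.single_apply]

theorem norm_e (i : ℕ) : ‖e i‖ = 1 := by
  rw [e, lp.norm_single (by norm_num)]; simp

theorem abs_apply_le_norm (x : Ell2) (i : ℕ) : |x i| ≤ ‖x‖ := by
  simpa using lp.norm_apply_le_norm (p := 2) (by norm_num) x i

theorem add_smul_e_apply (x : Ell2) (t : ℝ) (i j : ℕ) :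
    (x + t • e i) j = x j + if j = i then t else 0 := by
  rw [lp.coeFn_add, Pi.add_apply, lp.coeFn_smul, Pi.smul_apply, e_apply]; simp

/-- A coordinate as a continuous linear functional. -/
def coordL (i : ℕ) : Ell2 →L[ℝ] ℝ :=
  LinearMap.mkContinuous
    { toFun := fun x : Ell2 => x i
      map_add' := fun x y => by rw [lp.coeFn_add]; rfl
      map_smul' := fun c x => by rw [lp.coeFn_smul]; rfl } 1
    (fun x => by simpa using abs_apply_le_norm x i)

@[fun_prop]
theorem continuous_coord (i : ℕ) : Continuous fun x : Ell2 => x i := (coordL i).continuous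

instance : TopologicalSpace.SeparableSpace Ell2 := by
  have h1 : TopologicalSpace.IsSeparable (range e) := (countable_range e).isSeparable
  have h2 := (h1.span (R := ℝ)).closure
  rw [← TopologicalSpace.isSeparable_univ_iff]
  refine h2.mono fun x _ => ?_
  have hs := lp.hasSum_single (p := 2) (by norm_num) x
  refine mem_closure_of_tendsto hs (Eventually.of_forall fun s => ?_)
  refine Submodule.sum_mem _ fun i _ => ?_
  have : lp.single (E := fun _ : ℕ => ℝ) 2 i (x i) = x i • e i := by
    rw [e, ← lp.single_smul]; simp
  rw [this]
  exact Submodule.smul_mem _ _ (Submodule.subset_span ⟨i, rfl⟩)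

instance : SecondCountableTopology Ell2 := UniformSpace.secondCountable_of_separable Ell2

/-- Since `ℓ²` is Polish, forgetting square-summability is a measurable embedding (Lusin–Souslin);
this is what gives the measure `gaussian` its expected values. -/
theorem measurableEmbedding_coe : MeasurableEmbedding fun (x : Ell2) (i : ℕ) => x i := by
  refine Continuous.measurableEmbedding (continuous_pi continuous_coord) ?_
  intro x y h
  exact lp.ext h

/-- The one-dimensional marginal laws. -/
abbrev marginal (a : ℕ → ℝ) (i : ℕ) : Measure ℝ :=
  ProbabilityTheory.gaussianReal 0 (Real.toNNReal (a i ^ 2))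

theorem lintegral_sq_marginal (a : ℕ → ℝ) (i : ℕ) :
    ∫⁻ x, ENNReal.ofReal (x ^ 2) ∂(marginal a i) = ENNReal.ofReal (a i ^ 2) := by
  have h := ProbabilityTheory.variance_fun_id_gaussianReal (μ := 0) (v := Real.toNNReal (a i ^ 2))
  rw [ProbabilityTheory.variance_eq_integral (by fun_prop)] at h
  simp only [ProbabilityTheory.integral_id_gaussianReal, sub_zero] at h
  rw [← ofReal_integral_eq_lintegral_ofReal, h]
  · simp [Real.coe_toNNReal _ (sq_nonneg (a i))]
  · have := ProbabilityTheory.memLp_id_gaussianReal (μ := 0) (v := Real.toNNReal (a i ^ 2)) 2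
    exact this.integrable_sq
  · exact Eventually.of_forall fun x => sq_nonneg x

/-- The infinite product of the marginals gives full mass to the square-summable sequences, because
the expectation of `∑ xᵢ²` is `∑ aᵢ²`. -/
theorem ae_mem_range_coe (a : ℕ → ℝ) (ha2 : Summable fun i => a i ^ 2) :
    ∀ᵐ y ∂(Measure.infinitePi (marginal a)), y ∈ range fun (x : Ell2) (i : ℕ) => x i := by
  have h1 : ∫⁻ y, ∑' i, ENNReal.ofReal (y i ^ 2) ∂(Measure.infinitePi (marginal a)) ≠ ⊤ := by
    rw [lintegral_tsum (fun i =>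
      (Measurable.ennreal_ofReal ((measurable_pi_apply i).pow_const 2)).aemeasurable)]
    have : ∀ i, ∫⁻ y : ℕ → ℝ, ENNReal.ofReal (y i ^ 2) ∂(Measure.infinitePi (marginal a)) =
        ENNReal.ofReal (a i ^ 2) := by
      intro i
      rw [← lintegral_sq_marginal, ← Measure.infinitePi_map_eval (marginal a) i,
        lintegral_map (by fun_prop) (by fun_prop)]
    simp_rw [this]
    exact ha2.tsum_ofReal_ne_top
  filter_upwards [ae_lt_top (by fun_prop) h1] with y hy
  have hs : Summable fun i => y i ^ 2 := by
    have := ENNReal.summable_toReal hy.ne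
    simpa [ENNReal.toReal_ofReal (sq_nonneg _)] using this
  exact ⟨⟨y, memℓp_gen (by simpa using hs)⟩, rfl⟩

theorem map_coe_gaussian (a : ℕ → ℝ) (ha2 : Summable fun i => a i ^ 2) :
    (gaussian a).map (fun (x : Ell2) (i : ℕ) => x i) = Measure.infinitePi (marginal a) := by
  rw [gaussian, measurableEmbedding_coe.map_comap]
  exact Measure.restrict_eq_self_of_ae_mem (ae_mem_range_coe a ha2)

theorem isProbabilityMeasure_gaussian (a : ℕ → ℝ) (ha2 : Summable fun i => a i ^ 2) :
    IsProbabilityMeasure (gaussian a) := by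
  constructor
  have h := congrArg (fun μ => μ univ) (map_coe_gaussian a ha2)
  simpa [Measure.map_apply measurableEmbedding_coe.measurable MeasurableSet.univ] using h

/-! ### Resampling coordinates -/

/-- The point `w` with its coordinates in `s` replaced by those of `y`. -/
def resample (s : Finset ℕ) (y : ℕ → ℝ) (w : Ell2) : Ell2 :=
  w + ∑ j ∈ s, (y j - w j) • e j

theorem sum_smul_e_apply (s : Finset ℕ) (c : ℕ → ℝ) (i : ℕ) :
    (∑ j ∈ s, c j • e j : Ell2) i = if i ∈ s then c i else 0 := by
  rw [lp.coeFn_sum, Finset.sum_apply]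
  simp [lp.coeFn_smul, e_apply]

theorem resample_apply (s : Finset ℕ) (y : ℕ → ℝ) (w : Ell2) (i : ℕ) :
    resample s y w i = if i ∈ s then y i else w i := by
  rw [resample, lp.coeFn_add, Pi.add_apply, sum_smul_e_apply]
  split_ifs <;> simp

theorem measurable_resample (s : Finset ℕ) :
    Measurable fun q : (ℕ → ℝ) × Ell2 => resample s q.1 q.2 := by
  unfold resample
  refine Continuous.measurable (continuous_snd.add (continuous_finsetSum _ fun j _ => ?_))
  exact (((continuous_apply j).comp continuous_fst).sub
    ((continuous_coord j).comp continuous_snd)).smul continuous_const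

/-- Resampling coordinates of the product measure by an independent copy preserves it. -/
theorem map_piecewise_infinitePi (a : ℕ → ℝ) (s : Finset ℕ) :
    ((Measure.infinitePi (marginal a)).prod (Measure.infinitePi (marginal a))).map
      (fun q : (ℕ → ℝ) × (ℕ → ℝ) => fun i => if i ∈ s then q.1 i else q.2 i) =
      Measure.infinitePi (marginal a) := by
  have hm : Measurable (fun q : (ℕ → ℝ) × (ℕ → ℝ) => fun i => if i ∈ s then q.1 i else q.2 i) := by
    refine measurable_pi_lambda _ fun i => ?_
    by_cases hi : i ∈ s <;> simp only [hi, if_true, if_false] <;> fun_prop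
  refine Measure.eq_infinitePi _ fun t B hB => ?_
  rw [Measure.map_apply hm (MeasurableSet.pi t.countable_toSet fun i _ => hB i)]
  have : (fun q : (ℕ → ℝ) × (ℕ → ℝ) => fun i => if i ∈ s then q.1 i else q.2 i) ⁻¹'
      (Set.pi t B) = (Set.pi (t.filter (· ∈ s) : Finset ℕ) B) ×ˢ
        (Set.pi (t.filter (· ∉ s) : Finset ℕ) B) := by
    ext q
    simp only [mem_preimage, Set.mem_pi, Finset.mem_coe, mem_prod, Finset.mem_filter]
    constructor
    · intro h
      exact ⟨fun i hi => by simpa [hi.2] using h i hi.1, fun i hi => by simpa [hi.2] using h i hi.1⟩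
    · rintro ⟨h1, h2⟩ i hi
      by_cases his : i ∈ s
      · simpa [his] using h1 i ⟨hi, his⟩
      · simpa [his] using h2 i ⟨hi, his⟩
  rw [this, Measure.prod_prod, Measure.infinitePi_pi _ (fun i _ => hB i),
    Measure.infinitePi_pi _ (fun i _ => hB i), Finset.prod_filter_mul_prod_filter_not]

/-- The Gaussian measure is invariant under replacing finitely many coordinates by those of an
independent copy. The measures are compared after the measurable embedding of `ℓ²` into the space of
all sequences. -/
theorem map_resample_prod (a : ℕ → ℝ) (ha2 : Summable fun i => a i ^ 2) (s : Finset ℕ) :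
    ((Measure.infinitePi (marginal a)).prod (gaussian a)).map
      (fun q : (ℕ → ℝ) × Ell2 => resample s q.1 q.2) = gaussian a := by
  have := isProbabilityMeasure_gaussian a ha2
  have hcoe := measurableEmbedding_coe.measurable
  have key : (((Measure.infinitePi (marginal a)).prod (gaussian a)).map
      (fun q : (ℕ → ℝ) × Ell2 => resample s q.1 q.2)).map (fun (x : Ell2) (i : ℕ) => x i) =
      (gaussian a).map (fun (x : Ell2) (i : ℕ) => x i) := by
    have hprod : (Measure.infinitePi (marginal a)).prod (Measure.infinitePi (marginal a)) =
        ((Measure.infinitePi (marginal a)).prod (gaussian a)).map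
          (Prod.map id fun (x : Ell2) (i : ℕ) => x i) := by
      rw [← Measure.map_prod_map _ _ measurable_id hcoe, Measure.map_id, map_coe_gaussian a ha2]
    have hm : Measurable
        (fun q : (ℕ → ℝ) × (ℕ → ℝ) => fun i => if i ∈ s then q.1 i else q.2 i) := by
      refine measurable_pi_lambda _ fun i => ?_
      by_cases hi : i ∈ s <;> simp only [hi, if_true, if_false] <;> fun_prop
    have h2 := map_piecewise_infinitePi a s
    rw [hprod, Measure.map_map hm (measurable_id.prodMap hcoe)] at h2
    rw [map_coe_gaussian a ha2, Measure.map_map hcoe (measurable_resample s)]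
    refine Eq.trans ?_ h2
    congr 1
    ext q i
    simp [resample_apply]
  have := congrArg (Measure.comap (fun (x : Ell2) (i : ℕ) => x i)) key
  rwa [measurableEmbedding_coe.comap_map, measurableEmbedding_coe.comap_map] at this

/-- The first `n` coordinates, as a continuous linear map. -/
def headL (n : ℕ) : Ell2 →L[ℝ] (Fin n → ℝ) := ContinuousLinearMap.pi fun j => coordL j

@[simp] theorem headL_apply (n : ℕ) (x : Ell2) (j : Fin n) : headL n x j = x j := rfl

/-- The vector with prescribed first `n` coordinates and zeros after them. -/
def inclL (n : ℕ) : (Fin n → ℝ) →L[ℝ] Ell2 :=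
  ∑ j : Fin n, (ContinuousLinearMap.proj j : (Fin n → ℝ) →L[ℝ] ℝ).smulRight (e j)

theorem inclL_apply (n : ℕ) (z : Fin n → ℝ) : inclL n z = ∑ j : Fin n, z j • e j := by
  simp [inclL]

theorem headL_inclL (n : ℕ) (z : Fin n → ℝ) : headL n (inclL n z) = z := by
  ext i
  rw [headL_apply, inclL_apply, lp.coeFn_sum, Finset.sum_apply]
  simp [lp.coeFn_smul, e_apply, Fin.val_inj]

/-- The point `w` with its first `n` coordinates replaced by `y`. -/
def setHead (n : ℕ) (y : Fin n → ℝ) (w : Ell2) : Ell2 := w + inclL n (y - headL n w)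

theorem headL_setHead (n : ℕ) (y : Fin n → ℝ) (w : Ell2) : headL n (setHead n y w) = y := by
  rw [setHead, map_add, headL_inclL]; abel

theorem setHead_sub (n : ℕ) (y z : Fin n → ℝ) (w : Ell2) :
    setHead n (y - z) w = setHead n y w - inclL n z := by
  simp only [setHead, map_sub]; abel

theorem continuous_setHead (n : ℕ) :
    Continuous fun q : (Fin n → ℝ) × Ell2 => setHead n q.1 q.2 := by
  unfold setHead; fun_prop

theorem setHead_eq_resample (n : ℕ) (y : ℕ → ℝ) (w : Ell2) :
    setHead n (fun j => y j) w = resample (Finset.range n) y w := by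
  rw [setHead, resample, inclL_apply, Finset.sum_range]
  rfl

theorem map_head_infinitePi (a : ℕ → ℝ) (n : ℕ) :
    (Measure.infinitePi (marginal a)).map (fun y (j : Fin n) => y j) =
      Measure.pi fun j : Fin n => marginal a j := by
  have hm : Measurable (fun (y : ℕ → ℝ) (j : Fin n) => y j) := by fun_prop
  refine (Measure.pi_eq fun B hB => ?_).symm
  rw [Measure.map_apply hm (MeasurableSet.univ_pi hB)]
  have : (fun (y : ℕ → ℝ) (j : Fin n) => y j) ⁻¹' (Set.pi univ B) =
      Set.pi (Finset.range n : Finset ℕ) (fun i => if h : i < n then B ⟨i, h⟩ else univ) := by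
    ext y
    simp only [mem_preimage, Set.mem_pi, mem_univ, true_imp_iff, Finset.mem_coe, Finset.mem_range]
    constructor
    · intro h i hi
      simpa [hi] using h ⟨i, hi⟩
    · intro h j
      simpa using h j j.2
  rw [this, Measure.infinitePi_pi, Finset.prod_range]
  · simp
  · intro i hi
    have := Finset.mem_range.1 hi
    simp only [this, dif_pos]
    exact hB _

theorem map_headL_gaussian (a : ℕ → ℝ) (ha2 : Summable fun i => a i ^ 2) (n : ℕ) :
    (gaussian a).map (headL n) = Measure.pi fun j : Fin n => marginal a j := by
  rw [← map_head_infinitePi, ← map_coe_gaussian a ha2,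
    Measure.map_map (by fun_prop) measurableEmbedding_coe.measurable]
  rfl

theorem map_setHead_prod (a : ℕ → ℝ) (ha2 : Summable fun i => a i ^ 2) (n : ℕ) :
    ((Measure.pi fun j : Fin n => marginal a j).prod (gaussian a)).map
      (fun q => setHead n q.1 q.2) = gaussian a := by
  have := isProbabilityMeasure_gaussian a ha2
  have hm : Measurable (fun (y : ℕ → ℝ) (j : Fin n) => y j) := by fun_prop
  conv_rhs => rw [← map_resample_prod a ha2 (Finset.range n)]
  rw [← map_head_infinitePi]
  have h := Measure.map_prod_map (Measure.infinitePi (marginal a)) (gaussian a) hm measurable_id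
  rw [Measure.map_id] at h
  rw [h, Measure.map_map (continuous_setHead n).measurable (hm.prodMap measurable_id)]
  congr 1
  ext1 q
  exact setHead_eq_resample n q.1 q.2

theorem measurePreserving_setHead (a : ℕ → ℝ) (ha2 : Summable fun i => a i ^ 2) (n : ℕ) :
    MeasurePreserving (fun q : Ell2 × Ell2 => setHead n (headL n q.1) q.2)
      ((gaussian a).prod (gaussian a)) (gaussian a) := by
  have := isProbabilityMeasure_gaussian a ha2
  have hc : Continuous fun q : Ell2 × Ell2 => setHead n (headL n q.1) q.2 := by
    unfold setHead; fun_prop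
  refine ⟨hc.measurable, ?_⟩
  conv_rhs => rw [← map_setHead_prod a ha2 n]
  have h := Measure.map_prod_map (gaussian a) (gaussian a) (headL n).continuous.measurable
    measurable_id
  rw [Measure.map_id, map_headL_gaussian a ha2] at h
  rw [h, Measure.map_map (continuous_setHead n).measurable
    ((headL n).continuous.measurable.prodMap measurable_id)]
  rfl

theorem map_setCoord_prod (a : ℕ → ℝ) (ha2 : Summable fun i => a i ^ 2) (i : ℕ) :
    ((marginal a i).prod (gaussian a)).map
      (fun q => q.2 + (q.1 - q.2 i) • e i) = gaussian a := by
  have := isProbabilityMeasure_gaussian a ha2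
  have hm : Measurable (fun (y : ℕ → ℝ) => y i) := by fun_prop
  have hc : Continuous fun q : ℝ × Ell2 => q.2 + (q.1 - q.2 i) • e i :=
    continuous_snd.add ((continuous_fst.sub ((continuous_coord i).comp continuous_snd)).smul
      continuous_const)
  conv_rhs => rw [← map_resample_prod a ha2 {i}]
  have h := Measure.map_prod_map (Measure.infinitePi (marginal a)) (gaussian a) hm measurable_id
  rw [Measure.map_id, Measure.infinitePi_map_eval] at h
  rw [h, Measure.map_map hc.measurable (hm.prodMap measurable_id)]
  congr 1
  ext1 q
  simp [resample]

/-- The density of the law of the first `n` coordinates. -/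
def headPDF (a : ℕ → ℝ) (n : ℕ) (y : Fin n → ℝ) : ℝ :=
  ∏ j : Fin n, ProbabilityTheory.gaussianPDFReal 0 (Real.toNNReal (a j ^ 2)) (y j)

theorem toNNReal_sq_ne_zero {a : ℕ → ℝ} (ha : ∀ i, 0 < a i) (i : ℕ) :
    Real.toNNReal (a i ^ 2) ≠ 0 := by
  have := ha i
  simp only [ne_eq, Real.toNNReal_eq_zero, not_le]
  positivity

theorem headPDF_pos {a : ℕ → ℝ} (ha : ∀ i, 0 < a i) (n : ℕ) (y : Fin n → ℝ) :
    0 < headPDF a n y :=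
  Finset.prod_pos fun j _ =>
    ProbabilityTheory.gaussianPDFReal_pos _ _ _ (toNNReal_sq_ne_zero ha j)

theorem continuous_headPDF (a : ℕ → ℝ) (n : ℕ) : Continuous (headPDF a n) := by
  unfold headPDF ProbabilityTheory.gaussianPDFReal
  fun_prop

/-- The law of the first `n` coordinates has density `headPDF` for the Lebesgue measure. -/
theorem pi_marginal_eq_withDensity {a : ℕ → ℝ} (ha : ∀ i, 0 < a i) (n : ℕ) :
    (Measure.pi fun j : Fin n => marginal a j) =
      (volume : Measure (Fin n → ℝ)).withDensity fun y => ENNReal.ofReal (headPDF a n y) := by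
  refine Measure.pi_eq fun B hB => ?_
  rw [withDensity_apply _ (MeasurableSet.univ_pi hB), volume_pi, Measure.restrict_pi_pi,
    ← ofReal_integral_eq_lintegral_ofReal]
  · have := integral_fintype_prod_eq_prod (𝕜 := ℝ)
      (μ := fun j : Fin n => (volume : Measure ℝ).restrict (B j))
      (fun (j : Fin n) => ProbabilityTheory.gaussianPDFReal 0 (Real.toNNReal (a j ^ 2)))
    unfold headPDF
    rw [this, ENNReal.ofReal_prod_of_nonneg]
    · exact Finset.prod_congr rfl fun j _ =>
        (ProbabilityTheory.gaussianReal_apply_eq_integral _ (toNNReal_sq_ne_zero ha j) _).symm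
    · exact fun j _ => integral_nonneg fun x => ProbabilityTheory.gaussianPDFReal_nonneg _ _ _
  · exact Integrable.fintype_prod fun j =>
      (ProbabilityTheory.integrable_gaussianPDFReal _ _).restrict
  · exact Eventually.of_forall fun y => (headPDF_pos ha n y).le

/-- Disintegration of the Gaussian measure along its first `n` coordinates. -/
theorem lintegral_gaussian_eq {a : ℕ → ℝ} (ha : ∀ i, 0 < a i) (ha2 : Summable fun i => a i ^ 2)
    (n : ℕ) {G : Ell2 → ℝ≥0∞} (hG : Measurable G) :
    ∫⁻ x, G x ∂(gaussian a) = ∫⁻ w, (∫⁻ z : Fin n → ℝ,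
      ENNReal.ofReal (headPDF a n z) * G (setHead n z w)) ∂(gaussian a) := by
  have := isProbabilityMeasure_gaussian a ha2
  have hm := (continuous_setHead n).measurable
  conv_lhs => rw [← map_setHead_prod a ha2 n, lintegral_map hG hm,
    lintegral_prod_symm _ (by exact (hG.comp hm).aemeasurable)]
  refine lintegral_congr fun w => ?_
  rw [pi_marginal_eq_withDensity ha n, lintegral_withDensity_eq_lintegral_mul]
  · rfl
  · exact (continuous_headPDF a n).measurable.ennreal_ofReal
  · exact hG.comp (hm.comp (measurable_id.prodMk measurable_const))

/-! ### Smooth functions with bounded Fréchet derivatives -/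

/-- Smooth functions on `ℓ²` whose Fréchet derivatives of each order, including order zero, are
bounded. -/
def BddSmooth (η : Ell2 → ℝ) : Prop :=
  ContDiff ℝ ∞ η ∧ ∀ k : ℕ, ∃ C : ℝ, ∀ x, ‖iteratedFDeriv ℝ k η x‖ ≤ C

theorem hasDerivAt_line (x : Ell2) (i : ℕ) (t : ℝ) :
    HasDerivAt (fun t : ℝ => x + t • e i) (e i) t := by
  simpa using ((hasDerivAt_id t).smul_const (e i)).const_add x

/-- The partial derivatives of a Fréchet differentiable function. -/
theorem partialD_eq_fderiv {η : Ell2 → ℝ} (hη : Differentiable ℝ η) (i : ℕ) (x : Ell2) :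
    partialD i η x = fderiv ℝ η x (e i) := by
  have h1 : HasFDerivAt η (fderiv ℝ η x) (x + (0 : ℝ) • e i) := by
    simpa using (hη x).hasFDerivAt
  exact (h1.comp_hasDerivAt (0 : ℝ) (hasDerivAt_line x i 0)).deriv

theorem contDiff_partialD {η : Ell2 → ℝ} (hη : ContDiff ℝ ∞ η) (i : ℕ) :
    ContDiff ℝ ∞ (partialD i η) := by
  have : partialD i η = fun x => fderiv ℝ η x (e i) :=
    funext fun x => partialD_eq_fderiv (hη.differentiable (by simp)) i x
  rw [this]
  exact (hη.fderiv_right (m := ∞) (by simp)).clm_apply contDiff_const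

theorem norm_iteratedFDeriv_partialD_le {η : Ell2 → ℝ} (hη : ContDiff ℝ ∞ η) (i k : ℕ) (x : Ell2) :
    ‖iteratedFDeriv ℝ k (partialD i η) x‖ ≤ ‖iteratedFDeriv ℝ (k + 1) η x‖ := by
  have : partialD i η = fun x => fderiv ℝ η x (e i) :=
    funext fun x => partialD_eq_fderiv (hη.differentiable (by simp)) i x
  rw [this, ← norm_iteratedFDeriv_fderiv]
  have h := norm_iteratedFDeriv_clm_apply_const (𝕜 := ℝ) (f := fderiv ℝ η) (c := e i) (x := x)
    (n := k) (N := ∞) (hη.fderiv_right (m := ∞) (by simp)).contDiffAt (by exact_mod_cast le_top)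
  simpa [norm_e] using h

theorem BddSmooth.partialD {η : Ell2 → ℝ} (hη : BddSmooth η) (i : ℕ) :
    BddSmooth (partialD i η) := by
  refine ⟨contDiff_partialD hη.1 i, fun k => ?_⟩
  obtain ⟨C, hC⟩ := hη.2 (k + 1)
  exact ⟨C, fun x => (norm_iteratedFDeriv_partialD_le hη.1 i k x).trans (hC x)⟩

theorem iterD_append_singleton (I : List ℕ) (i : ℕ) (φ : Ell2 → ℝ) :
    iterD (I ++ [i]) φ = iterD I (partialD i φ) := by
  simp [iterD, List.foldr_append]

theorem iterD_cons (I : List ℕ) (i : ℕ) (φ : Ell2 → ℝ) :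
    iterD (i :: I) φ = partialD i (iterD I φ) := rfl

theorem abs_iterD_le {η : Ell2 → ℝ} (hη : ContDiff ℝ ∞ η) (I : List ℕ) (x : Ell2) :
    |iterD I η x| ≤ ‖iteratedFDeriv ℝ I.length η x‖ := by
  induction I using List.reverseRecOn generalizing η with
  | nil => simp [iterD]
  | append_singleton I i ih =>
    rw [iterD_append_singleton, List.length_append, List.length_singleton]
    exact (ih (contDiff_partialD hη i)).trans (norm_iteratedFDeriv_partialD_le hη i _ x)

theorem BddSmooth.iterD {η : Ell2 → ℝ} (hη : BddSmooth η) (I : List ℕ) :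
    BddSmooth (iterD I η) := by
  induction I with
  | nil => exact hη
  | cons i I ih => exact ih.partialD i

theorem BddSmooth.exists_bound_iterD {η : Ell2 → ℝ} (hη : BddSmooth η) (k : ℕ) :
    ∃ C : ℝ, ∀ I : List ℕ, I.length = k → ∀ x, |Ell2.iterD I η x| ≤ C := by
  obtain ⟨C, hC⟩ := hη.2 k
  refine ⟨C, fun I hI x => (abs_iterD_le hη.1 I x).trans ?_⟩
  rw [hI]; exact hC x

theorem BddSmooth.exists_bound {η : Ell2 → ℝ} (hη : BddSmooth η) : ∃ C : ℝ, ∀ x, |η x| ≤ C := by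
  obtain ⟨C, hC⟩ := hη.exists_bound_iterD 0
  exact ⟨C, fun x => hC [] rfl x⟩

theorem BddSmooth.continuous {η : Ell2 → ℝ} (hη : BddSmooth η) : Continuous η := hη.1.continuous

theorem BddSmooth.mul {η θ : Ell2 → ℝ} (hη : BddSmooth η) (hθ : BddSmooth θ) :
    BddSmooth fun x => η x * θ x := by
  refine ⟨hη.1.mul hθ.1, fun k => ?_⟩
  choose C hC using hη.2
  choose D hD using hθ.2
  refine ⟨∑ j ∈ Finset.range (k + 1), (k.choose j : ℝ) * C j * D (k - j), fun x => ?_⟩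
  refine (norm_iteratedFDeriv_mul_le (N := ∞) hη.1 hθ.1 x (by exact_mod_cast le_top)).trans ?_
  refine Finset.sum_le_sum fun j _ => ?_
  have h0 : 0 ≤ C j := (norm_nonneg _).trans (hC j x)
  gcongr
  · exact hC j x
  · exact hD _ x

theorem BddSmooth.const_mul {η : Ell2 → ℝ} (hη : BddSmooth η) (c : ℝ) :
    BddSmooth fun x => c * η x := by
  refine ⟨contDiff_const.mul hη.1, fun k => ?_⟩
  obtain ⟨C, hC⟩ := hη.2 k
  refine ⟨|c| * C, fun x => ?_⟩
  have : (fun x => c * η x) = c • η := rfl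
  rw [this, iteratedFDeriv_const_smul_apply (hη.1.contDiffAt.of_le (by exact_mod_cast le_top)),
    norm_smul, Real.norm_eq_abs]
  gcongr
  exact hC x

theorem bddSmooth_comp_clm {E : Type*} [NormedAddCommGroup E] [NormedSpace ℝ E] {F : E → ℝ}
    (hF : ContDiff ℝ ∞ F) (hb : ∀ k : ℕ, ∃ C : ℝ, ∀ y, ‖iteratedFDeriv ℝ k F y‖ ≤ C)
    (L : Ell2 →L[ℝ] E) : BddSmooth fun x => F (L x) := by
  refine ⟨hF.comp L.contDiff, fun k => ?_⟩
  obtain ⟨C, hC⟩ := hb k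
  refine ⟨C * ∏ _i : Fin k, ‖L‖, fun x => ?_⟩
  have h := L.iteratedFDeriv_comp_right (n := ∞) hF x (i := k) (by exact_mod_cast le_top)
  change ‖iteratedFDeriv ℝ k (F ∘ L) x‖ ≤ _
  rw [h]
  refine (ContinuousMultilinearMap.norm_compContinuousLinearMap_le _ _).trans ?_
  gcongr
  exact hC _

theorem exists_bound_iteratedFDeriv_of_hasCompactSupport {E : Type*} [NormedAddCommGroup E]
    [NormedSpace ℝ E] {F : E → ℝ} (hF : ContDiff ℝ ∞ F) (hc : HasCompactSupport F) (k : ℕ) :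
    ∃ C : ℝ, ∀ y, ‖iteratedFDeriv ℝ k F y‖ ≤ C :=
  (hF.continuous_iteratedFDeriv (m := k) (by exact_mod_cast le_top)).bounded_above_of_compact_support
    (hc.iteratedFDeriv k)

theorem bddSmooth_comp_headL {n : ℕ} {F : (Fin n → ℝ) → ℝ} (hF : ContDiff ℝ ∞ F)
    (hc : HasCompactSupport F) : BddSmooth fun x => F (headL n x) :=
  bddSmooth_comp_clm hF (exists_bound_iteratedFDeriv_of_hasCompactSupport hF hc) _

theorem bddSmooth_cos (t : Ell2) : BddSmooth fun x => Real.cos (inner ℝ t x) := by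
  refine bddSmooth_comp_clm Real.contDiff_cos (fun k => ⟨1, fun y => ?_⟩) (innerSL ℝ t)
  rw [norm_iteratedFDeriv_eq_norm_iteratedDeriv]
  exact Real.abs_iteratedDeriv_cos_le_one k y

theorem bddSmooth_sin (t : Ell2) : BddSmooth fun x => Real.sin (inner ℝ t x) := by
  refine bddSmooth_comp_clm Real.contDiff_sin (fun k => ⟨1, fun y => ?_⟩) (innerSL ℝ t)
  rw [norm_iteratedFDeriv_eq_norm_iteratedDeriv]
  exact Real.abs_iteratedDeriv_sin_le_one k y

theorem norm_iteratedFDeriv_norm_sub_sq_le (c : Ell2) (R : ℝ) (x : Ell2) (hx : ‖x - c‖ ≤ R)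
    (k : ℕ) (hk : 1 ≤ k) :
    ‖iteratedFDeriv ℝ k (fun x : Ell2 => ‖x - c‖ ^ 2) x‖ ≤ (2 * R + 2) ^ k := by
  have hR : 0 ≤ R := (norm_nonneg _).trans hx
  have hf : fderiv ℝ (fun x : Ell2 => ‖x - c‖ ^ 2) =
      fun x => (2 : ℝ) • (innerSL ℝ x - innerSL ℝ c) := by
    ext1 y
    have h := ((hasFDerivAt_id y).sub_const c).norm_sq.fderiv
    simp only [id] at h
    rw [h, ← map_sub]
    ext v
    simp
  have hf2 : ∀ y, fderiv ℝ (fun x : Ell2 => (2 : ℝ) • (innerSL ℝ x - innerSL ℝ c)) y =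
      (2 : ℝ) • (innerSL ℝ : Ell2 →L[ℝ] Ell2 →L[ℝ] ℝ) := by
    intro y
    exact ((((innerSL ℝ : Ell2 →L[ℝ] Ell2 →L[ℝ] ℝ).hasFDerivAt (x := y)).sub_const
      (innerSL ℝ c)).const_smul (2 : ℝ)).fderiv
  match k, hk with
  | 1, _ =>
    rw [← norm_iteratedFDeriv_fderiv, norm_iteratedFDeriv_zero, hf]
    simp only [← map_sub, norm_smul, innerSL_apply_norm]
    norm_num
    linarith
  | 2, _ =>
    rw [← norm_iteratedFDeriv_fderiv, ← norm_iteratedFDeriv_fderiv, norm_iteratedFDeriv_zero, hf,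
      hf2, norm_smul]
    have : ‖(innerSL ℝ : Ell2 →L[ℝ] Ell2 →L[ℝ] ℝ)‖ ≤ 1 := norm_innerSL_le ℝ
    norm_num
    nlinarith
  | k + 3, _ =>
    rw [← norm_iteratedFDeriv_fderiv, ← norm_iteratedFDeriv_fderiv, hf, funext hf2,
      iteratedFDeriv_succ_const]
    simp only [Pi.zero_apply, norm_zero]
    positivity

/-- Radial cutoff functions have bounded derivatives of all orders: outside the support they
vanish, and on it the derivatives of `x ↦ ‖x - c‖ ^ 2` are bounded. -/
theorem exists_cutoff (c : Ell2) {r R : ℝ} (hr : 0 < r) (hrR : r < R) :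
    ∃ η : Ell2 → ℝ, BddSmooth η ∧ (∀ x, ‖x - c‖ ≤ r → η x = 1) ∧
      (∀ x, R ≤ ‖x - c‖ → η x = 0) ∧ ∀ x, |η x| ≤ 1 := by
  let b : ContDiffBump (0 : ℝ) := ⟨r ^ 2, R ^ 2, by positivity, by gcongr⟩
  have hsm : ContDiff ℝ ∞ (fun x : Ell2 => ‖x - c‖ ^ 2) :=
    (contDiff_id.sub contDiff_const).norm_sq ℝ
  have h0 : ∀ x, R ≤ ‖x - c‖ → b (‖x - c‖ ^ 2) = 0 := fun x hx => by
    refine b.zero_of_le_dist ?_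
    have : 0 ≤ R := by linarith
    simp only [dist_zero_right, norm_pow, norm_norm, b]
    gcongr
  refine ⟨fun x => b (‖x - c‖ ^ 2), ⟨b.contDiff.comp hsm, fun k => ?_⟩, fun x hx => ?_, h0,
    fun x => ?_⟩
  · choose C hC using exists_bound_iteratedFDeriv_of_hasCompactSupport
      (b.contDiff (n := ⊤)) b.hasCompactSupport
    have hC0 : ∀ j, 0 ≤ C j := fun j => (norm_nonneg _).trans (hC j 0)
    refine ⟨k.factorial * (∑ j ∈ Finset.range (k + 1), C j) * (2 * R + 2) ^ k, fun x => ?_⟩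
    by_cases hx : ‖x - c‖ ≤ R
    · refine norm_iteratedFDeriv_comp_le (N := ∞) b.contDiff hsm (by exact_mod_cast le_top) x
        (fun i hi => ?_) (fun i hi _ => norm_iteratedFDeriv_norm_sub_sq_le c R x hx i hi)
      exact (hC i _).trans (Finset.single_le_sum (f := C) (fun j _ => hC0 j)
        (Finset.mem_range.2 (by omega)))
    · have hev : (fun x => b (‖x - c‖ ^ 2)) =ᶠ[𝓝 x] fun _ => (0 : ℝ) := by
        have ho : IsOpen {y : Ell2 | R < ‖y - c‖} :=
          isOpen_lt continuous_const (by fun_prop)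
        filter_upwards [ho.mem_nhds (not_le.1 hx)] with y hy
        exact h0 y (le_of_lt hy)
      rw [(hev.iteratedFDeriv ℝ k).eq_of_nhds]
      have : iteratedFDeriv ℝ k (fun _ : Ell2 => (0 : ℝ)) x = 0 := by
        simp
      rw [this, norm_zero]
      have : 0 ≤ ∑ j ∈ Finset.range (k + 1), C j := Finset.sum_nonneg fun j _ => hC0 j
      have : 0 ≤ 2 * R + 2 := by linarith
      positivity
  · refine b.one_of_mem_closedBall ?_
    simp only [Metric.mem_closedBall, dist_zero_right, norm_pow, norm_norm, b]
    gcongr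
  · rw [abs_of_nonneg b.nonneg]
    exact b.le_one

/-! ### Smoothness along coordinate directions -/

/-- F-continuous, Borel measurable and bounded on `U`. -/
def BddFCont (U : Set Ell2) (ψ : Ell2 → ℝ) : Prop :=
  FContinuous U ψ ∧ Measurable (fun x : U => ψ x) ∧ ∃ C : ℝ, ∀ x ∈ U, |ψ x| ≤ C

/-- The partial derivatives of order at most `n` exist on `U` and are, together with the function,
bounded, F-continuous and Borel measurable. -/
def SmoothOrder (U : Set Ell2) : ℕ → (Ell2 → ℝ) → Prop
  | 0, ψ => BddFCont U ψ
  | n + 1, ψ => BddFCont U ψ ∧ ∀ i,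
      (∀ x ∈ U, DifferentiableAt ℝ (fun t : ℝ => ψ (x + t • e i)) 0) ∧
      SmoothOrder U n (partialD i ψ)

/-- All partial derivatives exist on `U` and are, together with the function, bounded,
F-continuous and Borel measurable. -/
def CoordSmooth (U : Set Ell2) (ψ : Ell2 → ℝ) : Prop := ∀ n, SmoothOrder U n ψ

variable {U V W : Set Ell2} {ψ θ : Ell2 → ℝ}

theorem SmoothOrder.of_succ {n : ℕ} (h : SmoothOrder U (n + 1) ψ) : SmoothOrder U n ψ := by
  induction n generalizing ψ with
  | zero => exact h.1
  | succ n ih => exact ⟨h.1, fun i => ⟨(h.2 i).1, ih (h.2 i).2⟩⟩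

theorem CoordSmooth.bddFCont (h : CoordSmooth U ψ) : BddFCont U ψ := h 0

theorem CoordSmooth.partialD (h : CoordSmooth U ψ) (i : ℕ) : CoordSmooth U (partialD i ψ) :=
  fun n => ((h (n + 1)).2 i).2

theorem CoordSmooth.differentiableAt (h : CoordSmooth U ψ) (i : ℕ) {x : Ell2} (hx : x ∈ U) :
    DifferentiableAt ℝ (fun t : ℝ => ψ (x + t • e i)) 0 := ((h 1).2 i).1 x hx

theorem CoordSmooth.iterD (h : CoordSmooth U ψ) (I : List ℕ) : CoordSmooth U (iterD I ψ) := by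
  induction I with
  | nil => exact h
  | cons i I ih => exact ih.partialD i

theorem eventually_line_mem (hU : IsOpen U) {x : Ell2} (hx : x ∈ U) (i : ℕ) :
    ∀ᶠ t : ℝ in 𝓝 0, x + t • e i ∈ U := by
  have hc : ContinuousAt (fun t : ℝ => x + t • e i) 0 := (hasDerivAt_line x i 0).continuousAt
  refine hc.eventually_mem (hU.mem_nhds ?_)
  simpa using hx

theorem line_eventuallyEq (hU : IsOpen U) (h : EqOn ψ θ U) {x : Ell2} (hx : x ∈ U) (i : ℕ) :
    (fun t : ℝ => ψ (x + t • e i)) =ᶠ[𝓝 0] fun t : ℝ => θ (x + t • e i) := by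
  filter_upwards [eventually_line_mem hU hx i] with t ht using h ht

theorem partialD_eqOn (hU : IsOpen U) (h : EqOn ψ θ U) (i : ℕ) :
    EqOn (partialD i ψ) (partialD i θ) U :=
  fun _ hx => (line_eventuallyEq hU h hx i).deriv_eq

theorem iterD_eqOn (hU : IsOpen U) (h : EqOn ψ θ U) (I : List ℕ) :
    EqOn (iterD I ψ) (iterD I θ) U := by
  induction I with
  | nil => exact h
  | cons i I ih => exact partialD_eqOn hU ih i

theorem BddFCont.congr (h : BddFCont U ψ) (he : EqOn ψ θ U) : BddFCont U θ := by
  refine ⟨fun x hx l => (h.1 x hx l).congr fun s hs => (he hs).symm, ?_, ?_⟩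
  · have : (fun x : U => θ x) = fun x : U => ψ x := funext fun x => (he x.2).symm
    rw [this]; exact h.2.1
  · obtain ⟨C, hC⟩ := h.2.2
    exact ⟨C, fun x hx => by rw [← he hx]; exact hC x hx⟩

theorem SmoothOrder.congr (hU : IsOpen U) {n : ℕ} (h : SmoothOrder U n ψ) (he : EqOn ψ θ U) :
    SmoothOrder U n θ := by
  induction n generalizing ψ θ with
  | zero => exact BddFCont.congr h he
  | succ n ih =>
    refine ⟨h.1.congr he, fun i => ⟨fun x hx => ?_, ih (h.2 i).2 (partialD_eqOn hU he i)⟩⟩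
    exact ((h.2 i).1 x hx).congr_of_eventuallyEq (line_eventuallyEq hU he hx i).symm

theorem BddFCont.mono (h : BddFCont V ψ) (hUV : U ⊆ V) : BddFCont U ψ := by
  refine ⟨fun x hx l => (h.1 x (hUV hx) l).mono fun s hs => hUV hs, ?_, ?_⟩
  · exact h.2.1.comp (measurable_inclusion hUV)
  · obtain ⟨C, hC⟩ := h.2.2
    exact ⟨C, fun x hx => hC x (hUV hx)⟩

theorem SmoothOrder.mono {n : ℕ} (h : SmoothOrder V n ψ) (hUV : U ⊆ V) : SmoothOrder U n ψ := by
  induction n generalizing ψ with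
  | zero => exact BddFCont.mono h hUV
  | succ n ih =>
    exact ⟨h.1.mono hUV, fun i => ⟨fun x hx => (h.2 i).1 x (hUV hx), ih (h.2 i).2⟩⟩

theorem CoordSmooth.mono (h : CoordSmooth V ψ) (hUV : U ⊆ V) : CoordSmooth U ψ :=
  fun n => (h n).mono hUV

theorem CoordSmooth.congr (hU : IsOpen U) (h : CoordSmooth U ψ) (he : EqOn ψ θ U) :
    CoordSmooth U θ := fun n => (h n).congr hU he

theorem BddFCont.add (h : BddFCont U ψ) (h' : BddFCont U θ) :
    BddFCont U fun x => ψ x + θ x := by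
  refine ⟨fun x hx l => (h.1 x hx l).add (h'.1 x hx l), h.2.1.add h'.2.1, ?_⟩
  obtain ⟨C, hC⟩ := h.2.2
  obtain ⟨D, hD⟩ := h'.2.2
  exact ⟨C + D, fun x hx => (abs_add_le _ _).trans (add_le_add (hC x hx) (hD x hx))⟩

theorem BddFCont.mul (h : BddFCont U ψ) (h' : BddFCont U θ) :
    BddFCont U fun x => ψ x * θ x := by
  refine ⟨fun x hx l => (h.1 x hx l).mul (h'.1 x hx l), h.2.1.mul h'.2.1, ?_⟩
  obtain ⟨C, hC⟩ := h.2.2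
  obtain ⟨D, hD⟩ := h'.2.2
  refine ⟨C * D, fun x hx => ?_⟩
  rw [abs_mul]
  exact mul_le_mul (hC x hx) (hD x hx) (abs_nonneg _) ((abs_nonneg _).trans (hC x hx))

theorem partialD_add {i : ℕ} {x : Ell2}
    (h : DifferentiableAt ℝ (fun t : ℝ => ψ (x + t • e i)) 0)
    (h' : DifferentiableAt ℝ (fun t : ℝ => θ (x + t • e i)) 0) :
    partialD i (fun x => ψ x + θ x) x = partialD i ψ x + partialD i θ x :=
  deriv_fun_add h h'

theorem partialD_mul {i : ℕ} {x : Ell2}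
    (h : DifferentiableAt ℝ (fun t : ℝ => ψ (x + t • e i)) 0)
    (h' : DifferentiableAt ℝ (fun t : ℝ => θ (x + t • e i)) 0) :
    partialD i (fun x => ψ x * θ x) x = partialD i ψ x * θ x + ψ x * partialD i θ x := by
  have := deriv_fun_mul h h'
  simpa [partialD] using this

theorem SmoothOrder.add (hU : IsOpen U) {n : ℕ} (h : SmoothOrder U n ψ) (h' : SmoothOrder U n θ) :
    SmoothOrder U n fun x => ψ x + θ x := by
  induction n generalizing ψ θ with
  | zero => exact BddFCont.add h h'
  | succ n ih =>
    refine ⟨h.1.add h'.1, fun i => ⟨fun x hx => ((h.2 i).1 x hx).add ((h'.2 i).1 x hx), ?_⟩⟩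
    exact (ih (h.2 i).2 (h'.2 i).2).congr hU
      fun x hx => (partialD_add ((h.2 i).1 x hx) ((h'.2 i).1 x hx)).symm

theorem SmoothOrder.mul (hU : IsOpen U) {n : ℕ} (h : SmoothOrder U n ψ) (h' : SmoothOrder U n θ) :
    SmoothOrder U n fun x => ψ x * θ x := by
  induction n generalizing ψ θ with
  | zero => exact BddFCont.mul h h'
  | succ n ih =>
    refine ⟨h.1.mul h'.1, fun i => ⟨fun x hx => ((h.2 i).1 x hx).mul ((h'.2 i).1 x hx), ?_⟩⟩
    exact ((ih (h.2 i).2 h'.of_succ).add hU (ih h.of_succ (h'.2 i).2)).congr hU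
      fun x hx => (partialD_mul ((h.2 i).1 x hx) ((h'.2 i).1 x hx)).symm

theorem CoordSmooth.add (hU : IsOpen U) (h : CoordSmooth U ψ) (h' : CoordSmooth U θ) :
    CoordSmooth U fun x => ψ x + θ x := fun n => (h n).add hU (h' n)

theorem CoordSmooth.mul (hU : IsOpen U) (h : CoordSmooth U ψ) (h' : CoordSmooth U θ) :
    CoordSmooth U fun x => ψ x * θ x := fun n => (h n).mul hU (h' n)

theorem BddSmooth.coordSmooth {η : Ell2 → ℝ} (hη : BddSmooth η) (U : Set Ell2) :
    CoordSmooth U η := by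
  intro n
  have hQ : ∀ {η : Ell2 → ℝ}, BddSmooth η → BddFCont U η := by
    intro η hη
    refine ⟨fun x _ l => Continuous.continuousOn ?_, ?_, ?_⟩
    · exact hη.continuous.comp (by fun_prop)
    · exact hη.continuous.measurable.comp measurable_subtype_coe
    · obtain ⟨C, hC⟩ := hη.exists_bound
      exact ⟨C, fun x _ => hC x⟩
  induction n generalizing η with
  | zero => exact hQ hη
  | succ n ih =>
    refine ⟨hQ hη, fun i => ⟨fun x _ => ?_, ih (hη.partialD i)⟩⟩
    have h := (hη.1.differentiable (by simp)) (x + (0 : ℝ) • e i)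
    exact h.comp (0 : ℝ) (hasDerivAt_line x i 0).differentiableAt

/-! ### Functions with uniformly included support -/

theorem UniformlyIncluded.mono {E F : Set Ell2} (h : UniformlyIncluded F V) (hEF : E ⊆ F) :
    UniformlyIncluded E V := by
  obtain ⟨r, hr, R, hR, h1, h2⟩ := h
  exact ⟨r, hr, R, hR, (biUnion_subset_biUnion_left hEF).trans h1, hEF.trans h2⟩

theorem UniformlyIncluded.mono_right {E : Set Ell2} (h : UniformlyIncluded E U) (hUV : U ⊆ V) :
    UniformlyIncluded E V := by
  obtain ⟨r, hr, R, hR, h1, h2⟩ := h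
  exact ⟨r, hr, R, hR, h1.trans hUV, h2⟩

/-- Near a point outside `U`, a function with uniformly included support vanishes. -/
theorem eventually_indicator_eq_zero (hψ : UniformlyIncluded {x ∈ U | ψ x ≠ 0} U) {x : Ell2}
    (hx : x ∉ U) : ∀ᶠ y in 𝓝 x, U.indicator ψ y = 0 := by
  obtain ⟨r, hr, R, hR, h1, h2⟩ := hψ
  filter_upwards [Metric.ball_mem_nhds x hr] with y hy
  by_contra h
  have hyU : y ∈ U := mem_of_indicator_ne_zero h
  rw [indicator_of_mem hyU] at h
  refine hx (h1 (mem_biUnion (show y ∈ {x ∈ U | ψ x ≠ 0} from ⟨hyU, h⟩) ?_))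
  rwa [Metric.mem_ball, dist_comm]

/-- The extension by zero is differentiable along every coordinate line. -/
theorem hasDerivAt_indicator_line (hU : IsOpen U) (hψ : UniformlyIncluded {x ∈ U | ψ x ≠ 0} U)
    (i : ℕ) (hd : ∀ x ∈ U, DifferentiableAt ℝ (fun t : ℝ => ψ (x + t • e i)) 0) (x : Ell2) (t : ℝ) :
    HasDerivAt (fun t : ℝ => U.indicator ψ (x + t • e i))
      (U.indicator (partialD i ψ) (x + t • e i)) t := by
  have hc : ContinuousAt (fun s : ℝ => x + s • e i) t := (hasDerivAt_line x i t).continuousAt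
  by_cases hx : x + t • e i ∈ U
  · rw [indicator_of_mem hx]
    have h1 : HasDerivAt (fun s : ℝ => ψ (x + t • e i + s • e i))
        (partialD i ψ (x + t • e i)) (t - t) := by
      rw [sub_self]; exact (hd _ hx).hasDerivAt
    have h2 := h1.comp_sub_const t t
    refine h2.congr_of_eventuallyEq ?_
    filter_upwards [hc.eventually_mem (hU.mem_nhds hx)] with s hs
    rw [indicator_of_mem hs]
    congr 1
    rw [add_assoc, ← add_smul]; congr 2; ring
  · rw [indicator_of_notMem hx]
    refine (hasDerivAt_const t (0 : ℝ)).congr_of_eventuallyEq ?_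
    exact hc.eventually (eventually_indicator_eq_zero hψ hx)

/-- Functions on `U` that are smooth along coordinate directions, with support uniformly included
in `U`. -/
def TestLike (U : Set Ell2) (ψ : Ell2 → ℝ) : Prop :=
  CoordSmooth U ψ ∧ UniformlyIncluded {x ∈ U | ψ x ≠ 0} U

/-- A test function is bounded: follow a coordinate line until it leaves the support. -/
theorem IsTest.exists_bound {a : ℕ → ℝ} {φ : Ell2 → ℝ} (hU : IsOpen U) (hφ : IsTest a U φ) :
    ∃ C, ∀ x ∈ U, |φ x| ≤ C := by
  obtain ⟨⟨-, -, h3⟩, -, hs⟩ := hφ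
  obtain ⟨hd, ⟨C, hC⟩, -, -⟩ := h3 [] 0
  have hs' := hs
  obtain ⟨r, hr, R, hR, -, h2⟩ := hs
  refine ⟨max C 0 * (2 * R), fun x hx => ?_⟩
  by_cases hφx : φ x = 0
  · rw [hφx, abs_zero]; positivity
  have hxR : ‖x‖ < R := by simpa using h2 (show x ∈ {x ∈ U | φ x ≠ 0} from ⟨hx, hφx⟩)
  have hder := fun t => hasDerivAt_indicator_line hU hs' 0 hd x t
  have hb : ∀ t : ℝ, ‖U.indicator (partialD 0 φ) (x + t • e 0)‖ ≤ max C 0 := by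
    intro t
    by_cases ht : x + t • e 0 ∈ U
    · rw [indicator_of_mem ht]
      exact (hC _ ht).trans (le_max_left _ _)
    · rw [indicator_of_notMem ht, norm_zero]; exact le_max_right _ _
  have hmv := Convex.norm_image_sub_le_of_norm_hasDerivWithin_le (s := univ) (x := 2 * R) (y := 0)
    (fun t _ => (hder t).hasDerivWithinAt) (fun t _ => hb t) convex_univ (mem_univ _) (mem_univ _)
  have hfar : U.indicator φ (x + (2 * R) • e 0) = 0 := by
    by_contra hne
    have hm : x + (2 * R) • e 0 ∈ U := mem_of_indicator_ne_zero hne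
    rw [indicator_of_mem hm] at hne
    have h4 : ‖x + (2 * R) • e 0‖ < R := by
      simpa using h2 (show _ ∈ {x ∈ U | φ x ≠ 0} from ⟨hm, hne⟩)
    have h5 : ‖(2 * R) • e 0‖ ≤ ‖x + (2 * R) • e 0‖ + ‖x‖ := by
      simpa using norm_sub_le (x + (2 * R) • e 0) x
    rw [norm_smul, norm_e, Real.norm_eq_abs, abs_of_pos (by positivity)] at h5
    linarith
  rw [hfar] at hmv
  simp only [zero_smul, add_zero, sub_zero, indicator_of_mem hx, zero_sub, Real.norm_eq_abs,
    abs_neg] at hmv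
  rwa [abs_of_pos (by positivity : 0 < 2 * R)] at hmv

/-- Test functions are bounded and smooth along coordinates; the square-sum condition on the
derivatives is not needed for integration by parts. -/
theorem IsTest.testLike {a : ℕ → ℝ} {φ : Ell2 → ℝ} (hU : IsOpen U) (hφ : IsTest a U φ) :
    TestLike U φ := by
  refine ⟨?_, hφ.2.2⟩
  obtain ⟨C, hC⟩ := hφ.exists_bound hU
  have hQ : ∀ I : List ℕ, BddFCont U (iterD I φ) := by
    intro I
    cases I with
    | nil => exact ⟨hφ.1.1, hφ.1.2.1, C, hC⟩
    | cons i I =>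
      obtain ⟨-, h2, h3, h4⟩ := hφ.1.2.2 I i
      exact ⟨h3, h4, h2⟩
  have : ∀ n (I : List ℕ), SmoothOrder U n (iterD I φ) := by
    intro n
    induction n with
    | zero => exact hQ
    | succ n ih => exact fun I => ⟨hQ I, fun i => ⟨(hφ.1.2.2 I i).1, ih (i :: I)⟩⟩
  exact fun n => this n []

theorem CoordSmooth.isCFInfty (h : CoordSmooth U ψ) : IsCFInfty U ψ := by
  refine ⟨h.bddFCont.1, h.bddFCont.2.1, fun I i => ?_⟩
  obtain ⟨h1, h2, h3⟩ := (h.iterD (i :: I)).bddFCont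
  exact ⟨fun x hx => (h.iterD I).differentiableAt i hx, h3, h1, h2⟩

/-- A coordinate agrees with a smooth function with bounded derivatives on a given ball. -/
theorem exists_bddSmooth_eq_coord (i : ℕ) (R : ℝ) :
    ∃ χ : Ell2 → ℝ, BddSmooth χ ∧ ∀ x, ‖x‖ ≤ R → χ x = x i := by
  let b : ContDiffBump (0 : ℝ) := ⟨|R| + 1, |R| + 2, by positivity, by linarith⟩
  have hF : ContDiff ℝ ∞ fun s : ℝ => s * b s := contDiff_id.mul b.contDiff
  have hc : HasCompactSupport fun s : ℝ => s * b s := b.hasCompactSupport.mul_left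
  refine ⟨fun x => x i * b (x i), bddSmooth_comp_clm hF
    (exists_bound_iteratedFDeriv_of_hasCompactSupport hF hc) (coordL i), fun x hx => ?_⟩
  have hb : b (x i) = 1 := by
    refine b.one_of_mem_closedBall ?_
    simp only [Metric.mem_closedBall, dist_zero_right, Real.norm_eq_abs, b]
    have := abs_apply_le_norm x i
    have := le_abs_self R
    linarith
  change x i * b (x i) = x i
  rw [hb, mul_one]

theorem partialD_eq_zero_of_eventually {i : ℕ} {x : Ell2}
    (h : ∀ᶠ t : ℝ in 𝓝 0, ψ (x + t • e i) = 0) : partialD i ψ x = 0 := by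
  have : (fun t : ℝ => ψ (x + t • e i)) =ᶠ[𝓝 0] fun _ => (0 : ℝ) := h
  rw [partialD, this.deriv_eq, deriv_const]

/-- Where `D_i^* ψ` does not vanish, there are points at which `ψ` does not vanish nearby. -/
theorem exists_near_of_adjD_ne_zero {a : ℕ → ℝ} (hU : IsOpen U) {i : ℕ} {x : Ell2} (hx : x ∈ U)
    (h : adjD a i ψ x ≠ 0) {δ : ℝ} (hδ : 0 < δ) :
    ∃ y ∈ U, ψ y ≠ 0 ∧ dist y x < δ := by
  by_contra! hcon
  have hev : ∀ᶠ t : ℝ in 𝓝 0, ψ (x + t • e i) = 0 := by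
    have hc : ContinuousAt (fun t : ℝ => x + t • e i) 0 := (hasDerivAt_line x i 0).continuousAt
    have hc2 := hc.eventually_mem (s := Metric.ball x δ) (by simpa using Metric.ball_mem_nhds x hδ)
    filter_upwards [eventually_line_mem hU hx i, hc2] with t h1 h2
    by_contra h3
    exact absurd (hcon _ h1 h3) (not_le.2 h2)
  apply h
  have h0 : ψ x = 0 := by simpa using hev.self_of_nhds
  rw [adjD, partialD_eq_zero_of_eventually hev, h0]; simp

/-- The class is stable under `D_i^*`: the unbounded factor `x_i` can be replaced by a bounded smooth
function, since the support is bounded. -/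
theorem TestLike.adjD {a : ℕ → ℝ} (hU : IsOpen U) (h : TestLike U ψ) (i : ℕ) :
    TestLike U (adjD a i ψ) := by
  obtain ⟨hs, r, hr, R, hR, h1, h2⟩ := h
  constructor
  · obtain ⟨χ, hχ, hχR⟩ := exists_bddSmooth_eq_coord i R
    have hneg : BddSmooth fun _ : Ell2 => (-1 : ℝ) :=
      ⟨contDiff_const, fun k => by
        cases k with
        | zero => exact ⟨1, fun x => by simp⟩
        | succ k => exact ⟨0, fun x => by simp [iteratedFDeriv_succ_const]⟩⟩
    have h3 := ((hneg.coordSmooth U).mul hU (hs.partialD i)).add hU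
      (((hχ.const_mul (1 / a i ^ 2)).coordSmooth U).mul hU hs)
    refine h3.congr hU fun x hx => ?_
    by_cases h0 : ψ x = 0
    · simp [Ell2.adjD, h0]
    · have hxR : ‖x‖ < R := by simpa using h2 (show x ∈ {x ∈ U | ψ x ≠ 0} from ⟨hx, h0⟩)
      simp only [Ell2.adjD, hχR x hxR.le]; ring
  · refine ⟨r / 2, by positivity, R + 1, by positivity, ?_, ?_⟩
    · refine iUnion₂_subset fun x hx z hz => ?_
      obtain ⟨y, hyU, hy0, hyx⟩ := exists_near_of_adjD_ne_zero hU hx.1 hx.2 (half_pos hr)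
      refine h1 (mem_biUnion (show y ∈ {x ∈ U | ψ x ≠ 0} from ⟨hyU, hy0⟩) ?_)
      rw [Metric.mem_ball] at hz ⊢
      have := dist_triangle z x y
      rw [dist_comm x y] at this
      linarith
    · intro x hx
      obtain ⟨y, hyU, hy0, hyx⟩ := exists_near_of_adjD_ne_zero hU hx.1 hx.2 one_pos
      have h4 : ‖y‖ < R := by simpa using h2 (show y ∈ {x ∈ U | ψ x ≠ 0} from ⟨hyU, hy0⟩)
      rw [mem_ball_zero_iff]
      have := norm_sub_norm_le x y
      rw [dist_comm, dist_eq_norm] at hyx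
      linarith

theorem TestLike.iterAdjD {a : ℕ → ℝ} (hU : IsOpen U) (h : TestLike U ψ) (I : List ℕ) :
    TestLike U (iterAdjD a I ψ) := by
  induction I generalizing ψ with
  | nil => exact h
  | cons i I ih => exact ih (h.adjD hU i)

theorem adjD_eqOn {a : ℕ → ℝ} (hU : IsOpen U) (h : EqOn ψ θ U) (i : ℕ) :
    EqOn (adjD a i ψ) (adjD a i θ) U := fun x hx => by
  simp only [adjD, partialD_eqOn hU h i hx, h hx]

theorem iterAdjD_eqOn {a : ℕ → ℝ} (hU : IsOpen U) (h : EqOn ψ θ U) (I : List ℕ) :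
    EqOn (iterAdjD a I ψ) (iterAdjD a I θ) U := by
  induction I generalizing ψ θ with
  | nil => exact h
  | cons i I ih => exact ih (adjD_eqOn hU h i)

/-! ### Weighted sums of squares of partial derivatives -/

/-- `∑_{i₁,…,iₖ} a_{i₁}² ⋯ a_{iₖ}² |D_{i₁} ⋯ D_{iₖ} ψ (x)|²`. -/
def sqEnergy (a : ℕ → ℝ) (k : ℕ) (ψ : Ell2 → ℝ) (x : Ell2) : ℝ≥0∞ :=
  ∑' i : Fin k → ℕ, ENNReal.ofReal ((∏ j, a (i j) ^ 2) * |iterD (List.ofFn i) ψ x| ^ 2)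

theorem sqEnergy_zero (a : ℕ → ℝ) (ψ : Ell2 → ℝ) (x : Ell2) :
    sqEnergy a 0 ψ x = ENNReal.ofReal (ψ x ^ 2) := by
  rw [sqEnergy, tsum_eq_single default (fun i hi => absurd (Subsingleton.elim i default) hi)]
  simp [iterD]

/-- The sum over multi-indices of length `k + 1`, split according to the last index. -/
theorem sqEnergy_succ (a : ℕ → ℝ) (k : ℕ) (ψ : Ell2 → ℝ) (x : Ell2) :
    sqEnergy a (k + 1) ψ x =
      ∑' i : ℕ, ENNReal.ofReal (a i ^ 2) * sqEnergy a k (partialD i ψ) x := by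
  rw [sqEnergy, ← (Fin.snocEquiv fun _ : Fin (k + 1) => ℕ).tsum_eq, ENNReal.tsum_prod']
  refine tsum_congr fun i => ?_
  rw [sqEnergy, ← ENNReal.tsum_mul_left]
  refine tsum_congr fun I => ?_
  rw [← ENNReal.ofReal_mul (sq_nonneg _)]
  congr 1
  have h1 : List.ofFn (Fin.snoc (α := fun _ => ℕ) I i) = List.ofFn I ++ [i] := by
    rw [List.ofFn_succ']; simp [List.concat_eq_append]
  have h2 : ∏ j, a (Fin.snoc (α := fun _ => ℕ) I i j) ^ 2 = (∏ j, a (I j) ^ 2) * a i ^ 2 := by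
    rw [Fin.prod_univ_castSucc]; simp
  simp only [Fin.snocEquiv, Equiv.coe_fn_mk]
  rw [h1, h2, iterD_append_singleton]
  ring

theorem sqEnergy_congr {a : ℕ → ℝ} (hU : IsOpen U) (h : EqOn ψ θ U) (k : ℕ) {x : Ell2}
    (hx : x ∈ U) : sqEnergy a k ψ x = sqEnergy a k θ x := by
  unfold sqEnergy
  exact tsum_congr fun i => by rw [iterD_eqOn hU h _ hx]

theorem sqEnergy_add_le {a : ℕ → ℝ} (hU : IsOpen U) (h : CoordSmooth U ψ) (h' : CoordSmooth U θ)
    (k : ℕ) {x : Ell2} (hx : x ∈ U) :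
    sqEnergy a k (fun x => ψ x + θ x) x ≤ 2 * (sqEnergy a k ψ x + sqEnergy a k θ x) := by
  induction k generalizing ψ θ with
  | zero =>
    simp only [sqEnergy_zero]
    rw [← ENNReal.ofReal_add (sq_nonneg _) (sq_nonneg _), ← ENNReal.ofReal_ofNat,
      ← ENNReal.ofReal_mul (by norm_num)]
    exact ENNReal.ofReal_le_ofReal (by nlinarith [sq_nonneg (ψ x - θ x)])
  | succ k ih =>
    simp only [sqEnergy_succ]
    rw [← ENNReal.tsum_add, ← ENNReal.tsum_mul_left]
    refine ENNReal.tsum_le_tsum fun i => ?_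
    have he : EqOn (partialD i fun x => ψ x + θ x)
        (fun x => partialD i ψ x + partialD i θ x) U := fun y hy =>
      partialD_add (h.differentiableAt i hy) (h'.differentiableAt i hy)
    rw [sqEnergy_congr hU he k hx, ← mul_add, mul_left_comm]
    gcongr
    exact ih (h.partialD i) (h'.partialD i)

/-- Leibniz estimate for a product with a function whose derivatives are uniformly bounded. -/
theorem sqEnergy_mul_le {a : ℕ → ℝ} (ha : ∑' i, ENNReal.ofReal (a i ^ 2) ≤ 1) (hU : IsOpen U)
    {η : Ell2 → ℝ} (hη : BddSmooth η) {φ : Ell2 → ℝ} (hφ : CoordSmooth U φ) (k : ℕ) {M : ℝ}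
    (hM : ∀ I : List ℕ, I.length ≤ k → ∀ y, iterD I η y ^ 2 ≤ M) {x : Ell2} (hx : x ∈ U) :
    sqEnergy a k (fun x => η x * φ x) x ≤
      ENNReal.ofReal M * 4 ^ k * ∑ l ∈ Finset.range (k + 1), sqEnergy a l φ x := by
  have hM0 : 0 ≤ M := (sq_nonneg _).trans (hM [] (by simp) 0)
  induction k generalizing η φ with
  | zero =>
    simp only [sqEnergy_zero, pow_zero, mul_one, zero_add, Finset.range_one, Finset.sum_singleton]
    rw [← ENNReal.ofReal_mul hM0, mul_pow]
    refine ENNReal.ofReal_le_ofReal ?_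
    gcongr
    exact hM [] (by simp) x
  | succ k ih =>
    rw [sqEnergy_succ]
    have hstep : ∀ i, sqEnergy a k (partialD i fun x => η x * φ x) x ≤
        2 * (ENNReal.ofReal M * 4 ^ k * ∑ l ∈ Finset.range (k + 1), sqEnergy a l φ x +
          ENNReal.ofReal M * 4 ^ k * ∑ l ∈ Finset.range (k + 1),
            sqEnergy a l (partialD i φ) x) := by
      intro i
      have he : EqOn (partialD i fun x => η x * φ x)
          (fun x => partialD i η x * φ x + η x * partialD i φ x) U := fun y hy =>
        partialD_mul ((hη.coordSmooth U).differentiableAt i hy) (hφ.differentiableAt i hy)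
      rw [sqEnergy_congr hU he k hx]
      refine (sqEnergy_add_le hU (((hη.partialD i).coordSmooth U).mul hU hφ)
        ((hη.coordSmooth U).mul hU (hφ.partialD i)) k hx).trans ?_
      gcongr
      · refine ih (hη.partialD i) hφ fun I hI y => ?_
        rw [← iterD_append_singleton]
        exact hM _ (by simpa using hI) y
      · exact ih hη (hφ.partialD i) fun I hI y => hM I (by omega) y
    set c := ENNReal.ofReal M * 4 ^ k with hc
    calc ∑' i, ENNReal.ofReal (a i ^ 2) * sqEnergy a k (partialD i fun x => η x * φ x) x
        ≤ ∑' i, (ENNReal.ofReal (a i ^ 2) *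
              (2 * c * ∑ l ∈ Finset.range (k + 1), sqEnergy a l φ x) + 2 * c *
            ∑ l ∈ Finset.range (k + 1), ENNReal.ofReal (a i ^ 2) *
              sqEnergy a l (partialD i φ) x) := by
          refine ENNReal.tsum_le_tsum fun i => ?_
          refine (mul_le_mul_right (hstep i) _).trans (le_of_eq ?_)
          rw [← Finset.mul_sum]; ring
      _ = (∑' i, ENNReal.ofReal (a i ^ 2)) *
            (2 * c * ∑ l ∈ Finset.range (k + 1), sqEnergy a l φ x) + 2 * c *
            ∑ l ∈ Finset.range (k + 1), sqEnergy a (l + 1) φ x := by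
          rw [ENNReal.tsum_add, ENNReal.tsum_mul_right, ENNReal.tsum_mul_left,
            Summable.tsum_finsetSum (fun _ _ => ENNReal.summable)]
          simp only [← sqEnergy_succ]
      _ ≤ 1 * (2 * c * ∑ l ∈ Finset.range (k + 2), sqEnergy a l φ x) + 2 * c *
            ∑ l ∈ Finset.range (k + 2), sqEnergy a l φ x := by
          gcongr ?_ * (2 * c * ?_) + 2 * c * ?_
          · rw [Finset.sum_range_succ _ (k + 1)]; exact le_self_add
          · rw [Finset.sum_range_succ' _ (k + 1)]; exact le_self_add
      _ = ENNReal.ofReal M * 4 ^ (k + 1) * ∑ l ∈ Finset.range (k + 2), sqEnergy a l φ x := by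
          rw [hc, pow_succ]; ring

theorem sqEnergy_le_of_bound {a : ℕ → ℝ} (ha : ∑' i, ENNReal.ofReal (a i ^ 2) ≤ 1) (k : ℕ) {M : ℝ}
    {x : Ell2} (hM : ∀ I : List ℕ, I.length = k → iterD I ψ x ^ 2 ≤ M) :
    sqEnergy a k ψ x ≤ ENNReal.ofReal M := by
  induction k generalizing ψ with
  | zero =>
    rw [sqEnergy_zero]
    exact ENNReal.ofReal_le_ofReal (hM [] rfl)
  | succ k ih =>
    rw [sqEnergy_succ]
    calc _ ≤ ∑' i, ENNReal.ofReal (a i ^ 2) * ENNReal.ofReal M := by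
          refine ENNReal.tsum_le_tsum fun i => ?_
          gcongr
          refine ih fun I hI => ?_
          rw [← iterD_append_singleton]
          exact hM _ (by simpa using hI)
      _ ≤ 1 * ENNReal.ofReal M := by rw [ENNReal.tsum_mul_right]; gcongr
      _ = _ := one_mul _

theorem BddSmooth.exists_bound_sq {η : Ell2 → ℝ} (hη : BddSmooth η) (k : ℕ) :
    ∃ M : ℝ, ∀ I : List ℕ, I.length ≤ k → ∀ y, Ell2.iterD I η y ^ 2 ≤ M := by
  choose C hC using hη.exists_bound_iterD
  refine ⟨∑ j ∈ Finset.range (k + 1), C j ^ 2, fun I hI y => ?_⟩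
  have h := hC I.length I rfl y
  have h2 : Ell2.iterD I η y ^ 2 ≤ C I.length ^ 2 := by
    rw [← sq_abs]
    gcongr
  exact h2.trans (Finset.single_le_sum (f := fun j => C j ^ 2) (fun j _ => sq_nonneg _)
    (Finset.mem_range.2 (by omega)))

/-- The standing assumption on the weights. -/
structure Weights (a : ℕ → ℝ) : Prop where
  pos : ∀ i, 0 < a i
  summable : Summable a
  tsum_lt : ∑' i, a i < 1

theorem Weights.sq_le {a : ℕ → ℝ} (ha : Weights a) (i : ℕ) :
    a i ^ 2 ≤ a i := by
  have h1 : a i ≤ 1 :=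
    (ha.summable.le_tsum i fun j _ => (ha.pos j).le).trans ha.tsum_lt.le
  nlinarith [ha.pos i]

theorem Weights.summable_sq {a : ℕ → ℝ} (ha : Weights a) : Summable fun i => a i ^ 2 :=
  ha.summable.of_nonneg_of_le (fun _ => sq_nonneg _) ha.sq_le

theorem Weights.tsum_ofReal_sq_le {a : ℕ → ℝ} (ha : Weights a) :
    ∑' i, ENNReal.ofReal (a i ^ 2) ≤ 1 := by
  rw [← ENNReal.ofReal_tsum_of_nonneg (fun _ => sq_nonneg _) ha.summable_sq, ← ENNReal.ofReal_one]
  exact ENNReal.ofReal_le_ofReal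
    ((ha.summable_sq.tsum_le_tsum ha.sq_le ha.summable).trans ha.tsum_lt.le)

theorem Weights.isProbabilityMeasure {a : ℕ → ℝ} (ha : Weights a) :
    IsProbabilityMeasure (gaussian a) := isProbabilityMeasure_gaussian a ha.summable_sq

theorem isTest_of_bddSmooth {a : ℕ → ℝ} (ha : Weights a) {φ : Ell2 → ℝ}
    (hφ : BddSmooth φ) (hs : UniformlyIncluded {x ∈ U | φ x ≠ 0} U) : IsTest a U φ := by
  refine ⟨(hφ.coordSmooth U).isCFInfty, fun k _ => ?_, hs⟩
  obtain ⟨M, hM⟩ := hφ.exists_bound_sq k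
  refine (iSup₂_le fun x _ => ?_).trans_lt (ENNReal.ofReal_lt_top (r := M))
  exact sqEnergy_le_of_bound ha.tsum_ofReal_sq_le k fun I hI => hM I hI.le x

/-- Multiplying a test function by a cutoff function gives a test function on a smaller open set, if
the support allows it. -/
theorem isTest_mul {a : ℕ → ℝ} (ha : Weights a) (hV : IsOpen V) (hUV : U ⊆ V)
    {η φ : Ell2 → ℝ} (hη : BddSmooth η) (hφ : IsTest a V φ)
    (hs : UniformlyIncluded {x ∈ U | η x * φ x ≠ 0} U) : IsTest a U fun x => η x * φ x := by
  have hφc := (hφ.testLike hV).1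
  refine ⟨(((hη.coordSmooth V).mul hV hφc).mono hUV).isCFInfty, fun k _ => ?_, hs⟩
  obtain ⟨M, hM⟩ := hη.exists_bound_sq k
  have hbd : ∀ l, ⨆ x ∈ V, sqEnergy a l φ x < ⊤ := by
    intro l
    cases l with
    | zero =>
      obtain ⟨C, hC⟩ := hφ.exists_bound hV
      refine (iSup₂_le fun x hx => ?_).trans_lt (ENNReal.ofReal_lt_top (r := C ^ 2))
      rw [sqEnergy_zero]
      refine ENNReal.ofReal_le_ofReal ?_
      rw [← sq_abs]
      have := hC x hx
      gcongr
    | succ l => exact hφ.2.1 (l + 1) (by omega)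
  have hfin : ENNReal.ofReal M * 4 ^ k * ∑ l ∈ Finset.range (k + 1), ⨆ x ∈ V, sqEnergy a l φ x < ⊤ :=
    ENNReal.mul_lt_top (ENNReal.mul_lt_top ENNReal.ofReal_lt_top (ENNReal.pow_lt_top (by simp)))
      (ENNReal.sum_lt_top.2 fun l _ => hbd l)
  refine (iSup₂_le fun x hx => ?_).trans_lt hfin
  refine (sqEnergy_mul_le ha.tsum_ofReal_sq_le hV hη hφc k hM (hUV hx)).trans ?_
  gcongr with l hl
  exact le_iSup₂ (f := fun x (_ : x ∈ V) => sqEnergy a l φ x) x (hUV hx)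

/-! ### Integration by parts -/

theorem BddFCont.measurable_indicator (hU : IsOpen U) (h : BddFCont U ψ) :
    Measurable (U.indicator ψ) := by
  refine measurable_of_restrict_of_restrict_compl hU.measurableSet ?_ ?_
  · have : U.domRestrict (U.indicator ψ) = fun x : U => ψ x := by
      ext x
      exact indicator_of_mem x.2 _
    rw [this]; exact h.2.1
  · have : Uᶜ.domRestrict (U.indicator ψ) = fun _ => 0 := by
      ext x
      exact indicator_of_notMem x.2 _
    rw [this]; exact measurable_const

theorem BddFCont.exists_bound_indicator (h : BddFCont U ψ) :
    ∃ C, ∀ x, ‖U.indicator ψ x‖ ≤ C := by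
  obtain ⟨C, hC⟩ := h.2.2
  refine ⟨max C 0, fun x => ?_⟩
  by_cases hx : x ∈ U
  · rw [indicator_of_mem hx]; exact (hC x hx).trans (le_max_left _ _)
  · rw [indicator_of_notMem hx, norm_zero]; exact le_max_right _ _

theorem BddFCont.integrableOn_mul {f : Ell2 → ℝ} {μ : Measure Ell2} (hU : IsOpen U)
    (h : BddFCont U ψ) (hf : IntegrableOn f U μ) : IntegrableOn (fun x => f x * ψ x) U μ := by
  obtain ⟨C, hC⟩ := h.exists_bound_indicator
  have h1 : IntegrableOn (fun x => f x * U.indicator ψ x) U μ :=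
    Integrable.mul_bdd (c := C) hf (h.measurable_indicator hU).aestronglyMeasurable
      (Eventually.of_forall hC)
  exact h1.congr_fun (fun x hx => by simp [indicator_of_mem hx]) hU.measurableSet

theorem BddFCont.integrableOn {μ : Measure Ell2} [IsFiniteMeasure μ] (hU : IsOpen U)
    (h : BddFCont U ψ) : IntegrableOn ψ U μ := by
  have := h.integrableOn_mul hU (f := fun _ => (1 : ℝ)) (μ := μ) (integrable_const _)
  simpa using this

theorem hasDerivAt_gaussianPDFReal {v : NNReal} (hv : v ≠ 0) (t : ℝ) :
    HasDerivAt (ProbabilityTheory.gaussianPDFReal 0 v)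
      (-(t / v) * ProbabilityTheory.gaussianPDFReal 0 v t) t := by
  have hv' : (v : ℝ) ≠ 0 := by exact_mod_cast hv
  unfold ProbabilityTheory.gaussianPDFReal
  have h1 : HasDerivAt (fun x : ℝ => -(x - 0) ^ 2 / (2 * v)) (-(t / v)) t := by
    have := (((hasDerivAt_id t).sub_const (0 : ℝ)).pow 2).neg.div_const (2 * (v : ℝ))
    refine this.congr_deriv ?_
    simp only [id]
    field_simp
    push_cast
    ring
  refine (h1.exp.const_mul _).congr_deriv ?_
  ring

/-- Gaussian integration by parts in one coordinate. By Fubini it suffices to integrate along each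
line in direction `e i`, where the integrand is the derivative of an integrable function. -/
theorem integral_adjD_eq_zero {a : ℕ → ℝ} (ha : Weights a) (hU : IsOpen U) (h : TestLike U ψ)
    (i : ℕ) : ∫ x in U, adjD a i ψ x ∂(gaussian a) = 0 := by
  have := ha.isProbabilityMeasure
  have hv := toNNReal_sq_ne_zero ha.pos i
  have hvc : ((Real.toNNReal (a i ^ 2) : NNReal) : ℝ) = a i ^ 2 :=
    Real.coe_toNNReal _ (sq_nonneg _)
  have hG := (h.adjD (a := a) hU i).1.bddFCont
  have hGm := hG.measurable_indicator hU
  obtain ⟨C, hC⟩ := hG.exists_bound_indicator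
  obtain ⟨D, hD⟩ := h.1.bddFCont.exists_bound_indicator
  have hc : Continuous fun q : ℝ × Ell2 => q.2 + (q.1 - q.2 i) • e i :=
    continuous_snd.add ((continuous_fst.sub ((continuous_coord i).comp continuous_snd)).smul
      continuous_const)
  rw [← integral_indicator hU.measurableSet]
  conv_lhs => rw [← map_setCoord_prod a ha.summable_sq i]
  rw [integral_map hc.aemeasurable hGm.aestronglyMeasurable, integral_prod_symm]
  swap
  · exact Integrable.of_bound (hGm.comp hc.measurable).aestronglyMeasurable C
      (Eventually.of_forall fun q => hC _)
  refine integral_eq_zero_of_ae (Eventually.of_forall fun w => ?_)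
  simp only [Pi.zero_apply]
  rw [ProbabilityTheory.integral_gaussianReal_eq_integral_smul hv]
  -- On the line through `w` the integrand is minus the derivative of `pdf * ψ`.
  set x := w + (-(w i)) • e i with hx
  have hline : ∀ t : ℝ, w + (t - w i) • e i = x + t • e i := fun t => by
    rw [hx, add_assoc, ← add_smul]; congr 2; ring
  have hcoord : ∀ t : ℝ, (x + t • e i) i = t := fun t => by
    rw [← hline, add_smul_e_apply]; simp
  simp only [hline, smul_eq_mul]
  set pdf := ProbabilityTheory.gaussianPDFReal 0 (Real.toNNReal (a i ^ 2)) with hpdf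
  have hd : ∀ t, HasDerivAt (fun t : ℝ => -(pdf t * U.indicator ψ (x + t • e i)))
      (pdf t * U.indicator (adjD a i ψ) (x + t • e i)) t := by
    intro t
    have h1 := (hasDerivAt_gaussianPDFReal hv t).mul
      (hasDerivAt_indicator_line hU h.2 i (fun y hy => h.1.differentiableAt i hy) x t)
    refine h1.neg.congr_deriv ?_
    rw [hvc]
    by_cases hm : x + t • e i ∈ U
    · simp only [indicator_of_mem hm, Ell2.adjD, hcoord]
      ring
    · simp only [indicator_of_notMem hm]; ring
  have hlc : Continuous fun t : ℝ => x + t • e i := by fun_prop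
  have hpi : Integrable pdf := ProbabilityTheory.integrable_gaussianPDFReal _ _
  refine integral_eq_zero_of_hasDerivAt_of_integrable hd ?_ ?_
  · exact hpi.mul_bdd (c := C) (hGm.comp hlc.measurable).aestronglyMeasurable
      (Eventually.of_forall fun t => hC _)
  · exact (hpi.mul_bdd (c := D)
      ((h.1.bddFCont.measurable_indicator hU).comp hlc.measurable).aestronglyMeasurable
      (Eventually.of_forall fun t => hD _)).neg

/-- `D_i^*` is the adjoint of `D_i`: apply `integral_adjD_eq_zero` to the product. -/
theorem integral_partialD_mul {a : ℕ → ℝ} (ha : Weights a) (hU : IsOpen U) (hθ : CoordSmooth U θ)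
    (h : TestLike U ψ) (i : ℕ) :
    ∫ x in U, partialD i θ x * ψ x ∂(gaussian a) = ∫ x in U, θ x * adjD a i ψ x ∂(gaussian a) := by
  have := ha.isProbabilityMeasure
  have hprod : TestLike U fun x => θ x * ψ x := by
    refine ⟨hθ.mul hU h.1, h.2.mono ?_⟩
    rintro x ⟨hx, hne⟩
    exact ⟨hx, right_ne_zero_of_mul hne⟩
  have h0 := integral_adjD_eq_zero ha hU hprod i
  have he : ∫ x in U, adjD a i (fun x => θ x * ψ x) x ∂(gaussian a) =
      ∫ x in U, (θ x * adjD a i ψ x - partialD i θ x * ψ x) ∂(gaussian a) := by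
    refine setIntegral_congr_fun hU.measurableSet fun x hx => ?_
    simp only [adjD, partialD_mul (hθ.differentiableAt i hx) (h.1.differentiableAt i hx)]
    ring
  rw [he, integral_sub ((hθ.bddFCont.mul (h.adjD hU i).1.bddFCont).integrableOn hU)
    (((hθ.partialD i).bddFCont.mul h.1.bddFCont).integrableOn hU)] at h0
  linarith

theorem integral_iterD_mul {a : ℕ → ℝ} (ha : Weights a) (hU : IsOpen U) (hθ : CoordSmooth U θ)
    (h : TestLike U ψ) (I : List ℕ) :
    ∫ x in U, iterD I θ x * ψ x ∂(gaussian a) =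
      ∫ x in U, θ x * iterAdjD a I ψ x ∂(gaussian a) := by
  induction I generalizing ψ with
  | nil => rfl
  | cons i I ih =>
    rw [iterD_cons, integral_partialD_mul ha hU (hθ.iterD I) h i, ih (h.adjD hU i)]
    rfl

/-! ### Weak derivatives -/

theorem one_le_ofReal {p : ℝ} (hp : 1 ≤ p) : 1 ≤ ENNReal.ofReal p := by
  rwa [ENNReal.one_le_ofReal]

theorem integrableOn_of_memLp {a : ℕ → ℝ} (ha : Weights a) {p : ℝ} (hp : 1 ≤ p) {f : Ell2 → ℝ}
    (hf : MemLp f (ENNReal.ofReal p) ((gaussian a).restrict U)) :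
    IntegrableOn f U (gaussian a) := by
  have := ha.isProbabilityMeasure
  exact hf.integrable (one_le_ofReal hp)

theorem BddFCont.memLp {a : ℕ → ℝ} (ha : Weights a) (hU : IsOpen U) (h : BddFCont U ψ)
    (p : ℝ≥0∞) : MemLp ψ p ((gaussian a).restrict U) := by
  have := ha.isProbabilityMeasure
  obtain ⟨C, hC⟩ := h.exists_bound_indicator
  have h1 : MemLp (U.indicator ψ) p ((gaussian a).restrict U) :=
    MemLp.of_bound (h.measurable_indicator hU).aestronglyMeasurable C (Eventually.of_forall hC)
  refine h1.ae_eq ?_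
  filter_upwards [ae_restrict_mem hU.measurableSet] with x hx
  rw [indicator_of_mem hx]

/-- Classical derivatives are weak derivatives. -/
theorem CoordSmooth.hasWeakDeriv {a : ℕ → ℝ} (ha : Weights a) (p : ℝ) (hU : IsOpen U)
    (hθ : CoordSmooth U θ) {k : ℕ} (i : Fin k → ℕ) :
    HasWeakDeriv a p U i θ (Ell2.iterD (List.ofFn i) θ) :=
  ⟨(hθ.iterD _).bddFCont.memLp ha hU _, fun _ hφ =>
    integral_iterD_mul ha hU hθ (hφ.testLike hU) _⟩

theorem HasWeakDeriv.sub {a : ℕ → ℝ} (ha : Weights a) {p : ℝ} (hp : 1 ≤ p) (hU : IsOpen U) {k : ℕ}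
    {i : Fin k → ℕ} {f₁ f₂ g₁ g₂ : Ell2 → ℝ}
    (hf₁ : MemLp f₁ (ENNReal.ofReal p) ((gaussian a).restrict U))
    (hf₂ : MemLp f₂ (ENNReal.ofReal p) ((gaussian a).restrict U))
    (h₁ : HasWeakDeriv a p U i f₁ g₁) (h₂ : HasWeakDeriv a p U i f₂ g₂) :
    HasWeakDeriv a p U i (f₁ - f₂) (g₁ - g₂) := by
  refine ⟨h₁.1.sub h₂.1, fun φ hφ => ?_⟩
  have hφt := hφ.testLike hU
  have hφb := hφt.1.bddFCont
  have hab := (hφt.iterAdjD (a := a) hU (List.ofFn i)).1.bddFCont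
  simp only [Pi.sub_apply, sub_mul]
  rw [integral_sub (hφb.integrableOn_mul hU (integrableOn_of_memLp ha hp h₁.1))
      (hφb.integrableOn_mul hU (integrableOn_of_memLp ha hp h₂.1)),
    integral_sub (hab.integrableOn_mul hU (integrableOn_of_memLp ha hp hf₁))
      (hab.integrableOn_mul hU (integrableOn_of_memLp ha hp hf₂)), h₁.2 φ hφ, h₂.2 φ hφ]

theorem hasWeakDeriv_weakDeriv {a : ℕ → ℝ} {p : ℝ} {k : ℕ} {i : Fin k → ℕ} {f : Ell2 → ℝ}
    (h : ∃ g, HasWeakDeriv a p U i f g) : HasWeakDeriv a p U i f (weakDeriv a p U i f) := by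
  rw [weakDeriv, dif_pos h]
  exact h.choose_spec

/-! ### The fundamental lemma of the calculus of variations -/

/-- An integrable function all of whose Fourier coefficients vanish is zero: its positive and
negative parts define finite measures with the same characteristic function. -/
theorem ae_eq_zero_of_fourier {μ : Measure Ell2} {q : Ell2 → ℝ} (hq : Integrable q μ)
    (hcos : ∀ t : Ell2, ∫ x, q x * Real.cos (inner ℝ t x) ∂μ = 0)
    (hsin : ∀ t : Ell2, ∫ x, q x * Real.sin (inner ℝ t x) ∂μ = 0) : q =ᵐ[μ] 0 := by
  have hfin : ∀ {q : Ell2 → ℝ}, Integrable q μ →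
      IsFiniteMeasure (μ.withDensity fun x => ENNReal.ofReal (q x)) := fun {q} hq =>
    isFiniteMeasure_withDensity_ofReal hq.2
  have h1 := hfin hq
  have h2 := hfin hq.neg
  have hexpm : ∀ t : Ell2, AEStronglyMeasurable
      (fun x : Ell2 => Complex.exp (inner ℝ x t * Complex.I)) μ := fun t =>
    Continuous.aestronglyMeasurable (by fun_prop)
  have hexp1 : ∀ t x : Ell2, ‖Complex.exp (inner ℝ x t * Complex.I)‖ ≤ 1 := fun t x =>
    (Complex.norm_exp_ofReal_mul_I _).le
  have hwd : ∀ {q : Ell2 → ℝ}, Integrable q μ → ∀ t : Ell2,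
      charFun (μ.withDensity fun x => ENNReal.ofReal (q x)) t =
        ∫ x, ((max (q x) 0 : ℝ) : ℂ) * Complex.exp (inner ℝ x t * Complex.I) ∂μ := by
    intro q hq t
    rw [charFun_apply, integral_withDensity_eq_integral_toReal_smul₀
      hq.aestronglyMeasurable.aemeasurable.ennreal_ofReal
      (Eventually.of_forall fun x => ENNReal.ofReal_lt_top)]
    refine integral_congr_ae (Eventually.of_forall fun x => ?_)
    simp only [ENNReal.toReal_ofReal', Complex.real_smul]
  have hint : ∀ {q : Ell2 → ℝ}, Integrable q μ → ∀ t : Ell2,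
      Integrable (fun x => ((q x : ℝ) : ℂ) * Complex.exp (inner ℝ x t * Complex.I)) μ :=
    fun {q} hq t => (hq.ofReal (𝕜 := ℂ)).mul_bdd (c := 1) (hexpm t)
      (Eventually.of_forall (hexp1 t))
  have heq : (μ.withDensity fun x => ENNReal.ofReal (q x)) =
      μ.withDensity fun x => ENNReal.ofReal ((-q) x) := by
    refine Measure.ext_of_charFun (funext fun t => ?_)
    rw [hwd hq t, hwd hq.neg t, ← sub_eq_zero,
      ← integral_sub (hint hq.pos_part t) (hint hq.neg.pos_part t)]
    have : ∀ x, ((max (q x) 0 : ℝ) : ℂ) * Complex.exp (inner ℝ x t * Complex.I) -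
        ((max ((-q) x) 0 : ℝ) : ℂ) * Complex.exp (inner ℝ x t * Complex.I) =
        ((q x * Real.cos (inner ℝ t x) : ℝ) : ℂ) +
          ((q x * Real.sin (inner ℝ t x) : ℝ) : ℂ) * Complex.I := by
      intro x
      have hm : max (q x) 0 - max ((-q) x) 0 = q x := by
        simp only [Pi.neg_apply]
        rcases le_total 0 (q x) with h | h
        · rw [max_eq_left h, max_eq_right (by linarith)]; ring
        · rw [max_eq_right h, max_eq_left (by linarith)]; ring
      rw [← sub_mul, ← Complex.ofReal_sub, hm, Complex.exp_mul_I, real_inner_comm]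
      push_cast
      ring
    simp_rw [this]
    have hc : Integrable (fun x => q x * Real.cos (inner ℝ t x)) μ :=
      hq.mul_bdd (c := 1) (Continuous.aestronglyMeasurable (by fun_prop))
        (Eventually.of_forall fun x => Real.abs_cos_le_one _)
    have hs : Integrable (fun x => q x * Real.sin (inner ℝ t x)) μ :=
      hq.mul_bdd (c := 1) (Continuous.aestronglyMeasurable (by fun_prop))
        (Eventually.of_forall fun x => Real.abs_sin_le_one _)
    rw [integral_add hc.ofReal (hs.ofReal.mul_const _), integral_mul_const,
      integral_complex_ofReal, integral_complex_ofReal, hcos, hsin]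
    simp
  have h3 := (withDensity_eq_iff hq.aestronglyMeasurable.aemeasurable.ennreal_ofReal
    hq.neg.aestronglyMeasurable.aemeasurable.ennreal_ofReal hq.lintegral_lt_top.ne).1 heq
  filter_upwards [h3] with x hx
  have := congrArg ENNReal.toReal hx
  simp only [ENNReal.toReal_ofReal', Pi.neg_apply] at this
  rcases le_total 0 (q x) with h | h
  · rw [max_eq_left h, max_eq_right (by linarith)] at this; exact this
  · rw [max_eq_right h, max_eq_left (by linarith)] at this
    simp only [Pi.zero_apply]; linarith

/-- Bounded smooth functions with support uniformly included in `V` separate the integrable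
functions on `V`. -/
theorem ae_eq_zero_of_integral_mul_eq_zero {μ : Measure Ell2} (hV : IsOpen V) {g : Ell2 → ℝ}
    (hg : IntegrableOn g V μ)
    (h : ∀ φ : Ell2 → ℝ, BddSmooth φ → UniformlyIncluded {x | φ x ≠ 0} V →
      ∫ x in V, g x * φ x ∂μ = 0) : g =ᵐ[μ.restrict V] 0 := by
  have key : ∀ c ∈ V, ∃ ρ > 0, ∀ᵐ x ∂(μ.restrict V), x ∈ Metric.ball c ρ → g x = 0 := by
    intro c hc
    obtain ⟨ε, hε, hεV⟩ := Metric.isOpen_iff.1 hV c hc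
    obtain ⟨η, hη, hη1, hη0, -⟩ := exists_cutoff c (r := ε / 4) (R := ε / 2) (by linarith)
      (by linarith)
    obtain ⟨B, hB⟩ := hη.exists_bound
    have hincl : UniformlyIncluded {x | η x ≠ 0} V := by
      have hlt : ∀ x, η x ≠ 0 → ‖x - c‖ < ε / 2 := fun x hx => by
        by_contra hcon
        exact hx (hη0 x (not_lt.1 hcon))
      refine ⟨ε / 2, by linarith, ‖c‖ + ε, by positivity, ?_, ?_⟩
      · refine iUnion₂_subset fun x hx z hz => hεV ?_
        have h1 := hlt x hx
        rw [← dist_eq_norm] at h1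
        rw [Metric.mem_ball] at hz ⊢
        have := dist_triangle z x c
        linarith
      · intro x hx
        have h1 := hlt x hx
        rw [mem_ball_zero_iff]
        have := norm_sub_norm_le x c
        linarith
    have hq : Integrable (fun x => g x * η x) (μ.restrict V) :=
      Integrable.mul_bdd (c := B) hg hη.continuous.aestronglyMeasurable (Eventually.of_forall hB)
    have hz := ae_eq_zero_of_fourier hq
      (fun t => by
        simp only [mul_assoc]
        exact h _ (hη.mul (bddSmooth_cos t)) (hincl.mono fun x hx => left_ne_zero_of_mul hx))
      (fun t => by
        simp only [mul_assoc]
        exact h _ (hη.mul (bddSmooth_sin t)) (hincl.mono fun x hx => left_ne_zero_of_mul hx))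
    refine ⟨ε / 4, by linarith, ?_⟩
    filter_upwards [hz] with x hx hxb
    rw [mem_ball_iff_norm] at hxb
    simpa [hη1 x hxb.le] using hx
  have hnull : (μ.restrict V) ({x | g x ≠ 0} ∩ V) = 0 := by
    refine measure_null_of_locally_null _ fun x hx => ?_
    obtain ⟨ρ, hρ, hae⟩ := key x hx.2
    refine ⟨Metric.ball x ρ ∩ ({x | g x ≠ 0} ∩ V), ?_, ?_⟩
    · rw [inter_comm (Metric.ball x ρ)]
      exact inter_mem_nhdsWithin _ (Metric.ball_mem_nhds x hρ)
    · refine measure_mono_null ?_ (ae_iff.1 hae)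
      rintro y ⟨hy1, hy2, -⟩
      simp only [mem_ofPred_eq, Classical.not_imp]
      exact ⟨hy1, hy2⟩
  have h1 : ∀ᵐ x ∂(μ.restrict V), x ∉ {x | g x ≠ 0} ∩ V := measure_eq_zero_iff_ae_notMem.1 hnull
  filter_upwards [h1, ae_restrict_mem hV.measurableSet] with x hx hxV
  by_contra hne
  exact hx ⟨hne, hxV⟩

/-- Weak derivatives are unique up to null sets. -/
theorem HasWeakDeriv.unique {a : ℕ → ℝ} (ha : Weights a) {p : ℝ} (hp : 1 ≤ p) (hU : IsOpen U)
    {k : ℕ} {i : Fin k → ℕ} {f f' g g' : Ell2 → ℝ}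
    (h : HasWeakDeriv a p U i f g) (h' : HasWeakDeriv a p U i f' g')
    (hff' : f =ᵐ[(gaussian a).restrict U] f') : g =ᵐ[(gaussian a).restrict U] g' := by
  have hgi := integrableOn_of_memLp ha hp h.1
  have hgi' := integrableOn_of_memLp ha hp h'.1
  have hz : (g - g') =ᵐ[(gaussian a).restrict U] 0 := by
    refine ae_eq_zero_of_integral_mul_eq_zero hU (hgi.sub hgi') fun φ hφ hs => ?_
    have hφt : IsTest a U φ := isTest_of_bddSmooth ha hφ (hs.mono fun x hx => hx.2)
    have hb := (hφ.coordSmooth U).bddFCont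
    simp only [Pi.sub_apply, sub_mul]
    rw [integral_sub (hb.integrableOn_mul hU hgi) (hb.integrableOn_mul hU hgi'), h.2 φ hφt,
      h'.2 φ hφt, sub_eq_zero]
    refine integral_congr_ae ?_
    filter_upwards [hff'] with x hx
    rw [hx]
  filter_upwards [hz] with x hx
  exact sub_eq_zero.1 hx

/-! ### Supports and extension by zero -/

theorem isOpen_halfSpace : IsOpen halfSpace := isOpen_lt continuous_const (continuous_coord 0)

theorem iterAdjD_zero (a : ℕ → ℝ) (I : List ℕ) : iterAdjD a I (fun _ => 0) = fun _ => 0 := by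
  induction I with
  | nil => rfl
  | cons i I ih =>
    have : adjD a i (fun _ => 0) = fun _ => (0 : ℝ) := by
      ext x; simp [adjD, partialD]
    change iterAdjD a I (adjD a i fun _ => 0) = _
    rw [this, ih]

theorem iterAdjD_eq_zero_of_notMem {a : ℕ → ℝ} {φ : Ell2 → ℝ}
    (hs : UniformlyIncluded {x | φ x ≠ 0} W) (I : List ℕ) {x : Ell2} (hx : x ∉ W) :
    iterAdjD a I φ x = 0 := by
  obtain ⟨r, hr, R, hR, h1, -⟩ := hs
  have h0 : EqOn φ (fun _ => 0) (Metric.ball x r) := by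
    intro y hy
    by_contra hne
    exact hx (h1 (mem_biUnion (show y ∈ {x | φ x ≠ 0} from hne) (by rwa [Metric.mem_ball_comm])))
  have := iterAdjD_eqOn (a := a) Metric.isOpen_ball h0 I (Metric.mem_ball_self hr)
  rw [this, iterAdjD_zero]

/-- A function vanishes almost everywhere off its support. -/
theorem ae_eq_zero_off_lpSupport {a : ℕ → ℝ} {p : ℝ} {f : Ell2 → ℝ}
    (hf : MemLp f (ENNReal.ofReal p) ((gaussian a).restrict U)) :
    IsOpen (U \ lpSupport a p U f) ∧ f =ᵐ[(gaussian a).restrict (U \ lpSupport a p U f)] 0 := by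
  set 𝓑 := {B | ∃ (x : Ell2) (r : ℝ), 0 < r ∧ B = Metric.ball x r ∧ B ⊆ U ∧
    ∫⁻ y in B, ENNReal.ofReal (|f y| ^ p) ∂(gaussian a) = 0} with h𝓑
  have hW : U \ lpSupport a p U f = ⋃₀ 𝓑 := by
    rw [lpSupport, sdiff_sdiff_right_self, inter_eq_right]
    rintro x ⟨B, ⟨c, r, hr, rfl, hBU, -⟩, hx⟩
    exact hBU hx
  have hWo : IsOpen (⋃₀ 𝓑) := isOpen_sUnion fun B hB => by
    obtain ⟨c, r, hr, rfl, -⟩ := hB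
    exact Metric.isOpen_ball
  rw [hW]
  refine ⟨hWo, ?_⟩
  have hnull : gaussian a ({x | f x ≠ 0} ∩ ⋃₀ 𝓑) = 0 := by
    refine measure_null_of_locally_null _ fun x hx => ?_
    obtain ⟨-, B, hB, hxB⟩ := hx
    obtain ⟨c, r, hr, rfl, hBU, hint⟩ := hB
    refine ⟨{x | f x ≠ 0} ∩ ⋃₀ 𝓑 ∩ Metric.ball c r,
      inter_mem_nhdsWithin _ (Metric.isOpen_ball.mem_nhds hxB), ?_⟩
    have hfm : AEMeasurable (fun y => ENNReal.ofReal (|f y| ^ p))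
        ((gaussian a).restrict (Metric.ball c r)) := by
      have h1 := (hf.aestronglyMeasurable.aemeasurable).mono_measure
        (Measure.restrict_mono hBU le_rfl)
      have h2 : Measurable fun s : ℝ => ENNReal.ofReal (|s| ^ p) := by fun_prop
      exact h2.comp_aemeasurable h1
    rw [lintegral_eq_zero_iff' hfm] at hint
    have h3 : ∀ᵐ y ∂((gaussian a).restrict (Metric.ball c r)), f y = 0 := by
      filter_upwards [hint] with y hy
      by_contra hne
      have hpos : 0 < |f y| ^ p := Real.rpow_pos_of_pos (abs_pos.2 hne) p
      exact absurd hy (ENNReal.ofReal_pos.2 hpos).ne'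
    rw [ae_restrict_iff' Metric.isOpen_ball.measurableSet] at h3
    refine measure_mono_null ?_ (ae_iff.1 h3)
    rintro y ⟨⟨hy1, -⟩, hy2⟩
    simp only [mem_ofPred_eq, Classical.not_imp]
    exact ⟨hy2, hy1⟩
  have h1 : ∀ᵐ x ∂(gaussian a), x ∉ {x | f x ≠ 0} ∩ ⋃₀ 𝓑 := measure_eq_zero_iff_ae_notMem.1 hnull
  filter_upwards [ae_restrict_of_ae h1, ae_restrict_mem hWo.measurableSet] with x hx hxW
  by_contra hne
  exact hx ⟨hne, hxW⟩

/-- Weak differentiation does not enlarge the support. -/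
theorem HasWeakDeriv.ae_eq_zero {a : ℕ → ℝ} (ha : Weights a) {p : ℝ} (hp : 1 ≤ p) (hU : IsOpen U)
    (hW : IsOpen W) (hWU : W ⊆ U) {k : ℕ} {i : Fin k → ℕ} {f g : Ell2 → ℝ}
    (h : HasWeakDeriv a p U i f g) (hf : f =ᵐ[(gaussian a).restrict W] 0) :
    g =ᵐ[(gaussian a).restrict W] 0 := by
  refine ae_eq_zero_of_integral_mul_eq_zero hW
    ((integrableOn_of_memLp ha hp h.1).mono_set hWU) fun φ hφ hs => ?_
  have hφt : IsTest a U φ :=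
    isTest_of_bddSmooth ha hφ ((hs.mono fun x hx => hx.2).mono_right hWU)
  have h1 : ∫ x in W, g x * φ x ∂(gaussian a) = ∫ x in U, g x * φ x ∂(gaussian a) := by
    refine (setIntegral_eq_of_subset_of_forall_sdiff_eq_zero hU.measurableSet hWU
      fun x hx => ?_).symm
    have := iterAdjD_eq_zero_of_notMem (a := a) hs [] hx.2
    change φ x = 0 at this
    rw [this, mul_zero]
  have h2 : ∫ x in W, f x * iterAdjD a (List.ofFn i) φ x ∂(gaussian a) =
      ∫ x in U, f x * iterAdjD a (List.ofFn i) φ x ∂(gaussian a) := by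
    refine (setIntegral_eq_of_subset_of_forall_sdiff_eq_zero hU.measurableSet hWU
      fun x hx => ?_).symm
    rw [iterAdjD_eq_zero_of_notMem hs _ hx.2, mul_zero]
  rw [h1, h.2 φ hφt, ← h2]
  refine integral_eq_zero_of_ae ?_
  filter_upwards [hf] with x hx
  simp [hx]

/-- A function on `U` and all its weak derivatives vanish off a ball that contains the support. -/
theorem ae_eq_zero_off_ball {a : ℕ → ℝ} (ha : Weights a) {p : ℝ} (hp : 1 ≤ p) (hU : IsOpen U)
    {f : Ell2 → ℝ} (hf : MemLp f (ENNReal.ofReal p) ((gaussian a).restrict U)) {c : Ell2} {r : ℝ}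
    (hs : lpSupport a p U f ⊆ Metric.ball c r) :
    (∀ᵐ x ∂((gaussian a).restrict U), x ∉ Metric.ball c r → f x = 0) ∧
    ∀ {k : ℕ} {i : Fin k → ℕ} {g : Ell2 → ℝ}, HasWeakDeriv a p U i f g →
      ∀ᵐ x ∂((gaussian a).restrict U), x ∉ Metric.ball c r → g x = 0 := by
  obtain ⟨hWo, hf0⟩ := ae_eq_zero_off_lpSupport hf
  have aux : ∀ g : Ell2 → ℝ, g =ᵐ[(gaussian a).restrict (U \ lpSupport a p U f)] 0 →
      ∀ᵐ x ∂((gaussian a).restrict U), x ∉ Metric.ball c r → g x = 0 := by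
    intro g hg
    rw [EventuallyEq, ae_restrict_iff' hWo.measurableSet] at hg
    rw [ae_restrict_iff' hU.measurableSet]
    filter_upwards [hg] with x hx hxU hxb
    exact hx ⟨hxU, fun h => hxb (hs h)⟩
  exact ⟨aux f hf0, fun h => aux _ (h.ae_eq_zero ha hp hU hWo sdiff_subset hf0)⟩

/-- The radius condition that makes a cutoff function near `c` turn supports uniformly included in
`V` into supports uniformly included in `U`. -/
theorem uniformlyIncluded_of_ball {E : Set Ell2} (hE : UniformlyIncluded E V) {c : Ell2}
    {r R : ℝ} (hrR : r < R) (hb : Metric.ball c R ∩ V ⊆ U) (hEc : E ⊆ Metric.ball c r) :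
    UniformlyIncluded E U := by
  obtain ⟨δ, hδ, B, hB, h1, h2⟩ := hE
  refine ⟨min δ (R - r), lt_min hδ (by linarith), B, hB, ?_, h2⟩
  refine iUnion₂_subset fun x hx z hz => hb ⟨?_, h1 (mem_biUnion hx ?_)⟩
  · have h3 := hEc hx
    rw [Metric.mem_ball] at h3 hz ⊢
    have := dist_triangle z x c
    have := min_le_right δ (R - r)
    linarith
  · rw [Metric.mem_ball] at hz ⊢
    exact hz.trans_le (min_le_left _ _)

/-- Testing against `η φ` instead of `φ` changes nothing, where `η` is a cutoff function equal to
one near the support. -/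
theorem HasWeakDeriv.integral_cutoff {a : ℕ → ℝ} {p : ℝ} {k : ℕ} {i : Fin k → ℕ}
    {f g : Ell2 → ℝ} (h : HasWeakDeriv a p U i f g) {c : Ell2} {r : ℝ}
    (hf0 : ∀ᵐ x ∂((gaussian a).restrict U), x ∉ Metric.ball c r → f x = 0)
    (hg0 : ∀ᵐ x ∂((gaussian a).restrict U), x ∉ Metric.ball c r → g x = 0)
    {η φ : Ell2 → ℝ} (hη1 : ∀ x, ‖x - c‖ ≤ r → η x = 1) (hηφ : IsTest a U fun x => η x * φ x) :
    ∫ x in U, g x * φ x ∂(gaussian a) =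
      ∫ x in U, f x * iterAdjD a (List.ofFn i) φ x ∂(gaussian a) := by
  have hone : ∀ x ∈ Metric.ball c r, η x = 1 := fun x hx => by
    rw [mem_ball_iff_norm] at hx
    exact hη1 x hx.le
  have h1 : ∫ x in U, g x * φ x ∂(gaussian a) = ∫ x in U, g x * (η x * φ x) ∂(gaussian a) := by
    refine integral_congr_ae ?_
    filter_upwards [hg0] with x hx
    by_cases hxb : x ∈ Metric.ball c r
    · rw [hone x hxb, one_mul]
    · simp [hx hxb]
  rw [h1, h.2 _ hηφ]
  refine integral_congr_ae ?_
  filter_upwards [hf0] with x hx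
  by_cases hxb : x ∈ Metric.ball c r
  · rw [iterAdjD_eqOn (θ := φ) Metric.isOpen_ball (fun y hy => ?_) _ hxb]
    simp [hone y hy]
  · simp [hx hxb]

/-- Extension by zero commutes with weak differentiation when the support stays away from the part of
the boundary of `U` inside `V`. -/
theorem hasWeakDeriv_indicator {a : ℕ → ℝ} (ha : Weights a) {p : ℝ} (hU : IsOpen U)
    (hV : IsOpen V) (hUV : U ⊆ V) {k : ℕ} {i : Fin k → ℕ} {f g : Ell2 → ℝ}
    (h : HasWeakDeriv a p U i f g) {c : Ell2} {r R : ℝ} (hr : 0 < r) (hrR : r < R)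
    (hb : Metric.ball c R ∩ V ⊆ U)
    (hf0 : ∀ᵐ x ∂((gaussian a).restrict U), x ∉ Metric.ball c r → f x = 0)
    (hg0 : ∀ᵐ x ∂((gaussian a).restrict U), x ∉ Metric.ball c r → g x = 0) :
    HasWeakDeriv a p V i (U.indicator f) (U.indicator g) := by
  refine ⟨?_, fun φ hφ => ?_⟩
  · rw [memLp_indicator_iff_restrict hU.measurableSet, Measure.restrict_restrict hU.measurableSet,
      inter_eq_left.2 hUV]
    exact h.1
  obtain ⟨η, hη, hη1, hη0, -⟩ := exists_cutoff c (r := r) (R := (r + R) / 2) hr (by linarith)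
  have hηφ : IsTest a U fun x => η x * φ x := by
    refine isTest_mul ha hV hUV hη hφ ?_
    refine uniformlyIncluded_of_ball (r := (r + R) / 2) (R := R)
      (hφ.2.2.mono fun x hx => ⟨hUV hx.1, right_ne_zero_of_mul hx.2⟩) (by linarith) hb
      fun x hx => ?_
    rw [mem_ball_iff_norm]
    by_contra hcon
    exact left_ne_zero_of_mul hx.2 (hη0 x (not_lt.1 hcon))
  have key := h.integral_cutoff hf0 hg0 hη1 hηφ
  have hind : ∀ q ψ : Ell2 → ℝ, ∫ x in V, U.indicator q x * ψ x ∂(gaussian a) =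
      ∫ x in U, q x * ψ x ∂(gaussian a) := by
    intro q ψ
    simp only [← indicator_mul_left]
    rw [setIntegral_indicator hU.measurableSet, inter_eq_right.2 hUV]
  rw [hind, hind, key]

theorem lintegral_indicator_rpow {μ : Measure Ell2} {p : ℝ} (hp : 1 ≤ p) (hU : IsOpen U)
    (hUV : U ⊆ V) (g : Ell2 → ℝ) :
    ∫⁻ x in V, ENNReal.ofReal (|U.indicator g x| ^ p) ∂μ =
      ∫⁻ x in U, ENNReal.ofReal (|g x| ^ p) ∂μ := by
  have : (fun x => ENNReal.ofReal (|U.indicator g x| ^ p)) =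
      U.indicator fun x => ENNReal.ofReal (|g x| ^ p) := by
    ext x
    by_cases hx : x ∈ U
    · simp [hx]
    · simp [hx, Real.zero_rpow (by linarith : p ≠ 0)]
  rw [this, setLIntegral_indicator hU.measurableSet, inter_eq_left.2 hUV]

/-- The extension by zero lies in the Sobolev space of the larger set, and its weak derivatives are
the extensions by zero. -/
theorem extension_by_zero {a : ℕ → ℝ} (ha : Weights a) {m : ℕ} {p : ℝ} (hp : 1 ≤ p) (hU : IsOpen U)
    (hV : IsOpen V) (hUV : U ⊆ V) {f : Ell2 → ℝ} (hf : MemSobolev a m p U f)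
    {c : Ell2} {r R : ℝ} (hr : 0 < r) (hrR : r < R) (hb : Metric.ball c R ∩ V ⊆ U)
    (hs : lpSupport a p U f ⊆ Metric.ball c r) :
    MemSobolev a m p V (U.indicator f) ∧
    ∀ k : ℕ, 1 ≤ k → k ≤ m → ∀ i : Fin k → ℕ,
      weakDeriv a p V i (U.indicator f) =ᵐ[(gaussian a).restrict V]
        U.indicator (weakDeriv a p U i f) := by
  obtain ⟨hf0, hg0⟩ := ae_eq_zero_off_ball ha hp hU hf.1 hs
  have hwd : ∀ k : ℕ, 1 ≤ k → k ≤ m → ∀ i : Fin k → ℕ,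
      HasWeakDeriv a p V i (U.indicator f) (U.indicator (weakDeriv a p U i f)) := by
    intro k hk hkm i
    have h := hasWeakDeriv_weakDeriv (hf.2.1 k hk hkm i)
    exact hasWeakDeriv_indicator ha hU hV hUV h hr hrR hb hf0 (hg0 h)
  have hae : ∀ k : ℕ, 1 ≤ k → k ≤ m → ∀ i : Fin k → ℕ,
      weakDeriv a p V i (U.indicator f) =ᵐ[(gaussian a).restrict V]
        U.indicator (weakDeriv a p U i f) := fun k hk hkm i =>
    (hasWeakDeriv_weakDeriv ⟨_, hwd k hk hkm i⟩).unique ha hp hV (hwd k hk hkm i) (ae_eq_refl _)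
  refine ⟨⟨?_, fun k hk hkm i => ⟨_, hwd k hk hkm i⟩, ?_⟩, hae⟩
  · rw [memLp_indicator_iff_restrict hU.measurableSet, Measure.restrict_restrict hU.measurableSet,
      inter_eq_left.2 hUV]
    exact hf.1
  · have : derivEnergy a m p V (U.indicator f) = derivEnergy a m p U f := by
      refine Finset.sum_congr rfl fun k hk => tsum_congr fun i => ?_
      rw [Finset.mem_Icc] at hk
      congr 1
      rw [← lintegral_indicator_rpow hp hU hUV]
      refine lintegral_congr_ae ?_
      filter_upwards [hae k hk.1 hk.2 i] with x hx
      rw [hx]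
    rw [this]
    exact hf.2.2

/-! ### Mollification in finitely many coordinates -/

/-- The Gaussian average of `g` over the coordinates beyond the first `n`, mollified with `ρ` in the
first `n` coordinates. Dividing by the Gaussian density turns the integral over the first `n`
coordinates into an integral for the Lebesgue measure. -/
def mollify (a : ℕ → ℝ) (n : ℕ) (ρ : (Fin n → ℝ) → ℝ) (g : Ell2 → ℝ) (y : Fin n → ℝ) : ℝ :=
  ∫ w, ρ (y - headL n w) * ((headPDF a n (headL n w))⁻¹ * g w) ∂(gaussian a)

theorem norm_headL_le (n : ℕ) (x : Ell2) : ‖headL n x‖ ≤ ‖x‖ :=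
  (pi_norm_le_iff_of_nonneg (norm_nonneg _)).2 fun j => abs_apply_le_norm x j

theorem exists_bound_inv_headPDF {a : ℕ → ℝ} (ha : Weights a) (n : ℕ) (R : ℝ) :
    ∃ C, ∀ y : Fin n → ℝ, ‖y‖ ≤ R → (headPDF a n y)⁻¹ ≤ C := by
  have hc : Continuous fun y : Fin n → ℝ => (headPDF a n y)⁻¹ :=
    (continuous_headPDF a n).inv₀ fun y => (headPDF_pos ha.pos n y).ne'
  obtain ⟨C, hC⟩ := (isCompact_closedBall (0 : Fin n → ℝ) R).exists_bound_of_continuousOn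
    hc.continuousOn
  exact ⟨C, fun y hy => (le_abs_self _).trans (hC y (by simpa using hy))⟩

theorem integrable_inv_headPDF_mul {a : ℕ → ℝ} (ha : Weights a) (n : ℕ) {g : Ell2 → ℝ}
    (hg : Integrable g (gaussian a)) {R : ℝ} (hR : ∀ x, R ≤ ‖x‖ → g x = 0) :
    Integrable (fun w => (headPDF a n (headL n w))⁻¹ * g w) (gaussian a) := by
  obtain ⟨C, hC⟩ := exists_bound_inv_headPDF ha n R
  have hc : Continuous fun w : Ell2 => (headPDF a n (headL n w))⁻¹ :=
    ((continuous_headPDF a n).comp (headL n).continuous).inv₀ fun y => (headPDF_pos ha.pos n _).ne'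
  refine (hg.norm.const_mul C).mono' (hc.aestronglyMeasurable.mul hg.aestronglyMeasurable)
    (Eventually.of_forall fun w => ?_)
  by_cases hw : R ≤ ‖w‖
  · simp [hR w hw]
  · rw [norm_mul, Real.norm_eq_abs, abs_of_pos (inv_pos.2 (headPDF_pos ha.pos n _))]
    gcongr
    exact hC _ ((norm_headL_le n w).trans (not_le.1 hw).le)

/-- Smoothness of a convolution with a smooth compactly supported kernel. The values lie in a general
normed space so that the induction on the order can pass to the Fréchet derivative. -/
theorem contDiff_integral_sub {n : ℕ} {μ : Measure Ell2} {F : Ell2 → ℝ} (hF : Integrable F μ)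
    (N : ℕ) {E : Type} [NormedAddCommGroup E] [NormedSpace ℝ E] {ρ : (Fin n → ℝ) → E}
    (hρ : ContDiff ℝ ∞ ρ) (hc : HasCompactSupport ρ) :
    ContDiff ℝ N fun y => ∫ w, F w • ρ (y - headL n w) ∂μ := by
  have hmeas : ∀ {E : Type} [NormedAddCommGroup E] [NormedSpace ℝ E] {ρ : (Fin n → ℝ) → E},
      Continuous ρ → ∀ y, AEStronglyMeasurable (fun w => F w • ρ (y - headL n w)) μ := by
    intro E _ _ ρ hρ y
    exact hF.aestronglyMeasurable.smul
      (hρ.comp (continuous_const.sub (headL n).continuous)).aestronglyMeasurable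
  have hint : ∀ {E : Type} [NormedAddCommGroup E] [NormedSpace ℝ E] {ρ : (Fin n → ℝ) → E},
      Continuous ρ → HasCompactSupport ρ → ∀ y,
      Integrable (fun w => F w • ρ (y - headL n w)) μ := by
    intro E _ _ ρ hρ hc y
    obtain ⟨C, hC⟩ := hρ.bounded_above_of_compact_support hc
    refine (hF.norm.mul_const C).mono' (hmeas hρ y) (Eventually.of_forall fun w => ?_)
    rw [norm_smul]
    gcongr
    exact hC _
  have hder : ∀ {E : Type} [NormedAddCommGroup E] [NormedSpace ℝ E] {ρ : (Fin n → ℝ) → E},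
      ContDiff ℝ ∞ ρ → HasCompactSupport ρ → ∀ y,
      HasFDerivAt (fun y => ∫ w, F w • ρ (y - headL n w) ∂μ)
        (∫ w, F w • fderiv ℝ ρ (y - headL n w) ∂μ) y := by
    intro E _ _ ρ hρ hc y
    have hdc : Continuous (fderiv ℝ ρ) := hρ.continuous_fderiv (by simp)
    obtain ⟨C, hC⟩ := hdc.bounded_above_of_compact_support (hc.fderiv ℝ)
    refine hasFDerivAt_integral_of_dominated_of_fderiv_le (s := univ) univ_mem
      (F' := fun y w => F w • fderiv ℝ ρ (y - headL n w)) (bound := fun w => ‖F w‖ * C)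
      (Eventually.of_forall fun z => hmeas hρ.continuous z)
      (hint hρ.continuous hc y) (hmeas hdc y)
      (Eventually.of_forall fun w z _ => ?_) (hF.norm.mul_const C)
      (Eventually.of_forall fun w z _ => ?_)
    · rw [norm_smul]
      gcongr
      exact hC _
    · have h1 := (hρ.differentiable (by simp) (z - headL n w)).hasFDerivAt
      have h2 := h1.comp z ((hasFDerivAt_id z).sub_const (headL n w))
      rw [ContinuousLinearMap.comp_id] at h2
      exact h2.const_smul (F w)
  induction N generalizing E with
  | zero =>
    exact contDiff_zero.2 (continuous_iff_continuousAt.2 fun y => (hder hρ hc y).continuousAt)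
  | succ N ih =>
    refine (contDiff_succ_iff_hasFDerivAt (n := N)).2 ⟨_, ?_, hder hρ hc⟩
    exact ih (hρ.fderiv_right (m := ∞) (by simp)) (hc.fderiv ℝ)

theorem contDiff_mollify {a : ℕ → ℝ} {n : ℕ} {g : Ell2 → ℝ}
    (hF : Integrable (fun w => (headPDF a n (headL n w))⁻¹ * g w) (gaussian a))
    {ρ : (Fin n → ℝ) → ℝ} (hρ : ContDiff ℝ ∞ ρ) (hc : HasCompactSupport ρ) :
    ContDiff ℝ ∞ (mollify a n ρ g) := by
  refine contDiff_infty.2 fun N => ?_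
  have h := contDiff_integral_sub hF N hρ hc
  have he : mollify a n ρ g = fun y =>
      ∫ w, ((headPDF a n (headL n w))⁻¹ * g w) • ρ (y - headL n w) ∂(gaussian a) := by
    ext y
    simp only [mollify, smul_eq_mul]
    exact integral_congr_ae (Eventually.of_forall fun w => mul_comm _ _)
  rw [he]
  exact h

theorem hasCompactSupport_mollify {a : ℕ → ℝ} {n : ℕ} {g : Ell2 → ℝ} {R : ℝ}
    (hR : ∀ x, R ≤ ‖x‖ → g x = 0) {ρ : (Fin n → ℝ) → ℝ} (hc : HasCompactSupport ρ) :
    HasCompactSupport (mollify a n ρ g) := by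
  obtain ⟨S, hS⟩ := hc.isCompact.isBounded.exists_norm_le
  refine HasCompactSupport.intro (isCompact_closedBall (0 : Fin n → ℝ) (S + R)) fun y hy => ?_
  refine integral_eq_zero_of_ae (Eventually.of_forall fun w => ?_)
  by_contra hne
  have h1 : ‖y - headL n w‖ ≤ S := hS _ (subset_tsupport _ (left_ne_zero_of_mul hne))
  have h2 : ‖w‖ < R := by
    by_contra hcon
    exact right_ne_zero_of_mul (right_ne_zero_of_mul hne) (hR w (not_lt.1 hcon))
  have h3 := norm_headL_le n w
  have h4 := norm_le_norm_add_norm_sub' y (headL n w)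
  apply hy
  rw [mem_closedBall_zero_iff]
  linarith

/-! ### Derivatives of translation integrals -/

theorem BddSmooth.hasDerivAt_line {η : Ell2 → ℝ} (hη : BddSmooth η) (i : ℕ) (x : Ell2) (t : ℝ) :
    HasDerivAt (fun t : ℝ => η (x + t • e i)) (Ell2.partialD i η (x + t • e i)) t := by
  rw [partialD_eq_fderiv (hη.1.differentiable (by simp))]
  exact (hη.1.differentiable (by simp) _).hasFDerivAt.comp_hasDerivAt t (Ell2.hasDerivAt_line x i t)

theorem partialD_integral_sub {μ : Measure Ell2} {F : Ell2 → ℝ} (hF : Integrable F μ)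
    {η : Ell2 → ℝ} (hη : BddSmooth η) (i : ℕ) (x : Ell2) :
    partialD i (fun x => ∫ w, η (x - w) * F w ∂μ) x = ∫ w, partialD i η (x - w) * F w ∂μ := by
  have hmeas : ∀ {η : Ell2 → ℝ}, BddSmooth η → ∀ x,
      AEStronglyMeasurable (fun w => η (x - w) * F w) μ := fun hη x =>
    (hη.continuous.comp (continuous_const.sub continuous_id)).aestronglyMeasurable.mul
      hF.aestronglyMeasurable
  obtain ⟨C, hC⟩ := hη.exists_bound
  obtain ⟨D, hD⟩ := (hη.partialD i).exists_bound
  have h := hasDerivAt_integral_of_dominated_loc_of_deriv_le (μ := μ) (x₀ := (0 : ℝ)) (s := univ)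
    (F := fun t w => η (x + t • e i - w) * F w)
    (F' := fun t w => partialD i η (x + t • e i - w) * F w) (bound := fun w => D * ‖F w‖)
    univ_mem (Eventually.of_forall fun t => hmeas hη _)
    ?_ (hmeas (hη.partialD i) _) (Eventually.of_forall fun w t _ => ?_) (hF.norm.const_mul D)
    (Eventually.of_forall fun w t _ => ?_)
  · have := h.2.deriv
    simpa [partialD] using this
  · refine (hF.norm.const_mul C).mono' (hmeas hη _) (Eventually.of_forall fun w => ?_)
    rw [norm_mul]
    gcongr
    exact hC _
  · rw [norm_mul]
    gcongr
    exact hD _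
  · have h1 := (hη.hasDerivAt_line i (x - w) t).mul_const (F w)
    have h2 : ∀ t : ℝ, x - w + t • e i = x + t • e i - w := fun t => by abel
    simpa only [h2] using h1

theorem iterD_integral_sub {μ : Measure Ell2} {F : Ell2 → ℝ} (hF : Integrable F μ)
    {η : Ell2 → ℝ} (hη : BddSmooth η) (I : List ℕ) :
    iterD I (fun x => ∫ w, η (x - w) * F w ∂μ) = fun x => ∫ w, iterD I η (x - w) * F w ∂μ := by
  induction I with
  | nil => rfl
  | cons i I ih =>
    rw [iterD_cons, ih]
    ext x
    rw [partialD_integral_sub hF (hη.iterD I)]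
    rfl

theorem partialD_comm {η : Ell2 → ℝ} (hη : ContDiff ℝ ∞ η) (i j : ℕ) :
    partialD i (partialD j η) = partialD j (partialD i η) := by
  have hd := hη.differentiable (by simp)
  have h1 : ∀ j, partialD j η = fun x => fderiv ℝ η x (e j) := fun j =>
    funext fun x => partialD_eq_fderiv hd j x
  have hdd : Differentiable ℝ (fderiv ℝ η) :=
    (hη.fderiv_right (m := ∞) (by simp)).differentiable (by simp)
  have h2 : ∀ i j x, partialD i (partialD j η) x = fderiv ℝ (fderiv ℝ η) x (e i) (e j) := by
    intro i j x
    rw [partialD_eq_fderiv ((contDiff_partialD hη j).differentiable (by simp)), h1 j,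
      fderiv_clm_apply (hdd x) (differentiableAt_const _)]
    simp
  ext x
  rw [h2, h2]
  exact second_derivative_symmetric (fun y => (hd y).hasFDerivAt) (hdd x).hasFDerivAt _ _

theorem partialD_iterD_comm {η : Ell2 → ℝ} (hη : BddSmooth η) (i : ℕ) (I : List ℕ) :
    iterD I (partialD i η) = partialD i (iterD I η) := by
  induction I with
  | nil => rfl
  | cons j I ih => rw [iterD_cons, ih, partialD_comm (hη.iterD I).1]; rfl

theorem partialD_const_zero (i : ℕ) : partialD i (fun _ => 0) = fun _ => (0 : ℝ) := by
  ext x; simp [partialD]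

/-- A derivative in a coordinate on which the function does not depend vanishes, wherever it stands
in an iterated derivative. -/
theorem iterD_eq_zero_of_invariant {η : Ell2 → ℝ} {i : ℕ}
    (h : ∀ (x : Ell2) (t : ℝ), η (x + t • e i) = η x) {I : List ℕ} (hi : i ∈ I) :
    iterD I η = fun _ => 0 := by
  have hinv : ∀ (I : List ℕ) (x : Ell2) (t : ℝ), iterD I η (x + t • e i) = iterD I η x := by
    intro I
    induction I with
    | nil => exact h
    | cons j I ih =>
      intro x t
      simp only [iterD_cons, partialD]
      congr 1
      ext s
      rw [add_right_comm, ih]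
  induction I with
  | nil => simp at hi
  | cons j I ih =>
    rw [iterD_cons]
    rcases List.mem_cons.1 hi with rfl | hi
    · ext x
      have : (fun t : ℝ => iterD I η (x + t • e i)) = fun _ => iterD I η x :=
        funext fun t => hinv I x t
      rw [partialD, this, deriv_const]
    · rw [ih hi, partialD_const_zero]

theorem headL_add_smul_e_of_le {n i : ℕ} (hi : n ≤ i) (x : Ell2) (t : ℝ) :
    headL n (x + t • e i) = headL n x := by
  ext j
  rw [headL_apply, add_smul_e_apply, if_neg (by omega), add_zero, headL_apply]

/-! ### The adjoint derivatives of the mollifying kernel -/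

theorem contDiff_inv_headPDF {a : ℕ → ℝ} (ha : Weights a) (n : ℕ) :
    ContDiff ℝ ∞ fun y : Fin n → ℝ => (headPDF a n y)⁻¹ := by
  refine ContDiff.inv ?_ fun y => (headPDF_pos ha.pos n y).ne'
  unfold headPDF ProbabilityTheory.gaussianPDFReal
  fun_prop

/-- The inverse `γ⁻¹` of the Gaussian density satisfies `D_i γ⁻¹ = (x_i / a_i²) γ⁻¹`. -/
theorem hasDerivAt_inv_headPDF {a : ℕ → ℝ} (ha : Weights a) {n i : ℕ} (hi : i < n) (w : Ell2) :
    HasDerivAt (fun t : ℝ => (headPDF a n (headL n (w + t • e i)))⁻¹)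
      (w i / a i ^ 2 * (headPDF a n (headL n w))⁻¹) 0 := by
  classical
  set v : ℕ → NNReal := fun j => Real.toNNReal (a j ^ 2) with hv
  have hvc : ((v i : NNReal) : ℝ) = a i ^ 2 := Real.coe_toNNReal _ (sq_nonneg _)
  set c := ∏ j ∈ Finset.univ.erase (⟨i, hi⟩ : Fin n),
    ProbabilityTheory.gaussianPDFReal 0 (v j) (w j) with hcdef
  have hsplit : ∀ t : ℝ, headPDF a n (headL n (w + t • e i)) =
      ProbabilityTheory.gaussianPDFReal 0 (v i) (w i + t) * c := by
    intro t
    rw [headPDF, ← Finset.mul_prod_erase _ _ (Finset.mem_univ (⟨i, hi⟩ : Fin n))]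
    congr 1
    · simp [add_smul_e_apply, hv]
    · refine Finset.prod_congr rfl fun j hj => ?_
      have hne : (j : ℕ) ≠ i := fun h => (Finset.mem_erase.1 hj).1 (Fin.ext h)
      simp [add_smul_e_apply, hne, hv]
  have hcpos : 0 < c := Finset.prod_pos fun j _ =>
    ProbabilityTheory.gaussianPDFReal_pos _ _ _ (toNNReal_sq_ne_zero ha.pos j)
  have hc0 := hcpos.ne'
  have hp0 : ProbabilityTheory.gaussianPDFReal 0 (v i) (w i) ≠ 0 :=
    (ProbabilityTheory.gaussianPDFReal_pos _ _ _ (toNNReal_sq_ne_zero ha.pos i)).ne'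
  have h0 : headPDF a n (headL n w) = ProbabilityTheory.gaussianPDFReal 0 (v i) (w i) * c := by
    simpa using hsplit 0
  rw [h0]
  simp only [hsplit]
  have h1 : HasDerivAt (fun t : ℝ => ProbabilityTheory.gaussianPDFReal 0 (v i) (w i + t))
      (-(w i / v i) * ProbabilityTheory.gaussianPDFReal 0 (v i) (w i)) 0 := by
    have := hasDerivAt_gaussianPDFReal (toNNReal_sq_ne_zero ha.pos i) (w i + 0)
    have h2 := this.comp_const_add (w i) 0
    simpa only [add_zero] using h2
  have h2 := (h1.mul_const c).inv (by simpa using mul_ne_zero hp0 hc0)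
  refine h2.congr_deriv ?_
  rw [hvc]
  simp only [add_zero]
  have := (ha.pos i).ne'
  field_simp

/-- The Gaussian adjoint of a derivative acts on the mollifying kernel as the plain derivative on
the mollifier. -/
theorem adjD_kernel {a : ℕ → ℝ} (ha : Weights a) {n i : ℕ} (hi : i < n) {η : Ell2 → ℝ}
    (hη : BddSmooth η) (x : Ell2) :
    adjD a i (fun w => η (x - w) * (headPDF a n (headL n w))⁻¹) =
      fun w => partialD i η (x - w) * (headPDF a n (headL n w))⁻¹ := by
  ext w
  have h1 : HasDerivAt (fun t : ℝ => η (x - (w + t • e i))) (-(partialD i η (x - w))) 0 := by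
    have h := hη.hasDerivAt_line i (x - w) (-0)
    have h2 := h.comp (0 : ℝ) (hasDerivAt_neg (0 : ℝ))
    have h3 : ∀ t : ℝ, x - w + (-t) • e i = x - (w + t • e i) := fun t => by
      rw [neg_smul]; abel
    simp only [Function.comp_def, h3] at h2
    refine h2.congr_deriv ?_
    simp
  have h2 := h1.mul (hasDerivAt_inv_headPDF ha hi w)
  have h3 : partialD i (fun w => η (x - w) * (headPDF a n (headL n w))⁻¹) w = _ := h2.deriv
  rw [adjD, h3]
  simp only [zero_smul, add_zero]
  ring

/-- The order of differentiation is reversed on the two sides, which does not matter for smooth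
mollifiers. -/
theorem iterAdjD_kernel {a : ℕ → ℝ} (ha : Weights a) {n : ℕ} {η : Ell2 → ℝ}
    (hη : BddSmooth η) (x : Ell2) {I : List ℕ} (hI : ∀ i ∈ I, i < n) :
    iterAdjD a I (fun w => η (x - w) * (headPDF a n (headL n w))⁻¹) =
      fun w => iterD I η (x - w) * (headPDF a n (headL n w))⁻¹ := by
  induction I generalizing η with
  | nil => rfl
  | cons i I ih =>
    change iterAdjD a I (adjD a i _) = _
    rw [adjD_kernel ha (hI i (by simp)) hη, ih (hη.partialD i) fun j hj => hI j (by simp [hj]),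
      partialD_iterD_comm hη]
    rfl

/-! ### Derivatives of the mollification -/

theorem bddSmooth_kernel {a : ℕ → ℝ} (ha : Weights a) {n : ℕ} {ρ : (Fin n → ℝ) → ℝ}
    (hρ : ContDiff ℝ ∞ ρ) (hc : HasCompactSupport ρ) (x : Ell2) :
    BddSmooth fun w => ρ (headL n (x - w)) * (headPDF a n (headL n w))⁻¹ := by
  have h1 : ContDiff ℝ ∞ fun z : Fin n → ℝ => ρ (headL n x - z) * (headPDF a n z)⁻¹ :=
    (hρ.comp (contDiff_const.sub contDiff_id)).mul (contDiff_inv_headPDF ha n)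
  have h2 : HasCompactSupport fun z : Fin n → ℝ => ρ (headL n x - z) * (headPDF a n z)⁻¹ := by
    refine HasCompactSupport.mul_right ?_
    exact hc.comp_homeomorph (Homeomorph.subLeft (headL n x))
  have := bddSmooth_comp_headL h1 h2
  simpa only [map_sub] using this

/-- On the half-space, the weak derivatives of `f` in the mollified coordinates turn into
mollifications of the weak derivatives: the kernel, cut off to a bounded set, is a test function on
`U`, since the mollifier is supported in `{z | z 0 ≤ -δ}`. -/
theorem integral_kernel_eq {a : ℕ → ℝ} (ha : Weights a) {p : ℝ} (hp : 1 ≤ p) (hU : IsOpen U)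
    {f : Ell2 → ℝ} (hf : MemLp f (ENNReal.ofReal p) ((gaussian a).restrict U))
    {c : Ell2} {r R : ℝ} (hr : 0 < r) (hrR : r < R) (hb : Metric.ball c R ∩ halfSpace ⊆ U)
    (hs : lpSupport a p U f ⊆ Metric.ball c r) {n : ℕ} (hn : 0 < n) {ρ : (Fin n → ℝ) → ℝ}
    (hρ : ContDiff ℝ ∞ ρ) (hc : HasCompactSupport ρ) {δ : ℝ} (hδ : 0 < δ)
    (hρδ : ∀ z, ρ z ≠ 0 → z ⟨0, hn⟩ ≤ -δ) {k : ℕ} {i : Fin k → ℕ} (hi : ∀ j, i j < n)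
    {g : Ell2 → ℝ} (hg : HasWeakDeriv a p U i f g) {x : Ell2} (hx : x ∈ halfSpace) :
    ∫ w in U, iterD (List.ofFn i) (fun w => ρ (headL n w)) (x - w) *
        ((headPDF a n (headL n w))⁻¹ * f w) ∂(gaussian a) =
      ∫ w in U, ρ (headL n x - headL n w) * ((headPDF a n (headL n w))⁻¹ * g w) ∂(gaussian a) := by
  obtain ⟨hf0, hg0⟩ := ae_eq_zero_off_ball ha hp hU hf hs
  obtain ⟨η, hη, hη1, hη0, -⟩ := exists_cutoff c (r := r) (R := (r + R) / 2) hr (by linarith)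
  have hK := bddSmooth_kernel ha hρ hc x
  have hηball : ∀ w, η w ≠ 0 → w ∈ Metric.ball c ((r + R) / 2) := fun w hw => by
    rw [mem_ball_iff_norm]
    by_contra hcon
    exact hw (hη0 w (not_lt.1 hcon))
  have hincl : UniformlyIncluded
      {w | η w * (ρ (headL n (x - w)) * (headPDF a n (headL n w))⁻¹) ≠ 0} halfSpace := by
    have hR : 0 < R := by linarith
    refine ⟨δ, hδ, ‖c‖ + R, by positivity, ?_, ?_⟩
    · refine iUnion₂_subset fun w hw z hz => ?_
      have h1 := hρδ _ (left_ne_zero_of_mul (right_ne_zero_of_mul hw))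
      have h2 : (headL n (x - w)) ⟨0, hn⟩ = x 0 - w 0 := rfl
      rw [h2] at h1
      have h3 : 0 < x 0 := hx
      rw [mem_ball_iff_norm] at hz
      have h4 : |z 0 - w 0| ≤ ‖z - w‖ := abs_apply_le_norm (z - w) 0
      have h5 := neg_abs_le (z 0 - w 0)
      change 0 < z 0
      linarith
    · intro w hw
      have h1 := hηball w (left_ne_zero_of_mul hw)
      rw [mem_ball_iff_norm] at h1
      rw [mem_ball_zero_iff]
      have := norm_sub_norm_le w c
      linarith
  have htest : IsTest a U fun w =>
      η w * (ρ (headL n (x - w)) * (headPDF a n (headL n w))⁻¹) := by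
    refine isTest_of_bddSmooth ha (hη.mul hK) ?_
    refine uniformlyIncluded_of_ball (r := (r + R) / 2) (R := R)
      (hincl.mono fun w hw => hw.2) (by linarith) hb fun w hw => ?_
    exact hηball w (left_ne_zero_of_mul hw.2)
  have key := hg.integral_cutoff hf0 (hg0 hg) hη1 htest
  rw [iterAdjD_kernel ha (bddSmooth_comp_headL hρ hc) x
    (by simpa [List.mem_ofFn] using hi)] at key
  calc _ = ∫ w in U, f w * (iterD (List.ofFn i) (fun w => ρ (headL n w)) (x - w) *
        (headPDF a n (headL n w))⁻¹) ∂(gaussian a) :=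
        integral_congr_ae (Eventually.of_forall fun w => by simp only; ring)
    _ = _ := key.symm
    _ = _ := integral_congr_ae (Eventually.of_forall fun w => by simp only [map_sub]; ring)

theorem integral_mul_indicator_congr {a : ℕ → ℝ} {g g₀ : Ell2 → ℝ} (hU : IsOpen U)
    (hg : g₀ =ᵐ[gaussian a] U.indicator g) (K L : Ell2 → ℝ) :
    ∫ w, K w * (L w * g₀ w) ∂(gaussian a) = ∫ w in U, K w * (L w * g w) ∂(gaussian a) := by
  rw [← integral_indicator hU.measurableSet]
  refine integral_congr_ae ?_
  filter_upwards [hg] with w hw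
  rw [hw]
  by_cases hwU : w ∈ U
  · simp [hwU]
  · simp [hwU]

/-- The partial derivatives on the half-space of the mollified function. -/
theorem iterD_mollify {a : ℕ → ℝ} (ha : Weights a) {p : ℝ} (hp : 1 ≤ p) (hU : IsOpen U)
    {f : Ell2 → ℝ} (hf : MemLp f (ENNReal.ofReal p) ((gaussian a).restrict U))
    {c : Ell2} {r R : ℝ} (hr : 0 < r) (hrR : r < R) (hb : Metric.ball c R ∩ halfSpace ⊆ U)
    (hs : lpSupport a p U f ⊆ Metric.ball c r) {n : ℕ} (hn : 0 < n) {ρ : (Fin n → ℝ) → ℝ}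
    (hρ : ContDiff ℝ ∞ ρ) (hc : HasCompactSupport ρ) {δ : ℝ} (hδ : 0 < δ)
    (hρδ : ∀ z, ρ z ≠ 0 → z ⟨0, hn⟩ ≤ -δ) {k : ℕ} (i : Fin k → ℕ)
    {g : Ell2 → ℝ} (hg : HasWeakDeriv a p U i f g) {f₀ g₀ : Ell2 → ℝ}
    (hf₀ : f₀ =ᵐ[gaussian a] U.indicator f) (hg₀ : g₀ =ᵐ[gaussian a] U.indicator g)
    (hF : Integrable (fun w => (headPDF a n (headL n w))⁻¹ * f₀ w) (gaussian a))
    {x : Ell2} (hx : x ∈ halfSpace) :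
    iterD (List.ofFn i) (fun x => mollify a n ρ f₀ (headL n x)) x =
      if ∀ j, i j < n then mollify a n ρ g₀ (headL n x) else 0 := by
  have hR := bddSmooth_comp_headL hρ hc
  have h1 := iterD_integral_sub hF hR (List.ofFn i)
  simp only [map_sub] at h1
  change iterD (List.ofFn i) (fun x => ∫ w, ρ (headL n x - headL n w) *
    ((headPDF a n (headL n w))⁻¹ * f₀ w) ∂(gaussian a)) x = _
  rw [h1]
  beta_reduce
  split_ifs with hi
  · rw [mollify, integral_mul_indicator_congr hU hf₀, integral_mul_indicator_congr hU hg₀]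
    exact integral_kernel_eq ha hp hU hf hr hrR hb hs hn hρ hc hδ hρδ hi hg hx
  · push Not at hi
    obtain ⟨j, hj⟩ := hi
    rw [iterD_eq_zero_of_invariant (i := i j)
      (fun y t => by rw [headL_add_smul_e_of_le hj]) (by simp [List.mem_ofFn])]
    simp

/-! ### Convergence of the mollification in the mean of order `p` -/

theorem ofReal_abs_rpow {p : ℝ} (hp : 1 ≤ p) (s : ℝ) :
    ENNReal.ofReal (|s| ^ p) = ‖s‖ₑ ^ p := by
  rw [Real.enorm_eq_ofReal_abs, ENNReal.ofReal_rpow_of_nonneg (abs_nonneg _) (by linarith)]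

/-- Jensen's inequality for `s ↦ |s| ^ p`. -/
theorem enorm_integral_rpow_le {α : Type*} [MeasurableSpace α] {ν : Measure α}
    [IsProbabilityMeasure ν] {p : ℝ} (hp : 1 ≤ p) {q : α → ℝ} (hq : AEStronglyMeasurable q ν) :
    ‖∫ x, q x ∂ν‖ₑ ^ p ≤ ∫⁻ x, ‖q x‖ₑ ^ p ∂ν := by
  have hp0 : 0 < p := by linarith
  have h1 := eLpNorm_le_eLpNorm_of_exponent_le (one_le_ofReal hp) hq
  rw [eLpNorm_one_eq_lintegral_enorm, eLpNorm_eq_lintegral_rpow_enorm_toReal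
    (by simpa using hp0) ENNReal.ofReal_ne_top, ENNReal.toReal_ofReal hp0.le] at h1
  calc _ ≤ (∫⁻ x, ‖q x‖ₑ ∂ν) ^ p := by gcongr; exact enorm_integral_le_lintegral_enorm q
    _ ≤ ((∫⁻ x, ‖q x‖ₑ ^ p ∂ν) ^ (1 / p)) ^ p := by gcongr
    _ = _ := by rw [← ENNReal.rpow_mul, one_div_mul_cancel hp0.ne', ENNReal.rpow_one]

theorem enorm_sub_rpow_le {p : ℝ} (hp : 1 ≤ p) (s t u : ℝ) :
    ‖s - u‖ₑ ^ p ≤ 2 ^ (p - 1) * (‖s - t‖ₑ ^ p + ‖t - u‖ₑ ^ p) := by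
  have h : ‖s - u‖ₑ ≤ ‖s - t‖ₑ + ‖t - u‖ₑ := by
    have := enorm_add_le (s - t) (t - u)
    rwa [sub_add_sub_cancel] at this
  exact (ENNReal.rpow_le_rpow h (by linarith)).trans
    (ENNReal.rpow_add_le_mul_rpow_add_rpow _ _ hp)

/-- The mean of order `p` of the difference between `g` and its translate along the first `n`
coordinates. -/
def shiftError (a : ℕ → ℝ) (p : ℝ) (n : ℕ) (g : Ell2 → ℝ) (z : Fin n → ℝ) : ℝ≥0∞ :=
  ∫⁻ x, ‖g (x - inclL n z) - g x‖ₑ ^ p ∂(gaussian a)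

/-- The mean of order `p` of the change in `g` when the coordinates beyond the first `n` are
resampled. -/
def resampleError (a : ℕ → ℝ) (p : ℝ) (n : ℕ) (g : Ell2 → ℝ) : ℝ≥0∞ :=
  ∫⁻ q : Ell2 × Ell2, ‖g (setHead n (headL n q.1) q.2) - g q.1‖ₑ ^ p
    ∂((gaussian a).prod (gaussian a))

/-- The mollification error is controlled by the error of resampling the tail and by the error of
small shifts in the first `n` coordinates. -/
theorem lintegral_mollify_sub_le {a : ℕ → ℝ} (ha : Weights a) {p : ℝ} (hp : 1 ≤ p) {n : ℕ}
    {g : Ell2 → ℝ} (hgm : Measurable g) (hgi : Integrable g (gaussian a)) {ρ : (Fin n → ℝ) → ℝ}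
    (hρ : ContDiff ℝ ∞ ρ) (hc : HasCompactSupport ρ) (hρ0 : ∀ z, 0 ≤ ρ z)
    (hρ1 : ∫⁻ z, ENNReal.ofReal (ρ z) = 1) {δ : ℝ≥0∞}
    (hδ : ∀ z, ρ z ≠ 0 → shiftError a p n g z ≤ δ) :
    ∫⁻ x, ‖mollify a n ρ g (headL n x) - g x‖ₑ ^ p ∂(gaussian a) ≤
      2 ^ (p - 1) * (δ + resampleError a p n g) := by
  have := ha.isProbabilityMeasure
  set P := gaussian a with hP
  have hp0 : 0 ≤ p := by linarith
  have hρm : Measurable ρ := hρ.continuous.measurable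
  have hSc : Continuous fun q : Ell2 × Ell2 => setHead n (headL n q.1) q.2 :=
    (continuous_setHead n).comp (((headL n).continuous.comp continuous_fst).prodMk continuous_snd)
  have hSm := hSc.measurable
  have hιm : Measurable (inclL n) := (inclL n).continuous.measurable
  -- The kernel, its density with respect to `P` and the pointwise estimate.
  have hpt : ∀ x, ‖mollify a n ρ g (headL n x) - g x‖ₑ ^ p ≤
      ∫⁻ w, (∫⁻ z, ENNReal.ofReal (ρ z) *
        ‖g (setHead n (headL n x) w - inclL n z) - g x‖ₑ ^ p) ∂P := by
    intro x
    set κ : Ell2 → ℝ := fun w => ρ (headL n x - headL n w) * (headPDF a n (headL n w))⁻¹ with hκ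
    have hκ0 : ∀ w, 0 ≤ κ w := fun w =>
      mul_nonneg (hρ0 _) (inv_nonneg.2 (headPDF_pos ha.pos n _).le)
    have hκs : BddSmooth κ := by
      have := bddSmooth_kernel ha hρ hc x
      simpa only [map_sub] using this
    have hκm : Measurable κ := hκs.continuous.measurable
    -- Disintegration turns integrals against the kernel into Lebesgue integrals against `ρ`.
    have htrans : ∀ {G : Ell2 → ℝ≥0∞}, Measurable G →
        ∫⁻ w, ENNReal.ofReal (κ w) * G w ∂P =
          ∫⁻ w, (∫⁻ z, ENNReal.ofReal (ρ z) * G (setHead n (headL n x) w - inclL n z)) ∂P := by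
      intro G hG
      rw [hP, lintegral_gaussian_eq ha.pos ha.summable_sq n
        (G := fun w => ENNReal.ofReal (κ w) * G w) (hκm.ennreal_ofReal.mul hG)]
      refine lintegral_congr fun w => ?_
      have h1 : ∀ z : Fin n → ℝ, ENNReal.ofReal (headPDF a n z) *
          (ENNReal.ofReal (κ (setHead n z w)) * G (setHead n z w)) =
          ENNReal.ofReal (ρ (headL n x - z)) * G (setHead n z w) := by
        intro z
        have hpos := headPDF_pos ha.pos n z
        rw [← mul_assoc, ← ENNReal.ofReal_mul hpos.le]
        simp only [hκ, headL_setHead]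
        congr 2
        field_simp
      simp only [h1]
      rw [← lintegral_sub_left_eq_self _ (headL n x)]
      refine lintegral_congr fun z => ?_
      rw [sub_sub_cancel, setHead_sub]
    set ν := P.withDensity fun w => ENNReal.ofReal (κ w) with hν
    have hprob : IsProbabilityMeasure ν := by
      constructor
      rw [hν, withDensity_apply _ MeasurableSet.univ, Measure.restrict_univ]
      have := htrans (G := fun _ => 1) measurable_const
      simp only [mul_one] at this
      rw [this, hρ1]
      simp
    have hνi : Integrable g ν := by
      rw [hν, integrable_withDensity_iff_integrable_smul₀' hκm.ennreal_ofReal.aemeasurable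
        (Eventually.of_forall fun w => ENNReal.ofReal_lt_top)]
      obtain ⟨C, hC⟩ := hκs.exists_bound
      refine (hgi.bdd_mul (c := C) hκm.aestronglyMeasurable (Eventually.of_forall hC)).congr
        (Eventually.of_forall fun w => ?_)
      simp only [ENNReal.toReal_ofReal (hκ0 w), smul_eq_mul]
    have hm : mollify a n ρ g (headL n x) = ∫ w, g w ∂ν := by
      rw [hν, integral_withDensity_eq_integral_toReal_smul₀ hκm.ennreal_ofReal.aemeasurable
        (Eventually.of_forall fun w => ENNReal.ofReal_lt_top), mollify]
      refine integral_congr_ae (Eventually.of_forall fun w => ?_)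
      beta_reduce
      rw [ENNReal.toReal_ofReal (hκ0 w), smul_eq_mul, mul_assoc]
    have hsub : mollify a n ρ g (headL n x) - g x = ∫ w, (g w - g x) ∂ν := by
      rw [integral_sub hνi (integrable_const _), hm]
      simp
    rw [hsub]
    refine (enorm_integral_rpow_le hp (q := fun w => g w - g x)
      (hgm.sub measurable_const).aestronglyMeasurable).trans ?_
    have hGm : Measurable fun w => ‖g w - g x‖ₑ ^ p := by fun_prop
    rw [hν, lintegral_withDensity_eq_lintegral_mul _ hκm.ennreal_ofReal hGm]
    exact (htrans hGm).le
  -- Joint measurability of the integrand.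
  have hFm : Measurable fun q : (Fin n → ℝ) × (Ell2 × Ell2) => ENNReal.ofReal (ρ q.1) *
      ‖g (setHead n (headL n q.2.1) q.2.2 - inclL n q.1) - g q.2.1‖ₑ ^ p := by
    have h1 : Measurable fun q : (Fin n → ℝ) × (Ell2 × Ell2) =>
        setHead n (headL n q.2.1) q.2.2 - inclL n q.1 :=
      (hSm.comp measurable_snd).sub (hιm.comp measurable_fst)
    have h2 := hgm.comp h1
    have h3 : Measurable fun q : (Fin n → ℝ) × (Ell2 × Ell2) => g q.2.1 :=
      hgm.comp (measurable_fst.comp measurable_snd)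
    exact ((hρm.comp measurable_fst).ennreal_ofReal).mul (((h2.sub h3).enorm).pow_const p)
  have hswap : ∫⁻ x, ∫⁻ w, (∫⁻ z, ENNReal.ofReal (ρ z) *
        ‖g (setHead n (headL n x) w - inclL n z) - g x‖ₑ ^ p) ∂P ∂P =
      ∫⁻ z, ENNReal.ofReal (ρ z) * ∫⁻ q : Ell2 × Ell2,
        ‖g (setHead n (headL n q.1) q.2 - inclL n z) - g q.1‖ₑ ^ p ∂(P.prod P) := by
    have h1 : Measurable fun q : Ell2 × Ell2 => ∫⁻ z, ENNReal.ofReal (ρ z) *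
        ‖g (setHead n (headL n q.1) q.2 - inclL n z) - g q.1‖ₑ ^ p :=
      hFm.lintegral_prod_left'
    rw [← lintegral_prod (fun q : Ell2 × Ell2 => ∫⁻ z, ENNReal.ofReal (ρ z) *
      ‖g (setHead n (headL n q.1) q.2 - inclL n z) - g q.1‖ₑ ^ p) h1.aemeasurable]
    rw [lintegral_lintegral_swap (by exact (hFm.comp measurable_swap).aemeasurable)]
    refine lintegral_congr fun z => ?_
    rw [lintegral_const_mul]
    have h1 : Measurable fun q : Ell2 × Ell2 => setHead n (headL n q.1) q.2 - inclL n z :=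
      hSm.sub measurable_const
    exact (((hgm.comp h1).sub (hgm.comp measurable_fst)).enorm).pow_const p
  have hinner : ∀ z, ρ z ≠ 0 → ∫⁻ q : Ell2 × Ell2,
        ‖g (setHead n (headL n q.1) q.2 - inclL n z) - g q.1‖ₑ ^ p ∂(P.prod P) ≤
      2 ^ (p - 1) * (δ + resampleError a p n g) := by
    intro z hz
    have hG : Measurable fun x => ‖g (x - inclL n z) - g x‖ₑ ^ p := by fun_prop
    have h1 : ∫⁻ q : Ell2 × Ell2, ‖g (setHead n (headL n q.1) q.2 - inclL n z) -
        g (setHead n (headL n q.1) q.2)‖ₑ ^ p ∂(P.prod P) = shiftError a p n g z :=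
      (measurePreserving_setHead a ha.summable_sq n).lintegral_comp hG
    calc _ ≤ ∫⁻ q : Ell2 × Ell2, 2 ^ (p - 1) * (‖g (setHead n (headL n q.1) q.2 - inclL n z) -
            g (setHead n (headL n q.1) q.2)‖ₑ ^ p +
            ‖g (setHead n (headL n q.1) q.2) - g q.1‖ₑ ^ p) ∂(P.prod P) :=
          lintegral_mono fun q => enorm_sub_rpow_le hp _ _ _
      _ = 2 ^ (p - 1) * (shiftError a p n g z + resampleError a p n g) := by
          rw [lintegral_const_mul' _ _ (ENNReal.rpow_ne_top_of_nonneg (by linarith) (by simp)),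
            lintegral_add_left (by exact hG.comp hSm), h1, resampleError]
      _ ≤ _ := by gcongr; exact hδ z hz
  calc _ ≤ ∫⁻ x, ∫⁻ w, (∫⁻ z, ENNReal.ofReal (ρ z) *
        ‖g (setHead n (headL n x) w - inclL n z) - g x‖ₑ ^ p) ∂P ∂P := lintegral_mono hpt
    _ = _ := hswap
    _ ≤ ∫⁻ z, ENNReal.ofReal (ρ z) * (2 ^ (p - 1) * (δ + resampleError a p n g)) := by
        refine lintegral_mono fun z => ?_
        by_cases hz : ρ z = 0
        · simp [hz]
        · gcongr
          exact hinner z hz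
    _ = _ := by rw [lintegral_mul_const _ hρm.ennreal_ofReal, hρ1, one_mul]

/-! ### The resampling error and the shift error tend to zero -/

theorem two_rpow_ne_top {p : ℝ} (hp : 1 ≤ p) : (2 : ℝ≥0∞) ^ (p - 1) ≠ ⊤ :=
  ENNReal.rpow_ne_top_of_nonneg (by linarith) (by simp)

theorem lintegral_enorm_rpow_lt_top {p : ℝ} (hp : 1 ≤ p) {μ : Measure Ell2} {g : Ell2 → ℝ}
    (hg : MemLp g (ENNReal.ofReal p) μ) : ∫⁻ x, ‖g x‖ₑ ^ p ∂μ < ⊤ := by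
  have hp0 : 0 < p := by linarith
  have h := lintegral_rpow_enorm_lt_top_of_eLpNorm_lt_top (by simpa using hp0)
    ENNReal.ofReal_ne_top hg.2
  rwa [ENNReal.toReal_ofReal hp0.le] at h

/-- Density of the bounded continuous functions in the mean of order `p`. -/
theorem exists_boundedContinuous_lintegral_le {p : ℝ} (hp : 1 ≤ p) {μ : Measure Ell2}
    [IsFiniteMeasure μ] {g : Ell2 → ℝ} (hg : MemLp g (ENNReal.ofReal p) μ) {ε : ℝ≥0∞}
    (hε : ε ≠ 0) :
    ∃ h : BoundedContinuousFunction Ell2 ℝ, ∫⁻ x, ‖g x - h x‖ₑ ^ p ∂μ ≤ ε := by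
  have hp0 : 0 < p := by linarith
  have hε' : ε ^ (1 / p) ≠ 0 := by
    rw [ne_eq, ENNReal.rpow_eq_zero_iff]
    rintro (⟨h, -⟩ | ⟨-, h⟩)
    · exact hε h
    · exact absurd h (not_lt.2 (by positivity))
  obtain ⟨h, hh, -⟩ := hg.exists_boundedContinuous_eLpNorm_sub_le ENNReal.ofReal_ne_top hε'
  refine ⟨h, ?_⟩
  rw [eLpNorm_eq_lintegral_rpow_enorm_toReal (by simpa using hp0) ENNReal.ofReal_ne_top,
    ENNReal.toReal_ofReal hp0.le] at hh
  have h2 := ENNReal.rpow_le_rpow hh hp0.le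
  rw [← ENNReal.rpow_mul, ← ENNReal.rpow_mul, one_div_mul_cancel hp0.ne', ENNReal.rpow_one,
    ENNReal.rpow_one] at h2
  exact h2

theorem enorm_sub_rpow_le' {p : ℝ} (hp : 1 ≤ p) (s t : ℝ) :
    ‖s - t‖ₑ ^ p ≤ 2 ^ (p - 1) * (‖s‖ₑ ^ p + ‖t‖ₑ ^ p) := by
  have := enorm_sub_rpow_le hp s 0 t
  simpa using this

/-- Replacing `g` by `h` in a difference of values. -/
theorem enorm_sub_rpow_le_of_approx {p : ℝ} (hp : 1 ≤ p) (s t s' t' : ℝ) :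
    ‖s - t‖ₑ ^ p ≤ 2 ^ (p - 1) * (2 ^ (p - 1) * (‖s - s'‖ₑ ^ p + ‖t - t'‖ₑ ^ p) +
      ‖s' - t'‖ₑ ^ p) := by
  have h1 := enorm_sub_rpow_le hp (s - t) (s' - t') 0
  have h2 := enorm_sub_rpow_le' hp (s - s') (t - t')
  have h3 : s - t - (s' - t') = s - s' - (t - t') := by ring
  rw [sub_zero, sub_zero, h3] at h1
  exact h1.trans (by gcongr)

theorem tendsto_setHead (x w : Ell2) :
    Tendsto (fun n => setHead n (headL n x) w) atTop (𝓝 x) := by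
  have h := (lp.hasSum_single (p := 2) (by norm_num) (x - w)).tendsto_sum_nat
  have h2 := h.const_add w
  rw [add_sub_cancel] at h2
  refine h2.congr fun n => ?_
  rw [setHead, inclL_apply, Finset.sum_range]
  congr 1
  refine Finset.sum_congr rfl fun j _ => ?_
  rw [e, ← lp.single_smul]
  congr 1
  simp

theorem resampleError_le {a : ℕ → ℝ} (ha : Weights a) {p : ℝ} (hp : 1 ≤ p) (n : ℕ) {g : Ell2 → ℝ}
    (hgm : Measurable g) :
    resampleError a p n g ≤ 2 ^ (p - 1) * (2 * ∫⁻ x, ‖g x‖ₑ ^ p ∂(gaussian a)) := by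
  have := ha.isProbabilityMeasure
  have hG : Measurable fun x => ‖g x‖ₑ ^ p := by fun_prop
  have hS := measurePreserving_setHead a ha.summable_sq n
  calc resampleError a p n g ≤ ∫⁻ q : Ell2 × Ell2, 2 ^ (p - 1) *
        (‖g (setHead n (headL n q.1) q.2)‖ₑ ^ p + ‖g q.1‖ₑ ^ p)
          ∂((gaussian a).prod (gaussian a)) :=
        lintegral_mono fun q => enorm_sub_rpow_le' hp _ _
    _ = _ := by
        rw [lintegral_const_mul' _ _ (two_rpow_ne_top hp),
          lintegral_add_left (by exact hG.comp hS.measurable),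
          hS.lintegral_comp hG, measurePreserving_fst.lintegral_comp hG, two_mul]

/-- Resampling the tail coordinates moves a point by an amount that tends to zero. Bounded continuous
functions are treated by dominated convergence, and resampling preserves the measure, so that they
approximate general functions uniformly in `n`. -/
theorem tendsto_resampleError {a : ℕ → ℝ} (ha : Weights a) {p : ℝ} (hp : 1 ≤ p) {g : Ell2 → ℝ}
    (hgm : Measurable g) (hg : MemLp g (ENNReal.ofReal p) (gaussian a)) :
    Tendsto (fun n => resampleError a p n g) atTop (𝓝 0) := by
  have := ha.isProbabilityMeasure
  set c : ℝ≥0∞ := 2 ^ (p - 1) with hc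
  have hct : c ≠ ⊤ := two_rpow_ne_top hp
  have hc0 : c ≠ 0 := by
    rw [hc, ne_eq, ENNReal.rpow_eq_zero_iff]; simp
  -- Bounded continuous functions: dominated convergence.
  have hbc : ∀ h : BoundedContinuousFunction Ell2 ℝ,
      Tendsto (fun n => resampleError a p n h) atTop (𝓝 0) := by
    intro h
    have h0 : (0 : ℝ≥0∞) = ∫⁻ _ : Ell2 × Ell2, 0 ∂((gaussian a).prod (gaussian a)) := by simp
    rw [h0]
    refine tendsto_lintegral_of_dominated_convergence (fun _ => c * (‖h‖ₑ ^ p + ‖h‖ₑ ^ p))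
      (fun n => ?_) (fun n => Eventually.of_forall fun q => ?_) ?_
      (Eventually.of_forall fun q => ?_)
    · have h1 := h.continuous.measurable.comp
        (measurePreserving_setHead a ha.summable_sq n).measurable
      have h2 : Measurable fun q : Ell2 × Ell2 => h q.1 :=
        h.continuous.measurable.comp measurable_fst
      exact ((h1.sub h2).enorm).pow_const p
    · refine (enorm_sub_rpow_le' hp _ _).trans ?_
      have hle : ∀ x, ‖h x‖ₑ ≤ ‖h‖ₑ := fun x => by
        rw [← ofReal_norm, ← ofReal_norm]
        exact ENNReal.ofReal_le_ofReal (h.norm_coe_le_norm x)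
      have hp0 : 0 ≤ p := by linarith
      exact mul_le_mul_right (add_le_add (ENNReal.rpow_le_rpow (hle _) hp0)
        (ENNReal.rpow_le_rpow (hle _) hp0)) c
    · rw [lintegral_const, measure_univ, mul_one]
      have : ‖h‖ₑ ^ p ≠ ⊤ := ENNReal.rpow_ne_top_of_nonneg (by linarith) enorm_ne_top
      exact ENNReal.mul_ne_top hct (ENNReal.add_ne_top.2 ⟨this, this⟩)
    · have h1 := (h.continuous.tendsto q.1).comp (tendsto_setHead q.1 q.2)
      have h2 := ((h1.sub_const (h q.1)).enorm).ennrpow_const p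
      rw [sub_self, enorm_zero, ENNReal.zero_rpow_of_pos (by linarith)] at h2
      exact h2
  rw [ENNReal.tendsto_nhds_zero]
  intro ε hε
  -- Both error terms are made at most `ε / 2`.
  obtain ⟨h, hh⟩ := exists_boundedContinuous_lintegral_le hp hg (ε := ε / 2 / (c * (c * 2)))
    (ENNReal.div_ne_zero.2 ⟨(ENNReal.half_pos hε.ne').ne',
      ENNReal.mul_ne_top hct (ENNReal.mul_ne_top hct (by simp))⟩)
  have hev := ENNReal.tendsto_nhds_zero.1 (hbc h) (ε / 2 / c)
    (ENNReal.div_pos (ENNReal.half_pos hε.ne').ne' hct)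
  filter_upwards [hev] with n hn
  have hS := measurePreserving_setHead a ha.summable_sq n
  have hD : Measurable fun x => ‖g x - h x‖ₑ ^ p :=
    ((hgm.sub h.continuous.measurable).enorm).pow_const p
  calc resampleError a p n g
      ≤ ∫⁻ q : Ell2 × Ell2, c * (c * (‖g (setHead n (headL n q.1) q.2) -
          h (setHead n (headL n q.1) q.2)‖ₑ ^ p + ‖g q.1 - h q.1‖ₑ ^ p) +
          ‖h (setHead n (headL n q.1) q.2) - h q.1‖ₑ ^ p)
          ∂((gaussian a).prod (gaussian a)) :=
        lintegral_mono fun q => enorm_sub_rpow_le_of_approx hp _ _ _ _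
    _ = c * (c * (∫⁻ x, ‖g x - h x‖ₑ ^ p ∂(gaussian a) +
          ∫⁻ x, ‖g x - h x‖ₑ ^ p ∂(gaussian a)) + resampleError a p n h) := by
        have hD1 := hD.comp hS.measurable
        have hD2 : Measurable fun q : Ell2 × Ell2 => ‖g q.1 - h q.1‖ₑ ^ p := hD.comp measurable_fst
        rw [lintegral_const_mul' _ _ hct,
          lintegral_add_left (by exact (hD1.add hD2).const_mul c),
          lintegral_const_mul' _ _ hct, lintegral_add_left (by exact hD1),
          hS.lintegral_comp hD, measurePreserving_fst.lintegral_comp hD, resampleError]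
    _ ≤ c * (c * (ε / 2 / (c * (c * 2)) + ε / 2 / (c * (c * 2))) + ε / 2 / c) := by gcongr
    _ = c * (c * 2) * (ε / 2 / (c * (c * 2))) + c * (ε / 2 / c) := by ring
    _ = ε := by
        rw [ENNReal.mul_div_cancel hc0 hct, ENNReal.mul_div_cancel
          (mul_ne_zero hc0 (mul_ne_zero hc0 (by simp)))
          (ENNReal.mul_ne_top hct (ENNReal.mul_ne_top hct (by simp))), ENNReal.add_halves]

/-- On functions that vanish off a fixed ball, small shifts along the first `n` coordinates are
bounded in the mean: the ratio of the shifted density to the density is bounded there. -/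
theorem exists_bound_lintegral_shift {a : ℕ → ℝ} (ha : Weights a) (n : ℕ) (R : ℝ) :
    ∃ C : ℝ≥0∞, C ≠ ⊤ ∧ ∀ G : Ell2 → ℝ≥0∞, Measurable G → (∀ x, R ≤ ‖x‖ → G x = 0) →
      ∀ z : Fin n → ℝ, ‖z‖ ≤ 1 →
        ∫⁻ x, G (x - inclL n z) ∂(gaussian a) ≤ C * ∫⁻ x, G x ∂(gaussian a) := by
  obtain ⟨A, hA⟩ := exists_bound_inv_headPDF ha n R
  obtain ⟨B, hB⟩ := (isCompact_closedBall (0 : Fin n → ℝ) (R + 1)).exists_bound_of_continuousOn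
    (continuous_headPDF a n).continuousOn
  refine ⟨ENNReal.ofReal (B * A), ENNReal.ofReal_ne_top, fun G hG hR z hz => ?_⟩
  have hm : Measurable fun x => G (x - inclL n z) := hG.comp (measurable_id.sub measurable_const)
  rw [lintegral_gaussian_eq ha.pos ha.summable_sq n hm,
    lintegral_gaussian_eq ha.pos ha.summable_sq n hG,
    ← lintegral_const_mul' _ _ ENNReal.ofReal_ne_top]
  refine lintegral_mono fun w => ?_
  beta_reduce
  rw [← lintegral_const_mul' _ _ ENNReal.ofReal_ne_top]
  rw [← lintegral_add_right_eq_self _ z]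
  refine lintegral_mono fun y => ?_
  beta_reduce
  rw [← setHead_sub, add_sub_cancel_right, ← mul_assoc]
  by_cases hw : R ≤ ‖setHead n y w‖
  · simp [hR _ hw]
  gcongr
  have hy : ‖y‖ ≤ R := by
    have := norm_headL_le n (setHead n y w)
    rw [headL_setHead] at this
    exact this.trans (not_le.1 hw).le
  have h1 : headPDF a n (y + z) ≤ B := by
    refine (le_abs_self _).trans (hB _ ?_)
    rw [mem_closedBall_zero_iff]
    exact (norm_add_le y z).trans (add_le_add hy hz)
  have hpos := headPDF_pos ha.pos n y
  have h2 : 1 ≤ A * headPDF a n y := by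
    have := hA y hy
    rw [inv_le_iff_one_le_mul₀ hpos] at this
    exact this
  have hB0 : 0 ≤ B := (headPDF_pos ha.pos n (y + z)).le.trans h1
  have hBA : 0 ≤ B * A := mul_nonneg hB0 ((inv_nonneg.2 hpos.le).trans (hA y hy))
  rw [← ENNReal.ofReal_mul hBA]
  refine ENNReal.ofReal_le_ofReal (h1.trans ?_)
  rw [mul_assoc]
  exact le_mul_of_one_le_right hB0 h2

/-- Translation along the first `n` coordinates is continuous in the mean of order `p` at functions of
bounded support; the Gaussian measure is only quasi-invariant under it, whence
`exists_bound_lintegral_shift`. -/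
theorem tendsto_shiftError {a : ℕ → ℝ} (ha : Weights a) {p : ℝ} (hp : 1 ≤ p) (n : ℕ)
    {g : Ell2 → ℝ} (hgm : Measurable g) (hg : MemLp g (ENNReal.ofReal p) (gaussian a)) {R : ℝ}
    (hR0 : 0 < R) (hR : ∀ x, R ≤ ‖x‖ → g x = 0) :
    Tendsto (shiftError a p n g) (𝓝 0) (𝓝 0) := by
  have := ha.isProbabilityMeasure
  have hp0 : 0 < p := by linarith
  set c : ℝ≥0∞ := 2 ^ (p - 1) with hc
  have hct : c ≠ ⊤ := two_rpow_ne_top hp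
  have hc0 : c ≠ 0 := by
    rw [hc, ne_eq, ENNReal.rpow_eq_zero_iff]; simp
  obtain ⟨C, hCt, hC⟩ := exists_bound_lintegral_shift ha n (R + 1)
  obtain ⟨η, hη, hη1, hη0, hηle⟩ := exists_cutoff 0 hR0 (lt_add_one R)
  simp only [sub_zero] at hη1 hη0
  -- Bounded continuous functions: dominated convergence.
  have hbc : ∀ h : Ell2 → ℝ, Continuous h → (∃ B : ℝ, ∀ x, ‖h x‖ ≤ B) →
      Tendsto (shiftError a p n h) (𝓝 0) (𝓝 0) := by
    rintro h hcont ⟨B, hB⟩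
    have h0 : (0 : ℝ≥0∞) = ∫⁻ _, 0 ∂(gaussian a) := by simp
    rw [h0]
    refine tendsto_lintegral_filter_of_dominated_convergence
      (fun _ => c * (ENNReal.ofReal B ^ p + ENNReal.ofReal B ^ p))
      (Eventually.of_forall fun z => ?_)
      (Eventually.of_forall fun z => Eventually.of_forall fun x => ?_) ?_
      (Eventually.of_forall fun x => ?_)
    · have h1 : Continuous fun x => h (x - inclL n z) - h x :=
        (hcont.comp (continuous_id.sub continuous_const)).sub hcont
      exact h1.measurable.enorm.pow_const p
    · refine (enorm_sub_rpow_le' hp _ _).trans ?_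
      have hle : ∀ x, ‖h x‖ₑ ≤ ENNReal.ofReal B := fun x => by
        rw [← ofReal_norm]
        exact ENNReal.ofReal_le_ofReal (hB x)
      gcongr <;> exact hle _
    · rw [lintegral_const, measure_univ, mul_one]
      have : ENNReal.ofReal B ^ p ≠ ⊤ :=
        ENNReal.rpow_ne_top_of_nonneg hp0.le ENNReal.ofReal_ne_top
      exact ENNReal.mul_ne_top hct (ENNReal.add_ne_top.2 ⟨this, this⟩)
    · have h1 : Continuous fun z : Fin n → ℝ => ‖h (x - inclL n z) - h x‖ₑ :=
        ((hcont.comp (continuous_const.sub (inclL n).continuous)).sub continuous_const).enorm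
      have h2 := (h1.tendsto 0).ennrpow_const p
      rw [map_zero, sub_zero, sub_self, enorm_zero, ENNReal.zero_rpow_of_pos hp0] at h2
      exact h2
  rw [ENNReal.tendsto_nhds_zero]
  intro ε hε
  have hC1 : C + 1 ≠ ⊤ := ENNReal.add_ne_top.2 ⟨hCt, by simp⟩
  -- Both error terms are made at most `ε / 2`.
  obtain ⟨h₀, hh₀⟩ := exists_boundedContinuous_lintegral_le hp hg
    (ε := ε / 2 / (c * (c * (C + 1))))
    (ENNReal.div_ne_zero.2 ⟨(ENNReal.half_pos hε.ne').ne',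
      ENNReal.mul_ne_top hct (ENNReal.mul_ne_top hct hC1)⟩)
  set h : Ell2 → ℝ := fun x => η x * h₀ x with hh
  have hhc : Continuous h := hη.continuous.mul h₀.continuous
  have hDle : ∀ x, ‖g x - h x‖ₑ ≤ ‖g x - h₀ x‖ₑ := by
    intro x
    rcases le_total ‖x‖ R with hx | hx
    · rw [hh]; simp only [hη1 x hx, one_mul, le_refl]
    · rw [hR x hx, zero_sub, zero_sub, enorm_neg, enorm_neg, hh, ← ofReal_norm, ← ofReal_norm]
      refine ENNReal.ofReal_le_ofReal ?_
      rw [norm_mul]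
      exact mul_le_of_le_one_left (norm_nonneg _) (hηle x)
  have hDint : ∫⁻ x, ‖g x - h x‖ₑ ^ p ∂(gaussian a) ≤ ε / 2 / (c * (c * (C + 1))) := by
    refine (lintegral_mono fun x => ?_).trans hh₀
    beta_reduce
    gcongr
    exact hDle x
  have hD : Measurable fun x => ‖g x - h x‖ₑ ^ p :=
    ((hgm.sub hhc.measurable).enorm).pow_const p
  have hD0 : ∀ x, R + 1 ≤ ‖x‖ → ‖g x - h x‖ₑ ^ p = 0 := by
    intro x hx
    rw [hR x (by linarith), hh]
    simp [hη0 x hx, hp0]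
  have hev := ENNReal.tendsto_nhds_zero.1 (hbc h hhc ⟨‖h₀‖, fun x => by
    rw [hh, norm_mul]
    exact (mul_le_of_le_one_left (norm_nonneg _) (hηle x)).trans (h₀.norm_coe_le_norm x)⟩)
    (ε / 2 / c) (ENNReal.div_pos (ENNReal.half_pos hε.ne').ne' hct)
  filter_upwards [hev, Metric.closedBall_mem_nhds (0 : Fin n → ℝ) one_pos] with z hz hz1
  rw [mem_closedBall_zero_iff] at hz1
  have hm : Measurable fun x : Ell2 => x - inclL n z := measurable_id.sub measurable_const
  have hDm := hD.comp hm
  calc shiftError a p n g z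
      ≤ ∫⁻ x, c * (c * (‖g (x - inclL n z) - h (x - inclL n z)‖ₑ ^ p + ‖g x - h x‖ₑ ^ p) +
          ‖h (x - inclL n z) - h x‖ₑ ^ p) ∂(gaussian a) :=
        lintegral_mono fun x => enorm_sub_rpow_le_of_approx hp _ _ _ _
    _ = c * (c * (∫⁻ x, ‖g (x - inclL n z) - h (x - inclL n z)‖ₑ ^ p ∂(gaussian a) +
          ∫⁻ x, ‖g x - h x‖ₑ ^ p ∂(gaussian a)) + shiftError a p n h z) := by
        rw [lintegral_const_mul' _ _ hct,
          lintegral_add_left (by exact (hDm.add hD).const_mul c),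
          lintegral_const_mul' _ _ hct, lintegral_add_left (by exact hDm), shiftError]
    _ ≤ c * (c * (C * (ε / 2 / (c * (c * (C + 1)))) + ε / 2 / (c * (c * (C + 1)))) +
          ε / 2 / c) := by
        gcongr
        exact (hC _ hD hD0 z hz1).trans (by gcongr)
    _ = c * (c * (C + 1)) * (ε / 2 / (c * (c * (C + 1)))) + c * (ε / 2 / c) := by ring
    _ = ε := by
        rw [ENNReal.mul_div_cancel hc0 hct, ENNReal.mul_div_cancel
          (mul_ne_zero hc0 (mul_ne_zero hc0 (by simp)))
          (ENNReal.mul_ne_top hct (ENNReal.mul_ne_top hct hC1)), ENNReal.add_halves]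

/-! ### Approximation by smooth cylinder functions -/

theorem hasWeakDeriv_self {a : ℕ → ℝ} {p : ℝ} {f : Ell2 → ℝ}
    (hf : MemLp f (ENNReal.ofReal p) ((gaussian a).restrict U)) (i : Fin 0 → ℕ) :
    HasWeakDeriv a p U i f f :=
  ⟨hf, fun φ _ => by rw [List.ofFn_zero]; rfl⟩

/-- The `p`-th power of the Sobolev norm as a sum over all multi-indices, including the empty
one. -/
theorem lintegral_add_derivEnergy {a : ℕ → ℝ} (ha : Weights a) (m : ℕ) {p : ℝ} (hp : 1 ≤ p)
    (hU : IsOpen U) {f : Ell2 → ℝ}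
    (hf : MemLp f (ENNReal.ofReal p) ((gaussian a).restrict U)) :
    ∫⁻ x in U, ENNReal.ofReal (|f x| ^ p) ∂(gaussian a) + derivEnergy a m p U f =
      ∑ k ∈ Finset.range (m + 1), ∑' i : Fin k → ℕ, ENNReal.ofReal (∏ j, a (i j) ^ p) *
        ∫⁻ x in U, ‖weakDeriv a p U i f x‖ₑ ^ p ∂(gaussian a) := by
  have hIcc : Finset.Icc 1 m = (Finset.range m).map ⟨fun k => k + 1, add_left_injective 1⟩ := by
    ext k
    simp only [Finset.mem_Icc, Finset.mem_map, Finset.mem_range, Function.Embedding.coeFn_mk]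
    exact ⟨fun h => ⟨k - 1, by omega, by omega⟩, by rintro ⟨l, h1, rfl⟩; omega⟩
  rw [derivEnergy, hIcc, Finset.sum_map, Finset.sum_range_succ', add_comm]
  simp only [Function.Embedding.coeFn_mk, ofReal_abs_rpow hp]
  congr 1
  rw [tsum_eq_single default fun i hi => absurd (Subsingleton.elim i default) hi]
  simp only [Finset.univ_eq_empty, Finset.prod_empty, ENNReal.ofReal_one, one_mul]
  refine lintegral_congr_ae ?_
  have h := hasWeakDeriv_self hf default
  filter_upwards [(hasWeakDeriv_weakDeriv ⟨f, h⟩).unique ha hp hU h (ae_eq_refl _)] with x hx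
  rw [hx]

/-- A Borel representative of the extension by zero that vanishes off a centred ball. -/
theorem exists_measurable_rep {a : ℕ → ℝ} {p : ℝ} (hU : IsOpen U) {g : Ell2 → ℝ}
    (hg : MemLp g (ENNReal.ofReal p) ((gaussian a).restrict U)) {c : Ell2} {r : ℝ}
    (hg0 : ∀ᵐ x ∂((gaussian a).restrict U), x ∉ Metric.ball c r → g x = 0) :
    ∃ g₀ : Ell2 → ℝ, Measurable g₀ ∧ g₀ =ᵐ[gaussian a] U.indicator g ∧
      MemLp g₀ (ENNReal.ofReal p) (gaussian a) ∧ ∀ x, ‖c‖ + r ≤ ‖x‖ → g₀ x = 0 := by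
  have hLp : MemLp (U.indicator g) (ENNReal.ofReal p) (gaussian a) :=
    (memLp_indicator_iff_restrict hU.measurableSet).2 hg
  set q := hLp.aestronglyMeasurable.mk (U.indicator g) with hq
  have hqm : Measurable q := hLp.aestronglyMeasurable.stronglyMeasurable_mk.measurable
  have hae : (Metric.ball (0 : Ell2) (‖c‖ + r)).indicator q =ᵐ[gaussian a] U.indicator g := by
    rw [ae_restrict_iff' hU.measurableSet] at hg0
    filter_upwards [hLp.aestronglyMeasurable.ae_eq_mk, hg0] with x hx hx0
    by_cases hxb : x ∈ Metric.ball (0 : Ell2) (‖c‖ + r)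
    · rw [indicator_of_mem hxb, hx]
    · rw [indicator_of_notMem hxb]
      by_cases hxU : x ∈ U
      · rw [indicator_of_mem hxU, hx0 hxU]
        intro hxc
        apply hxb
        rw [mem_ball_iff_norm] at hxc
        rw [mem_ball_zero_iff]
        have := norm_sub_norm_le x c
        linarith
      · rw [indicator_of_notMem hxU]
  refine ⟨_, hqm.indicator Metric.isOpen_ball.measurableSet, hae, hLp.ae_eq hae.symm, ?_⟩
  intro x hx
  refine indicator_of_notMem ?_ _
  rw [mem_ball_zero_iff]
  exact not_lt.2 hx

/-- Mollifiers supported near the origin, on the side of negative first coordinate. -/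
theorem exists_mollifier {n : ℕ} (hn : 0 < n) {s : ℝ} (hs : 0 < s) :
    ∃ ρ : (Fin n → ℝ) → ℝ, ContDiff ℝ ∞ ρ ∧ HasCompactSupport ρ ∧ (∀ z, 0 ≤ ρ z) ∧
      ∫⁻ z, ENNReal.ofReal (ρ z) = 1 ∧ (∀ z, ρ z ≠ 0 → z ⟨0, hn⟩ ≤ -(s / 4)) ∧
      ∀ z, ρ z ≠ 0 → ‖z‖ < s := by
  let v : Fin n → ℝ := fun _ => -(s / 2)
  let b : ContDiffBump v := ⟨s / 8, s / 4, by positivity, by linarith⟩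
  have hsupp : ∀ z, b.normed volume z ≠ 0 → ‖z - v‖ < s / 4 := by
    intro z hz
    have h1 : z ∈ Function.support (b.normed volume) := hz
    rw [b.support_normed_eq, mem_ball_iff_norm] at h1
    exact h1
  refine ⟨b.normed volume, b.contDiff_normed, b.hasCompactSupport_normed, b.nonneg_normed, ?_,
    fun z hz => ?_, fun z hz => ?_⟩
  · rw [← ofReal_integral_eq_lintegral_ofReal b.integrable_normed
      (Eventually.of_forall b.nonneg_normed), b.integral_normed, ENNReal.ofReal_one]
  · have h1 := (norm_le_pi_norm (z - v) ⟨0, hn⟩).trans_lt (hsupp z hz)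
    rw [Pi.sub_apply, Real.norm_eq_abs, abs_lt] at h1
    have h2 : v ⟨0, hn⟩ = -(s / 2) := rfl
    rw [h2] at h1
    linarith
  · have h1 : ‖v‖ ≤ s / 2 := by
      refine (pi_norm_le_iff_of_nonneg (by positivity)).2 fun j => ?_
      change ‖-(s / 2)‖ ≤ s / 2
      rw [norm_neg, Real.norm_eq_abs, abs_of_pos (by positivity)]
    have h2 := norm_sub_norm_le z v
    have := hsupp z hz
    linarith

/-- Dominated convergence to zero for series in `ℝ≥0∞`. -/
theorem tendsto_tsum_of_dominated_ennreal {ι : Type*} [Countable ι] {F : ℕ → ι → ℝ≥0∞}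
    {b : ι → ℝ≥0∞} (hb : ∑' i, b i ≠ ⊤) (hF : ∀ n i, F n i ≤ b i)
    (h : ∀ i, Tendsto (fun n => F n i) atTop (𝓝 0)) :
    Tendsto (fun n => ∑' i, F n i) atTop (𝓝 0) := by
  let _ : MeasurableSpace ι := ⊤
  have h1 := tendsto_lintegral_of_dominated_convergence (μ := Measure.count) (F := F)
    (f := fun _ => 0) b (fun n => measurable_from_top)
    (fun n => Eventually.of_forall (hF n)) (by rwa [lintegral_count])
    (Eventually.of_forall h)
  simpa only [lintegral_count, lintegral_zero] using h1

theorem finite_multiIndex_lt (k n : ℕ) : {i : Fin k → ℕ | ∀ j, i j < n}.Finite := by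
  have : {i : Fin k → ℕ | ∀ j, i j < n} = Set.pi univ fun _ => Set.Iio n := by
    ext i; simp [Set.mem_pi]
  rw [this]
  exact Set.Finite.pi fun _ => finite_Iio n

open Classical in
/-- Approximation up to a given error. The number `n` of coordinates is chosen first, to make the
resampling errors and the contribution of derivatives in coordinates beyond the first `n` small; only
finitely many derivatives remain, and the support of the mollifier is chosen for these. -/
theorem exists_cylinder_approx {a : ℕ → ℝ} (ha : Weights a) {m : ℕ} {p : ℝ} (hp : 1 ≤ p)
    (hU : IsOpen U) (hUH : U ⊆ halfSpace) {f : Ell2 → ℝ} (hf : MemSobolev a m p U f)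
    {c : Ell2} {r R : ℝ} (hr : 0 < r) (hrR : r < R) (hb : Metric.ball c R ∩ halfSpace ⊆ U)
    (hs : lpSupport a p U f ⊆ Metric.ball c r) {ε : ℝ≥0∞} (hε : ε ≠ 0) (hεt : ε ≠ ⊤) :
    ∃ φ : Ell2 → ℝ, IsSmoothCylinder φ ∧ MemSobolev a m p U (φ - f) ∧
      ∫⁻ x in U, ENNReal.ofReal (|(φ - f) x| ^ p) ∂(gaussian a) +
        derivEnergy a m p U (φ - f) ≤ ε := by
  have := ha.isProbabilityMeasure
  have hp0 : 0 < p := by linarith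
  set M : ℝ≥0∞ := 2 ^ (p - 1) with hM
  have hMt : M ≠ ⊤ := two_rpow_ne_top hp
  obtain ⟨-, hg0⟩ := ae_eq_zero_off_ball ha hp hU hf.1 hs
  have hD : ∀ k, k ≤ m → ∀ i : Fin k → ℕ, HasWeakDeriv a p U i f (weakDeriv a p U i f) := by
    intro k hk i
    refine hasWeakDeriv_weakDeriv ?_
    rcases Nat.eq_zero_or_pos k with rfl | hk0
    · exact ⟨f, hasWeakDeriv_self hf.1 i⟩
    · exact hf.2.1 k hk0 hk i
  -- Representatives of the weak derivatives, defined on the whole space.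
  have hrep : ∀ k (i : Fin k → ℕ), ∃ g₀ : Ell2 → ℝ, k ≤ m → Measurable g₀ ∧
      g₀ =ᵐ[gaussian a] U.indicator (weakDeriv a p U i f) ∧
      MemLp g₀ (ENNReal.ofReal p) (gaussian a) ∧ ∀ x, ‖c‖ + r ≤ ‖x‖ → g₀ x = 0 := by
    intro k i
    by_cases hk : k ≤ m
    · obtain ⟨g₀, hg₀⟩ := exists_measurable_rep hU (hD k hk i).1 (hg0 (hD k hk i))
      exact ⟨g₀, fun _ => hg₀⟩
    · exact ⟨0, fun h => absurd h hk⟩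
  choose g hg using hrep
  have hgi : ∀ k, k ≤ m → ∀ i : Fin k → ℕ, Integrable (g k i) (gaussian a) := fun k hk i =>
    (hg k i hk).2.2.1.integrable (one_le_ofReal hp)
  have hgU : ∀ k, k ≤ m → ∀ i : Fin k → ℕ,
      g k i =ᵐ[(gaussian a).restrict U] weakDeriv a p U i f := by
    intro k hk i
    filter_upwards [ae_restrict_of_ae (hg k i hk).2.1, ae_restrict_mem hU.measurableSet]
      with x hx hxU
    rw [hx, indicator_of_mem hxU]
  set w : ∀ k, (Fin k → ℕ) → ℝ≥0∞ := fun k i => ENNReal.ofReal (∏ j, a (i j) ^ p) with hw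
  set N : ∀ k, (Fin k → ℕ) → ℝ≥0∞ := fun k i => ∫⁻ x, ‖g k i x‖ₑ ^ p ∂(gaussian a) with hN
  have hNU : ∀ k, k ≤ m → ∀ i : Fin k → ℕ,
      N k i = ∫⁻ x in U, ‖weakDeriv a p U i f x‖ₑ ^ p ∂(gaussian a) := by
    intro k hk i
    rw [hN, ← lintegral_indicator hU.measurableSet]
    refine lintegral_congr_ae ?_
    filter_upwards [(hg k i hk).2.1] with x hx
    rw [hx]
    by_cases hxU : x ∈ U
    · simp [hxU]
    · simp [hxU, hp0]
  have hsum : ∀ k, k ≤ m → ∑' i, w k i * N k i ≠ ⊤ := by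
    intro k hk
    have h1 : ∫⁻ x in U, ENNReal.ofReal (|f x| ^ p) ∂(gaussian a) + derivEnergy a m p U f < ⊤ := by
      refine ENNReal.add_lt_top.2 ⟨?_, hf.2.2⟩
      simp only [ofReal_abs_rpow hp]
      exact lintegral_enorm_rpow_lt_top hp hf.1
    rw [lintegral_add_derivEnergy ha m hp hU hf.1, ENNReal.sum_lt_top] at h1
    simp only [hNU k hk, hw]
    exact (h1 k (Finset.mem_range.2 (by omega))).ne
  -- The part of the error that depends on the number of coordinates only.
  set B : ℕ → ∀ k, (Fin k → ℕ) → ℝ≥0∞ := fun n k i =>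
    if ∀ j, i j < n then M * resampleError a p n (g k i) else N k i with hB
  have hBt : Tendsto (fun n => ∑ k ∈ Finset.range (m + 1), ∑' i, w k i * B n k i) atTop (𝓝 0) := by
    rw [← Finset.sum_const_zero (ι := ℕ) (s := Finset.range (m + 1))]
    refine tendsto_finsetSum _ fun k hk => ?_
    have hkm : k ≤ m := by
      have := Finset.mem_range.1 hk
      omega
    refine tendsto_tsum_of_dominated_ennreal
      (b := fun i => (M * (M * 2) + 1) * (w k i * N k i)) ?_ (fun n i => ?_) fun i => ?_
    · rw [ENNReal.tsum_mul_left]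
      exact ENNReal.mul_ne_top (ENNReal.add_ne_top.2
        ⟨ENNReal.mul_ne_top hMt (ENNReal.mul_ne_top hMt (by simp)), by simp⟩) (hsum k hkm)
    · have h1 : B n k i ≤ (M * (M * 2) + 1) * N k i := by
        simp only [hB]
        split_ifs
        · calc _ ≤ M * (M * (2 * N k i)) := by
                gcongr
                exact resampleError_le ha hp n (hg k i hkm).1
            _ = M * (M * 2) * N k i := by ring
            _ ≤ _ := by gcongr; exact le_self_add
        · calc _ = 1 * N k i := (one_mul _).symm
            _ ≤ _ := by gcongr; exact le_add_self
      calc _ ≤ w k i * ((M * (M * 2) + 1) * N k i) := by gcongr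
        _ = _ := by ring
    · have h1 := tendsto_resampleError ha hp (hg k i hkm).1 (hg k i hkm).2.2.1
      have h2 := ENNReal.Tendsto.const_mul (a := w k i * M) h1
        (Or.inr (ENNReal.mul_ne_top ENNReal.ofReal_ne_top hMt))
      rw [mul_zero] at h2
      refine h2.congr' ?_
      have hev : ∀ᶠ n in atTop, ∀ j, i j < n :=
        eventually_all.2 fun j => eventually_gt_atTop (i j)
      filter_upwards [hev] with n hn
      simp only [hB, if_pos hn, mul_assoc]
  have hε2 : 0 < ε / 2 := ENNReal.half_pos hε
  obtain ⟨n, hnB, hn⟩ :=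
    ((ENNReal.tendsto_nhds_zero.1 hBt (ε / 2) hε2).and (eventually_gt_atTop 0)).exists
  -- Only finitely many derivatives are taken in the first `n` coordinates.
  set S : ℝ≥0∞ := ∑ k ∈ Finset.range (m + 1), ∑' i : Fin k → ℕ,
    if ∀ j, i j < n then w k i else 0 with hS
  have hSt : S ≠ ⊤ := by
    refine (ENNReal.sum_lt_top.2 fun k _ => ?_).ne
    rw [tsum_eq_sum (s := (finite_multiIndex_lt k n).toFinset) fun i hi => by
      rw [Set.Finite.mem_toFinset] at hi
      exact if_neg hi]
    refine ENNReal.sum_lt_top.2 fun i _ => ?_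
    split_ifs
    · exact ENNReal.ofReal_lt_top
    · simp
  have hMS : M * (S + 1) ≠ ⊤ := ENNReal.mul_ne_top hMt (ENNReal.add_ne_top.2 ⟨hSt, by simp⟩)
  set δ := ε / 2 / (M * (S + 1)) with hδ
  have hδ0 : 0 < δ := ENNReal.div_pos hε2.ne' hMS
  have hshift : ∀ᶠ z in 𝓝 (0 : Fin n → ℝ), ∀ k ∈ Finset.range (m + 1),
      ∀ i ∈ {i : Fin k → ℕ | ∀ j, i j < n}, shiftError a p n (g k i) z ≤ δ := by
    rw [Finset.eventually_all]
    intro k hk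
    rw [eventually_all_finite (finite_multiIndex_lt k n)]
    intro i _
    have hkm : k ≤ m := by
      have := Finset.mem_range.1 hk
      omega
    exact ENNReal.tendsto_nhds_zero.1 (tendsto_shiftError ha hp n (hg k i hkm).1
      (hg k i hkm).2.2.1 (by positivity) (hg k i hkm).2.2.2) δ hδ0
  obtain ⟨s, hs0, hsδ⟩ := Metric.eventually_nhds_iff_ball.1 hshift
  obtain ⟨ρ, hρ, hρc, hρ0, hρ1, hρneg, hρs⟩ := exists_mollifier hn hs0
  -- The approximating function.
  have hk0 : 0 ≤ m := Nat.zero_le m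
  set f₀ := g 0 default with hf₀
  have hf₀U : f₀ =ᵐ[gaussian a] U.indicator f := by
    have h1 := (hD 0 hk0 default).unique ha hp hU (hasWeakDeriv_self hf.1 default) (ae_eq_refl _)
    rw [EventuallyEq, ae_restrict_iff' hU.measurableSet] at h1
    filter_upwards [(hg 0 default hk0).2.1, h1] with x hx hx1
    rw [hf₀, hx]
    by_cases hxU : x ∈ U
    · rw [indicator_of_mem hxU, indicator_of_mem hxU, hx1 hxU]
    · rw [indicator_of_notMem hxU, indicator_of_notMem hxU]
  have hF := integrable_inv_headPDF_mul ha n (hgi 0 hk0 default) (hg 0 default hk0).2.2.2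
  have huc := contDiff_mollify hF hρ hρc
  have hus := hasCompactSupport_mollify (a := a) (hg 0 default hk0).2.2.2 hρc
  set φ : Ell2 → ℝ := fun x => mollify a n ρ f₀ (headL n x) with hφ
  have hφs : BddSmooth φ := bddSmooth_comp_headL huc hus
  have hφU : CoordSmooth U φ := hφs.coordSmooth U
  have hwd : ∀ k, k ≤ m → ∀ i : Fin k → ℕ, HasWeakDeriv a p U i (φ - f)
      (iterD (List.ofFn i) φ - weakDeriv a p U i f) := fun k hk i =>
    (hφU.hasWeakDeriv ha p hU i).sub ha hp hU (hφU.bddFCont.memLp ha hU _) hf.1 (hD k hk i)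
  have hφf : MemLp (φ - f) (ENNReal.ofReal p) ((gaussian a).restrict U) :=
    (hφU.bddFCont.memLp ha hU _).sub hf.1
  have herr : ∀ k ∈ Finset.range (m + 1), ∀ i : Fin k → ℕ,
      ∫⁻ x in U, ‖weakDeriv a p U i (φ - f) x‖ₑ ^ p ∂(gaussian a) ≤
        (if ∀ j, i j < n then M * δ else 0) + B n k i := by
    intro k hk i
    have hkm : k ≤ m := by
      have := Finset.mem_range.1 hk
      omega
    have h1 : ∫⁻ x in U, ‖weakDeriv a p U i (φ - f) x‖ₑ ^ p ∂(gaussian a) =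
        ∫⁻ x in U, ‖(if ∀ j, i j < n then mollify a n ρ (g k i) (headL n x) else 0) -
          g k i x‖ₑ ^ p ∂(gaussian a) := by
      refine lintegral_congr_ae ?_
      filter_upwards [(hasWeakDeriv_weakDeriv ⟨_, hwd k hkm i⟩).unique ha hp hU (hwd k hkm i)
        (ae_eq_refl _), hgU k hkm i, ae_restrict_mem hU.measurableSet] with x hx1 hx2 hxU
      rw [hx1, Pi.sub_apply, hφ, iterD_mollify ha hp hU hf.1 hr hrR hb hs hn hρ hρc
        (by positivity) hρneg i (hD k hkm i) hf₀U (hg k i hkm).2.1 hF (hUH hxU), hx2]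
    rw [h1]
    refine (setLIntegral_le_lintegral _ _).trans ?_
    simp only [hB]
    split_ifs with hi
    · rw [← mul_add]
      refine lintegral_mollify_sub_le ha hp (hg k i hkm).1 (hgi k hkm i) hρ hρc hρ0 hρ1
        fun z hz => ?_
      exact hsδ z (by rw [mem_ball_zero_iff]; exact hρs z hz) k hk i hi
    · simp only [zero_sub, enorm_neg, zero_add, hN, le_refl]
  have htotal : ∫⁻ x in U, ENNReal.ofReal (|(φ - f) x| ^ p) ∂(gaussian a) +
      derivEnergy a m p U (φ - f) ≤ ε := by
    rw [lintegral_add_derivEnergy ha m hp hU hφf]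
    calc _ ≤ ∑ k ∈ Finset.range (m + 1), ∑' i : Fin k → ℕ,
          (M * δ * (if ∀ j, i j < n then w k i else 0) + w k i * B n k i) := by
          refine Finset.sum_le_sum fun k hk => ENNReal.tsum_le_tsum fun i => ?_
          refine (mul_le_mul_right (herr k hk i) _).trans (le_of_eq ?_)
          rw [mul_add]
          congr 1
          split_ifs
          · exact mul_comm _ _
          · simp
      _ = M * δ * S + ∑ k ∈ Finset.range (m + 1), ∑' i, w k i * B n k i := by
          rw [hS, Finset.mul_sum, ← Finset.sum_add_distrib]
          refine Finset.sum_congr rfl fun k _ => ?_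
          rw [ENNReal.tsum_add, ENNReal.tsum_mul_left]
      _ ≤ ε / 2 + ε / 2 := by
          gcongr
          calc M * δ * S ≤ M * δ * (S + 1) := by gcongr; exact le_self_add
            _ = δ * (M * (S + 1)) := by ring
            _ ≤ ε / 2 := ENNReal.mul_le_of_le_div le_rfl
      _ = ε := ENNReal.add_halves ε
  refine ⟨φ, ⟨n, mollify a n ρ f₀, hn, huc, hus, fun x => rfl⟩,
    ⟨hφf, fun k _ hk i => ⟨_, hwd k hk i⟩, ?_⟩, htotal⟩
  exact (le_add_self.trans htotal).trans_lt hεt.lt_top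

/-- Functions whose support has a positive distance from the part of the boundary of `U` inside the
half-space are limits of smooth cylinder functions. -/
theorem exists_cylinder_sequence {a : ℕ → ℝ} (ha : Weights a) {m : ℕ} {p : ℝ} (hp : 1 ≤ p)
    (hU : IsOpen U) (hUH : U ⊆ halfSpace) {f : Ell2 → ℝ} (hf : MemSobolev a m p U f)
    {c : Ell2} {r R : ℝ} (hr : 0 < r) (hrR : r < R) (hb : Metric.ball c R ∩ halfSpace ⊆ U)
    (hs : lpSupport a p U f ⊆ Metric.ball c r) :
    ∃ φ : ℕ → Ell2 → ℝ, (∀ j, IsSmoothCylinder (φ j)) ∧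
      (∀ j, MemSobolev a m p U (φ j - f)) ∧
      Tendsto (fun j => sobolevNorm a m p U (φ j - f)) atTop (𝓝 0) := by
  have hp0 : 0 < p := by linarith
  have h := fun j : ℕ => exists_cylinder_approx ha hp hU hUH hf hr hrR hb hs
    (ε := ((j : ℝ≥0∞) + 1)⁻¹) (by simp) (by simp)
  choose φ hφ1 hφ2 hφ3 using h
  refine ⟨φ, hφ1, hφ2, ?_⟩
  have hlim : Tendsto (fun j : ℕ => ((j : ℝ≥0∞) + 1)⁻¹) atTop (𝓝 0) := by
    have h1 := ENNReal.tendsto_inv_nat_nhds_zero.comp (tendsto_add_atTop_nat 1)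
    simpa [Function.comp_def] using h1
  have hlim2 := hlim.ennrpow_const (1 / p)
  rw [ENNReal.zero_rpow_of_pos (by positivity)] at hlim2
  refine tendsto_of_tendsto_of_tendsto_of_le_of_le tendsto_const_nhds hlim2 (fun _ => zero_le)
    fun j => ?_
  exact ENNReal.rpow_le_rpow (hφ3 j) (by positivity)

end

end Ell2

theorem mainTheorem9 (a : ℕ → ℝ) (ha_pos : ∀ i, 0 < a i) (ha_sum : Summable a)
    (ha_lt : ∑' i, a i < 1) (m : ℕ) (hm : 1 ≤ m) (p : ℝ) (hp : 1 ≤ p)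
    (O : Set Ell2) (hO : IsOpen O)
    (x₀ : Ell2) (hx₀ : x₀ ∈ frontier Ell2.halfSpace ∩ O)
    (f : Ell2 → ℝ) (hf : Ell2.MemSobolev a m p (Ell2.halfSpace ∩ O) f)
    (r₁ r₂ : ℝ) (hr₁ : 0 < r₁) (hr₁₂ : r₁ < r₂)
    (hsupp : Ell2.lpSupport a p (Ell2.halfSpace ∩ O) f ⊆ Metric.ball x₀ r₁)
    (hball : Metric.ball x₀ r₂ ∩ Ell2.halfSpace ⊆ O) :
    Ell2.MemSobolev a m p Ell2.halfSpace ((Ell2.halfSpace ∩ O).indicator f) ∧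
    (∀ k : ℕ, 1 ≤ k → k ≤ m → ∀ i : Fin k → ℕ,
      Ell2.weakDeriv a p Ell2.halfSpace i ((Ell2.halfSpace ∩ O).indicator f)
        =ᵐ[(Ell2.gaussian a).restrict Ell2.halfSpace]
      (Ell2.halfSpace ∩ O).indicator (Ell2.weakDeriv a p (Ell2.halfSpace ∩ O) i f)) ∧
    ∃ φ : ℕ → Ell2 → ℝ,
      (∀ j, Ell2.IsSmoothCylinder (φ j)) ∧
      (∀ j, Ell2.MemSobolev a m p (Ell2.halfSpace ∩ O) (φ j - f)) ∧
      Tendsto (fun j => Ell2.sobolevNorm a m p (Ell2.halfSpace ∩ O) (φ j - f)) atTop (𝓝 0) := by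
  have ha : Ell2.Weights a := ⟨ha_pos, ha_sum, ha_lt⟩
  have hU : IsOpen (Ell2.halfSpace ∩ O) := Ell2.isOpen_halfSpace.inter hO
  have hUH : Ell2.halfSpace ∩ O ⊆ Ell2.halfSpace := inter_subset_left
  have hb : Metric.ball x₀ r₂ ∩ Ell2.halfSpace ⊆ Ell2.halfSpace ∩ O := fun x hx =>
    ⟨hx.2, hball hx⟩
  obtain ⟨h1, h2⟩ :=
    Ell2.extension_by_zero ha hp hU Ell2.isOpen_halfSpace hUH hf hr₁ hr₁₂ hb hsupp
  exact ⟨h1, h2, Ell2.exists_cylinder_sequence ha hp hU hUH hf hr₁ hr₁₂ hb hsupp⟩
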